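/- Let $\mathbb K\in\{\mathbb R,\mathbb C\}$, $a<b$, and consider the linear hyperbolic boundary control system $$\partial_t x(\xi,t)=P_1\,\partial_\xi\big(\mathcal H(\xi)x(\xi,t)\big)+P_0(\xi)\mathcal H(\xi)x(\xi,t),\qquad \xi\in[a,b],\ t\ge 0,$$ $$u(t)=\widetilde W_B\begin{bmatrix}(\mathcal Hx)(b,t)\\(\mathcal Hx)(a,t)\end{bmatrix},\qquad y(t)=\widetilde W_C\begin{bmatrix}(\mathcal Hx)(b,t)\\(\mathcal Hx)(a,t)\end{bmatrix},$$ under the following assumptions. 1. $P_1\in\mathbb K^{n\times n}$ is invertible and self-adjoint. 2. $P_0\in L^\infty([a,b],\mathbb K^{n\times n})$. 3. $\mathcal H\in L^\infty([a,b],\mathbb K^{n\times n})$, $\mathcal H(\xi)$ is self-adjoint for a.e. $\xi$, and there are $m,M>0$ with $mI_n\le\mathcal H(\xi)\le MI_n$ for a.e. $\xi$. 4. $\widetilde W_B,\widetilde W_C\in\mathbb K^{n\times 2n}$, and both $\widetilde W_B$ and $\begin{bmatrix}\widetilde W_B\\ \widetilde W_C\end{bmatrix}\in\mathbb K^{2n\times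 2n}$ have full rank. 5. For $p\in\{1,2\}$ let $A_p x_0:=P_1(\mathcal Hx_0)'+P_0\mathcal Hx_0$ be the operator on $L^p([a,b],\mathbb K^n)$ with domain $$\mathrm D(A_p)=\Big\{x_0\in L^p([a,b],\mathbb K^n)\ \Big|\ \mathcal Hx_0\in W^{1,p}([a,b],\mathbb K^n),\ \widetilde W_B\begin{bmatrix}(\mathcal Hx_0)(b)\\(\mathcal Hx_0)(a)\end{bmatrix}=0\Big\}.$$ The operator $A_2$ generates a $C_0$-semigroup on $L^2([a,b],\mathbb K^n)$. 6. There are $S,\mathcal H^D\in C^1([a,b],\mathbb K^{n\times n})$ and $0\le m\le n$ such that $S$ is pointwise invertible, $\mathcal H^D$ is pointwise diagonal and positive definite, and $P_1\mathcal H=S^{-1}\begin{bmatrix}I_m&0\\0&-I_{n-m}\end{bmatrix}\mathcal H^DS$ a.e. on $[a,b]$. Suppose that the system is exponentially stable on the state space $L^1([a,b],\mathbb K^n)$, that is, $A_1$ generates a $C_0$-semigroup $(T(t))_{t\ge0}$ on $L^1([a,b],\mathbb K^n)$ and there are $M\in\mathbb R$, $\omega>0$ with $\|T(t)\|\le Me^{-\omega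 t}$ for all $t\ge0$. Then the system is BIBO stable: there is $c>0$ such that for every classical solution $(u,x,y)$, i.e. $u,y\in C([0,\infty),\mathbb K^n)$ and $x\in C^1([0,\infty),L^2([a,b],\mathbb K^n))$ satisfying the above equations for all $t\ge0$, with $x(0)=0$ and $u\in C_c^\infty([0,\infty),\mathbb K^n)$, and for every $t>0$, $$\|y\|_{L^\infty([0,t])}\le c\,\|u\|_{L^\infty([0,t])}.$$ -/

import Mathlib

open MeasureTheory Set Filter Topology
open scoped ComplexOrder NNReal ENNReal

/-- A strongly continuous (`C₀`-) semigroup of bounded operators on a Banach space `X`. -/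
structure C0Semigroup (𝕜 : Type*) [RCLike 𝕜] (X : Type*) [NormedAddCommGroup X]
    [NormedSpace 𝕜 X] where
  T : ℝ≥0 → X →L[𝕜] X
  map_zero : T 0 = ContinuousLinearMap.id 𝕜 X
  map_add : ∀ s t : ℝ≥0, T (s + t) = (T s).comp (T t)
  strongly_continuous : ∀ x : X, Tendsto (fun t => T t x) (𝓝 0) (𝓝 x)

namespace C0Semigroup

variable {𝕜 : Type*} [RCLike 𝕜] {X : Type*} [NormedAddCommGroup X] [NormedSpace 𝕜 X]

/-- `A`, an operator given by its graph, is the infinitesimal generator of the semigroup: a pair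
`(x, z)` lies in the graph iff `(T h x - x) / h` converges to `z` as `h ↓ 0`. In particular the
domain of `A` is exactly the set of `x` for which this limit exists. -/
def IsGenerator (S : C0Semigroup 𝕜 X) (A : Set (X × X)) : Prop :=
  ∀ x z : X, (x, z) ∈ A ↔
    Tendsto (fun h : ℝ≥0 => (((h : ℝ) : 𝕜))⁻¹ • (S.T h x - x)) (𝓝[>] 0) (𝓝 z)

/-- Exponential stability: `‖T t‖ ≤ M e^{-ω t}` for all `t ≥ 0`, with some `ω > 0`. -/
def IsExponentiallyStable (S : C0Semigroup 𝕜 X) : Prop :=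
  ∃ M ω : ℝ, 0 < ω ∧ ∀ t : ℝ≥0, ‖S.T t‖ ≤ M * Real.exp (-ω * t)

end C0Semigroup

/-- `v : [a,b] → E` is (the continuous representative of) an element of the Sobolev space
`W^{1,p}([a,b], E)` with weak derivative `g ∈ L^p([a,b], E)`. For `p = 2` this is `H¹`. -/
def IsSobolevOnInterval {E : Type*} [NormedAddCommGroup E] [NormedSpace ℝ E]
    (p : ℝ≥0∞) (a b : ℝ) (v g : ℝ → E) : Prop :=
  MemLp g p (volume.restrict (Icc a b)) ∧ ∀ ξ ∈ Icc a b, v ξ = v a + ∫ s in a..ξ, g s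

/-- The data of a linear hyperbolic boundary control system on the interval `[a,b]`:
`∂ₜ x = P₁ ∂_ξ (H x) + P₀ (H x)`, `u = W_B [(H x)(b); (H x)(a)]`, `y = W_C [(H x)(b); (H x)(a)]`.
The matrix functions `P₀` and `H` only matter almost everywhere on `[a,b]`. -/
structure HBCS (𝕜 : Type*) [RCLike 𝕜] (n : ℕ) where
  a : ℝ
  b : ℝ
  a_lt_b : a < b
  P₁ : Matrix (Fin n) (Fin n) 𝕜
  P₀ : ℝ → Matrix (Fin n) (Fin n) 𝕜
  H : ℝ → Matrix (Fin n) (Fin n) 𝕜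
  W_B : Matrix (Fin n) (Fin n ⊕ Fin n) 𝕜
  W_C : Matrix (Fin n) (Fin n ⊕ Fin n) 𝕜

namespace HBCS

variable {𝕜 : Type*} [RCLike 𝕜] {n : ℕ}

/-- Lebesgue measure on the spatial interval `[a,b]`. -/
noncomputable abbrev μ (sys : HBCS 𝕜 n) : Measure ℝ := volume.restrict (Icc sys.a sys.b)

/-- The space `L^p([a,b], 𝕜ⁿ)`. -/
abbrev StateSpace (sys : HBCS 𝕜 n) (p : ℝ≥0∞) : Type _ :=
  Lp (EuclideanSpace 𝕜 (Fin n)) p sys.μ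

/-- The boundary vector `[v(b); v(a)]` in `𝕜²ⁿ`. -/
def boundaryVector (sys : HBCS 𝕜 n) (v : ℝ → EuclideanSpace 𝕜 (Fin n)) :
    EuclideanSpace 𝕜 (Fin n ⊕ Fin n) :=
  WithLp.toLp 2 (Sum.elim (v sys.b).ofLp (v sys.a).ofLp)

/-- `x` and `z` in `L^p` and the function `v` satisfy: `v` is the continuous representative of
`H x ∈ W^{1,p}([a,b], 𝕜ⁿ)` and `z = P₁ ∂_ξ (H x) + P₀ (H x)`. No boundary condition is imposed. -/
def IsDiffExpr (sys : HBCS 𝕜 n) (p : ℝ≥0∞) (x z : sys.StateSpace p)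
    (v : ℝ → EuclideanSpace 𝕜 (Fin n)) : Prop :=
  (∀ᵐ ξ ∂sys.μ, v ξ = (sys.H ξ).toEuclideanLin (x ξ)) ∧
  ∃ g : ℝ → EuclideanSpace 𝕜 (Fin n),
    IsSobolevOnInterval p sys.a sys.b v g ∧
    ∀ᵐ ξ ∂sys.μ, z ξ = sys.P₁.toEuclideanLin (g ξ) + (sys.P₀ ξ).toEuclideanLin (v ξ)

/-- The graph of the operator `A = P₁ ∂_ξ H + P₀ H` on `L^p([a,b], 𝕜ⁿ)` with domain
`{x | H x ∈ W^{1,p}, W_B [(H x)(b); (H x)(a)] = 0}`. -/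
def operatorGraph (sys : HBCS 𝕜 n) (p : ℝ≥0∞) : Set (sys.StateSpace p × sys.StateSpace p) :=
  {q | ∃ v : ℝ → EuclideanSpace 𝕜 (Fin n), sys.IsDiffExpr p q.1 q.2 v ∧
    sys.W_B.toEuclideanLin (sys.boundaryVector v) = 0}

/-- The standing assumptions on a hyperbolic boundary control system. In the last one, the norm of
`L²([a,b], 𝕜ⁿ)` is used; the inner product `½ ∫ g* H f` induces an equivalent norm since `H` is
bounded and uniformly positive, and being a generator does not depend on this choice. -/
structure StandingAssumptions (sys : HBCS 𝕜 n) : Prop where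
  P₁_isUnit : IsUnit sys.P₁
  P₁_selfAdjoint : sys.P₁.IsHermitian
  P₀_bounded : ∀ i j, MemLp (fun ξ => sys.P₀ ξ i j) ∞ sys.μ
  H_bounded : ∀ i j, MemLp (fun ξ => sys.H ξ i j) ∞ sys.μ
  H_selfAdjoint : ∀ᵐ ξ ∂sys.μ, (sys.H ξ).IsHermitian
  H_bounds : ∃ m M : ℝ, 0 < m ∧ 0 < M ∧ ∀ᵐ ξ ∂sys.μ,
    (sys.H ξ - (m : 𝕜) • (1 : Matrix (Fin n) (Fin n) 𝕜)).PosSemidef ∧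
    ((M : 𝕜) • (1 : Matrix (Fin n) (Fin n) 𝕜) - sys.H ξ).PosSemidef
  W_B_fullRank : sys.W_B.rank = n
  W_fullRank : (Matrix.fromRows sys.W_B sys.W_C).rank = 2 * n
  generator : ∃ S : C0Semigroup 𝕜 (sys.StateSpace 2), S.IsGenerator (sys.operatorGraph 2)

/-- `C¹`-diagonalisability: `P₁ H = S⁻¹ P₁ᴰ Hᴰ S` with `S, Hᴰ ∈ C¹([a,b], 𝕜ⁿˣⁿ)`, `S` pointwise
invertible, `Hᴰ` diagonal and positive, and `P₁ᴰ = diag(I_m, -I_{n-m})`. The identity is one between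
`L^∞` functions, hence is required almost everywhere. -/
def IsC1Diagonalisable (sys : HBCS 𝕜 n) : Prop :=
  ∃ (S HD : ℝ → Matrix (Fin n) (Fin n) 𝕜) (m : ℕ), m ≤ n ∧
    (∀ i j, ContDiffOn ℝ 1 (fun ξ => S ξ i j) (Icc sys.a sys.b)) ∧
    (∀ i j, ContDiffOn ℝ 1 (fun ξ => HD ξ i j) (Icc sys.a sys.b)) ∧
    (∀ ξ ∈ Icc sys.a sys.b, IsUnit (S ξ) ∧ (HD ξ).IsDiag ∧ (HD ξ).PosDef) ∧
    ∀ᵐ ξ ∂sys.μ, sys.P₁ * sys.H ξ =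
      (S ξ)⁻¹ * Matrix.diagonal (fun i : Fin n => if (i : ℕ) < m then (1 : 𝕜) else -1) * HD ξ * S ξ

/-- Exponential stability of the system on the state space `L^p([a,b], 𝕜ⁿ)`: the operator `A`,
considered on `L^p([a,b], 𝕜ⁿ)`, generates an exponentially stable `C₀`-semigroup. -/
def IsExponentiallyStableOn (sys : HBCS 𝕜 n) (p : ℝ≥0∞) [Fact (1 ≤ p)] : Prop :=
  ∃ S : C0Semigroup 𝕜 (sys.StateSpace p),
    S.IsGenerator (sys.operatorGraph p) ∧ S.IsExponentiallyStable

/-- Classical solutions `(u, x, y)`: `u, y ∈ C([0,∞), 𝕜ⁿ)` and `x ∈ C¹([0,∞), L²([a,b], 𝕜ⁿ))`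
satisfy the differential equation, the input equation and the output equation for all `t ≥ 0`
(only the values at times `t ≥ 0` matter). -/
def IsClassicalSolution (sys : HBCS 𝕜 n) (u : ℝ → EuclideanSpace 𝕜 (Fin n))
    (x : ℝ → sys.StateSpace 2) (y : ℝ → EuclideanSpace 𝕜 (Fin n)) : Prop :=
  ContinuousOn u (Ici 0) ∧ ContinuousOn y (Ici 0) ∧
  ∃ x' : ℝ → sys.StateSpace 2, ContinuousOn x' (Ici 0) ∧
    ∀ t ∈ Ici (0 : ℝ), HasDerivWithinAt x (x' t) (Ici 0) t ∧
      ∃ v : ℝ → EuclideanSpace 𝕜 (Fin n), sys.IsDiffExpr 2 (x t) (x' t) v ∧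
        u t = sys.W_B.toEuclideanLin (sys.boundaryVector v) ∧
        y t = sys.W_C.toEuclideanLin (sys.boundaryVector v)

/-- BIBO stability: there is `c > 0` with `‖y‖_{L^∞([0,t])} ≤ c ‖u‖_{L^∞([0,t])}` for all `t > 0`
and all classical solutions with `x(0) = 0` and `u ∈ C_c^∞([0,∞), 𝕜ⁿ)`. -/
def IsBIBOStable (sys : HBCS 𝕜 n) : Prop :=
  ∃ c : ℝ≥0, 0 < c ∧
    ∀ (u : ℝ → EuclideanSpace 𝕜 (Fin n)) (x : ℝ → sys.StateSpace 2)
      (y : ℝ → EuclideanSpace 𝕜 (Fin n)),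
      sys.IsClassicalSolution u x y → x 0 = 0 →
      ContDiffOn ℝ (⊤ : ℕ∞) u (Ici 0) → (∃ R : ℝ, ∀ t, R < t → u t = 0) →
      ∀ t : ℝ, 0 < t →
        eLpNorm y ∞ (volume.restrict (Icc 0 t)) ≤
          c * eLpNorm u ∞ (volume.restrict (Icc 0 t))

end HBCS

/-! ### Duhamel's formula for bounded semigroups. -/

namespace C0Semigroup

variable {X : Type*} [NormedAddCommGroup X] [NormedSpace ℝ X]

/-! A convolution `y = h * u` maps bounded inputs to bounded outputs as soon as `h` has finite total
variation, and exponential stability on `L¹` is what bounds the total variation of the impulse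
response. To stay with functions, impulses are mollified. Let `φ` be a bump of mass one supported in
`(0, 1)`, and let `z i` be the solution with zero history for the input `φ e i`, where `e` is a
basis of the input space. The `L¹` norm in time of the output of `z i` is bounded independently of
`φ` (`exists_impulseResponse_bound`): on each unit time interval it is controlled by the state at
the beginning and the `L¹` norm of the input, and the states decay geometrically. By uniqueness, `φ
* y` is the sum of the convolutions of the input coordinates with the outputs of the `z i`
(`response_identity`). Letting `φ` concentrate at zero gives the supremum bound for `y`
(`exists_output_bound`).

The analytic input is a finite time estimate (`EnergyEstimate`). In characteristic coordinates `w =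
S P₁ H x` the equation is diagonal transport up to bounded terms. Weight the `L¹` norm of `w i`,
divided by the speed `d i`, with an affine weight that is one at the outgoing end and a small `δ` at
the incoming end. Along solutions its derivative is at most `∑ (δ |incoming| - |outgoing|)` plus a
multiple of the norm (`exists_dissipative`). Once the incoming values are bounded by the outgoing
ones and the input, a small `δ` and Grönwall's inequality give the estimate
(`energyEstimate_of_dissipative`).

This last bound is finite-dimensional: it says that boundary values with zero input and zero
outgoing part vanish (`boundary_eq_zero`). Otherwise the domain of the generator contains boundary
layers at the incoming ends, which are approximate eigenvectors for arbitrarily large `l > 0`; this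
contradicts the bound `l ‖x‖ ≤ M ‖A x - l x‖` valid for a bounded semigroup
(`IsGenerator.mul_norm_le`). Finally, classical solutions in `L²` are solutions in `L¹`, the
interval being bounded. -/

theorem continuous_orbit (S : C0Semigroup ℝ X) {M : ℝ} (hM : ∀ t, ‖S.T t‖ ≤ M) (x : X) :
    Continuous fun t => S.T t x := by
  have hM0 : 0 ≤ M := (norm_nonneg _).trans (hM 0)
  have key : ∀ s t : ℝ≥0, s ≤ t → ‖S.T t x - S.T s x‖ ≤ M * ‖S.T (t - s) x - x‖ := by
    intro s t hst
    have h : S.T t x = S.T s (S.T (t - s) x) := by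
      rw [← ContinuousLinearMap.comp_apply, ← S.map_add, add_tsub_cancel_of_le hst]
    rw [h, ← map_sub]
    exact (S.T s).le_of_opNorm_le (hM s) _
  have h0 : Tendsto (fun r : ℝ≥0 => M * ‖S.T r x - x‖) (𝓝 0) (𝓝 0) := by
    have := ((S.strongly_continuous x).sub_const x).norm.const_mul M
    simpa using this
  rw [continuous_iff_continuousAt]
  intro t
  rw [ContinuousAt, tendsto_iff_norm_sub_tendsto_zero]
  have hd : Tendsto (fun s : ℝ≥0 => max (s - t) (t - s)) (𝓝 t) (𝓝 0) := by
    have : Continuous fun s : ℝ≥0 => max (s - t) (t - s) := by fun_prop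
    simpa using this.tendsto t
  refine squeeze_zero (fun _ => norm_nonneg _) (fun s => ?_) (h0.comp hd)
  rcases le_total s t with h | h
  · simpa [norm_sub_rev, tsub_eq_zero_of_le h] using key s t h
  · simpa [tsub_eq_zero_of_le h] using key t s h

/-- The orbit of `p`, extended by zero to negative times. -/
noncomputable def extOrbit (S : C0Semigroup ℝ X) (p : X) : ℝ → X :=
  (Ici (0 : ℝ)).indicator fun s => S.T s.toNNReal p

theorem extOrbit_of_nonneg (S : C0Semigroup ℝ X) (p : X) {s : ℝ} (hs : 0 ≤ s) :
    S.extOrbit p s = S.T s.toNNReal p := indicator_of_mem (mem_Ici.2 hs) _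

theorem extOrbit_of_neg (S : C0Semigroup ℝ X) (p : X) {s : ℝ} (hs : s < 0) :
    S.extOrbit p s = 0 := indicator_of_notMem (by simpa using hs) _

theorem locallyIntegrable_extOrbit (S : C0Semigroup ℝ X) {M : ℝ} (hM : ∀ t, ‖S.T t‖ ≤ M) (p : X) :
    LocallyIntegrable (S.extOrbit p) volume := by
  have : Continuous fun s : ℝ => S.T s.toNNReal p :=
    (S.continuous_orbit hM p).comp continuous_real_toNNReal
  exact this.locallyIntegrable.indicator measurableSet_Ici

/-- The solution of `z' = A z + φ p` with zero history, given by Duhamel's formula. -/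
noncomputable def duhamel (S : C0Semigroup ℝ X) (φ : ℝ → ℝ) (p : X) (t : ℝ) : X :=
  ∫ r, φ r • S.extOrbit p (t - r)

theorem integrable_duhamel (S : C0Semigroup ℝ X) {M : ℝ} (hM : ∀ t, ‖S.T t‖ ≤ M) {φ : ℝ → ℝ}
    (hφ : Continuous φ) (hc : HasCompactSupport φ) (p : X) (t : ℝ) :
    Integrable fun r => φ r • S.extOrbit p (t - r) :=
  hc.convolutionExists_left (ContinuousLinearMap.lsmul ℝ ℝ) hφ
    (S.locallyIntegrable_extOrbit hM p) t

/-- The derivative falls on `φ`, the smooth factor of the convolution; the orbit of `p` need not be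
differentiable. -/
theorem hasDerivAt_duhamel (S : C0Semigroup ℝ X) {M : ℝ} (hM : ∀ t, ‖S.T t‖ ≤ M) {φ : ℝ → ℝ}
    (hφ : ContDiff ℝ 1 φ) (hc : HasCompactSupport φ) (p : X) (t : ℝ) :
    HasDerivAt (S.duhamel φ p) (S.duhamel (deriv φ) p t) t :=
  hc.hasDerivAt_convolution_left (ContinuousLinearMap.lsmul ℝ ℝ) hφ
    (S.locallyIntegrable_extOrbit hM p) t

theorem continuous_duhamel (S : C0Semigroup ℝ X) {M : ℝ} (hM : ∀ t, ‖S.T t‖ ≤ M) {φ : ℝ → ℝ}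
    (hφ : Continuous φ) (hc : HasCompactSupport φ) (p : X) : Continuous (S.duhamel φ p) :=
  hc.continuous_convolution_left (ContinuousLinearMap.lsmul ℝ ℝ) hφ
    (S.locallyIntegrable_extOrbit hM p)

theorem duhamel_of_nonpos (S : C0Semigroup ℝ X) {φ : ℝ → ℝ} (hφ : ∀ r ≤ 0, φ r = 0) (p : X)
    {t : ℝ} (ht : t ≤ 0) : S.duhamel φ p t = 0 := by
  refine integral_eq_zero_of_ae (ae_of_all _ fun r => ?_)
  rcases le_or_gt r 0 with hr | hr
  · simp [hφ r hr]
  · simp [S.extOrbit_of_neg p (show t - r < 0 by linarith)]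

theorem extOrbit_add (S : C0Semigroup ℝ X) (p : X) {s h : ℝ} (hs : 0 ≤ s) (hh : 0 ≤ h) :
    S.extOrbit p (s + h) = S.T h.toNNReal (S.extOrbit p s) := by
  rw [S.extOrbit_of_nonneg p hs, S.extOrbit_of_nonneg p (add_nonneg hs hh),
    ← ContinuousLinearMap.comp_apply, ← S.map_add, Real.toNNReal_add hs hh, add_comm]

variable [CompleteSpace X]

/-- After the forcing has stopped the solution is a free orbit; this is how decay of the semigroup
reaches forced solutions. -/
theorem duhamel_eq_of_ge (S : C0Semigroup ℝ X) {M : ℝ} (hM : ∀ t, ‖S.T t‖ ≤ M) {φ : ℝ → ℝ}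
    (hφ : Continuous φ) (hc : HasCompactSupport φ) (p : X) {t₀ t : ℝ}
    (hsupp : ∀ r, t₀ ≤ r → φ r = 0) (ht : t₀ ≤ t) :
    S.duhamel φ p t = S.T (t - t₀).toNNReal (S.duhamel φ p t₀) := by
  unfold duhamel
  rw [← ContinuousLinearMap.integral_comp_comm _ (S.integrable_duhamel hM hφ hc p t₀)]
  congr 1
  ext r
  rcases le_or_gt t₀ r with hr | hr
  · simp [hsupp r hr]
  · rw [map_smul, ← S.extOrbit_add p (by linarith : 0 ≤ t₀ - r) (by linarith : 0 ≤ t - t₀)]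
    congr 2
    ring

/-- `T h` shifts every orbit already started; the subtracted integral is the forcing during `[t, t +
h]`, which `T h` does not see. Divided by `h` it tends to `φ t • p` and so produces the
inhomogeneity. -/
theorem map_duhamel (S : C0Semigroup ℝ X) {M : ℝ} (hM : ∀ t, ‖S.T t‖ ≤ M) {φ : ℝ → ℝ}
    (hφ : Continuous φ) (hc : HasCompactSupport φ) (p : X) (t : ℝ) {h : ℝ} (hh : 0 ≤ h) :
    S.T h.toNNReal (S.duhamel φ p t) = S.duhamel φ p (t + h) -
      ∫ r in t..t + h, φ r • S.extOrbit p (t + h - r) := by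
  have hi := S.integrable_duhamel hM hφ hc p (t + h)
  rw [intervalIntegral.integral_of_le (by linarith), ← integral_indicator measurableSet_Ioc]
  unfold duhamel
  rw [← ContinuousLinearMap.integral_comp_comm _ (S.integrable_duhamel hM hφ hc p t),
    ← integral_sub hi (hi.indicator measurableSet_Ioc)]
  congr 1
  ext r
  rw [map_smul]
  by_cases h1 : t < r
  · rw [S.extOrbit_of_neg p (by linarith : t - r < 0)]
    by_cases h2 : r ≤ t + h
    · rw [indicator_of_mem (show r ∈ Ioc t (t + h) from ⟨h1, h2⟩)]
      simp
    · rw [S.extOrbit_of_neg p (by linarith : t + h - r < 0),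
        indicator_of_notMem (fun h' => h2 h'.2)]
      simp
  · rw [indicator_of_notMem (fun h' => h1 h'.1), sub_zero, ← S.extOrbit_add p (by linarith) hh]
    congr 2
    ring

theorem tendsto_average_extOrbit (S : C0Semigroup ℝ X) {M : ℝ} (hM : ∀ t, ‖S.T t‖ ≤ M)
    {φ : ℝ → ℝ} (hφ : Continuous φ) (p : X) (t : ℝ) :
    Tendsto (fun h : ℝ => h⁻¹ • ∫ r in t..t + h, φ r • S.extOrbit p (t + h - r)) (𝓝[>] 0)
      (𝓝 (φ t • p)) := by
  have hcont : Continuous fun q : ℝ × ℝ => φ q.1 • S.T q.2.toNNReal p :=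
    (hφ.comp continuous_fst).smul
      ((S.continuous_orbit hM p).comp (continuous_real_toNNReal.comp continuous_snd))
  rw [Metric.tendsto_nhds]
  intro ε hε
  obtain ⟨δ, hδ, hδ'⟩ := Metric.continuous_iff.1 hcont (t, 0) (ε / 2) (half_pos hε)
  filter_upwards [Ioo_mem_nhdsGT hδ] with h hh
  have hbound : ∀ r ∈ uIoc t (t + h), ‖φ r • S.extOrbit p (t + h - r) - φ t • p‖ ≤ ε / 2 := by
    intro r hr
    rw [uIoc_of_le (by linarith [hh.1])] at hr
    have := hδ' (r, t + h - r) (by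
      rw [Prod.dist_eq, max_lt_iff, Real.dist_eq, Real.dist_eq, abs_lt, abs_lt]
      have := hr.1; have := hr.2; have := hh.2
      refine ⟨⟨?_, ?_⟩, ⟨?_, ?_⟩⟩ <;> simp only <;> linarith)
    rw [S.extOrbit_of_nonneg p (by linarith [hr.2])]
    simpa [dist_eq_norm, S.map_zero] using this.le
  have hint : IntervalIntegrable (fun r => φ r • S.extOrbit p (t + h - r)) volume t (t + h) := by
    have : IntervalIntegrable (fun r => φ r • S.T (t + h - r).toNNReal p) volume t (t + h) := by
      refine Continuous.intervalIntegrable ?_ _ _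
      exact hcont.comp (continuous_id.prodMk (continuous_const.sub continuous_id))
    refine this.congr fun r hr => ?_
    rw [uIoc_of_le (by linarith [hh.1])] at hr
    rw [S.extOrbit_of_nonneg p (by linarith [hr.2])]
  have := intervalIntegral.norm_integral_le_of_norm_le_const hbound
  rw [intervalIntegral.integral_sub hint intervalIntegrable_const,
    intervalIntegral.integral_const, add_sub_cancel_left, abs_of_pos hh.1] at this
  rw [dist_eq_norm]
  have h2 : h⁻¹ • (∫ r in t..t + h, φ r • S.extOrbit p (t + h - r)) - φ t • p =
      h⁻¹ • ((∫ r in t..t + h, φ r • S.extOrbit p (t + h - r)) - h • φ t • p) := by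
    rw [smul_sub, inv_smul_smul₀ hh.1.ne']
  rw [h2, norm_smul, norm_inv, Real.norm_of_nonneg hh.1.le]
  calc h⁻¹ * _ ≤ h⁻¹ * (ε / 2 * h) := by gcongr; exact inv_nonneg.2 hh.1.le
    _ = ε / 2 := by field_simp [hh.1.ne']
    _ < ε := half_lt_self hε

theorem tendsto_coe_nnreal_nhdsGT : Tendsto (fun h : ℝ≥0 => (h : ℝ)) (𝓝[>] 0) (𝓝[>] 0) := by
  refine tendsto_nhdsWithin_iff.2 ⟨?_, ?_⟩
  · exact (NNReal.continuous_coe.tendsto' 0 0 rfl).mono_left nhdsWithin_le_nhds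
  · filter_upwards [self_mem_nhdsWithin] with h hh using by simpa using hh

/-- Duhamel's formula defines a classical solution. -/
theorem IsGenerator.duhamel_mem {S : C0Semigroup ℝ X} {A : Set (X × X)} (hA : S.IsGenerator A)
    {M : ℝ} (hM : ∀ t, ‖S.T t‖ ≤ M) {φ : ℝ → ℝ} (hφ : ContDiff ℝ 1 φ) (hc : HasCompactSupport φ)
    (p : X) (t : ℝ) : (S.duhamel φ p t, S.duhamel (deriv φ) p t - φ t • p) ∈ A := by
  rw [hA]
  have h1 := (hasDerivAt_iff_tendsto_slope_zero.1 (S.hasDerivAt_duhamel hM hφ hc p t)).mono_left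
    (nhdsWithin_mono 0 (fun h (hh : 0 < h) => hh.ne'))
  have h2 := (h1.sub (S.tendsto_average_extOrbit hM hφ.continuous p t)).comp
    tendsto_coe_nnreal_nhdsGT
  refine h2.congr fun h => ?_
  have h3 := S.map_duhamel hM hφ.continuous hc p t h.2
  simp only [NNReal.val_eq_coe, Real.toNNReal_coe] at h3
  simp only [Function.comp_apply, h3, RCLike.ofReal_real_eq_id, id_eq]
  rw [← smul_sub]
  congr 1
  abel

end C0Semigroup

/-! ### Right derivatives of orbits and the resolvent lower bound. -/

namespace C0Semigroup

variable {X : Type*} [NormedAddCommGroup X] [NormedSpace ℝ X]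

/-- The right derivative comes straight from the generator and the semigroup law, and it is all that
the mean value inequality below requires. -/
theorem IsGenerator.hasDerivWithinAt {S : C0Semigroup ℝ X} {A : Set (X × X)}
    (hA : S.IsGenerator A) {x z : X} (hx : (x, z) ∈ A) {t : ℝ} (ht : 0 ≤ t) :
    HasDerivWithinAt (fun s : ℝ => S.T s.toNNReal x) (S.T t.toNNReal z) (Ici t) t := by
  rw [← hasDerivWithinAt_Ioi_iff_Ici, hasDerivWithinAt_iff_tendsto_slope' self_notMem_Ioi]
  have h1 := (S.T t.toNNReal).continuous.tendsto z |>.comp ((hA x z).1 hx)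
  have h2 : Tendsto (fun s : ℝ => (s - t).toNNReal) (𝓝[>] t) (𝓝[>] 0) := by
    refine tendsto_nhdsWithin_iff.2 ⟨?_, ?_⟩
    · have : Continuous fun s : ℝ => (s - t).toNNReal := by fun_prop
      exact (this.tendsto' t 0 (by simp)).mono_left nhdsWithin_le_nhds
    · filter_upwards [self_mem_nhdsWithin] with s hs
      have : t < s := hs
      simpa using this
  refine (h1.comp h2).congr' ?_
  filter_upwards [self_mem_nhdsWithin] with s hs
  have hs : t < s := hs
  have h3 : S.T s.toNNReal x = S.T t.toNNReal (S.T (s - t).toNNReal x) := by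
    rw [← ContinuousLinearMap.comp_apply, ← S.map_add, ← Real.toNNReal_add ht (by linarith)]
    congr 3
    ring
  simp only [Function.comp_apply, slope_def_module, RCLike.ofReal_real_eq_id, id_eq, map_smul,
    map_sub, h3, Real.coe_toNNReal _ (sub_nonneg.2 hs.le)]

/-- The Hille–Yosida lower bound for a bounded semigroup. -/
theorem IsGenerator.mul_norm_le {S : C0Semigroup ℝ X} {A : Set (X × X)}
    (hA : S.IsGenerator A) {M : ℝ} (hM : ∀ t, ‖S.T t‖ ≤ M) {x z : X} (hx : (x, z) ∈ A) {l : ℝ}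
    (hl : 0 < l) : l * ‖x‖ ≤ M * ‖z - l • x‖ := by
  set f : ℝ → X := fun t => Real.exp (-l * t) • S.T t.toNNReal x with hf
  set N := ‖z - l • x‖
  have hcont : Continuous f := by
    refine Continuous.smul (by fun_prop) ?_
    exact (S.continuous_orbit hM x).comp continuous_real_toNNReal
  have hf0 : f 0 = x := by simp [hf, S.map_zero]
  have hE : ∀ t : ℝ, HasDerivAt (fun t : ℝ => Real.exp (-l * t)) (Real.exp (-l * t) * (-l)) t := by
    intro t
    simpa using ((hasDerivAt_id t).const_mul (-l)).exp
  -- The right derivative of `f` is `exp (-l t) T(t) (z - l x)`, of norm at most `M N exp (-l t)`;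
  -- the right-hand side is the integral of this bound. The claim follows as `t → ∞`, where `f t`
  -- tends to zero.
  have key : ∀ t : ℝ, 0 ≤ t → ‖f t - x‖ ≤ M * N / l * (1 - Real.exp (-l * t)) := by
    intro t ht
    refine image_norm_le_of_norm_deriv_right_le_deriv_boundary (a := 0) (b := t)
      (f := fun t => f t - x) (f' := fun t => Real.exp (-l * t) • S.T t.toNNReal (z - l • x))
      (B := fun t => M * N / l * (1 - Real.exp (-l * t)))
      (B' := fun t => M * N * Real.exp (-l * t)) (hcont.sub continuous_const).continuousOn ?_ ?_
      ?_ ?_ (right_mem_Icc.2 ht)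
    · intro s hs
      have := ((hE s).hasDerivWithinAt.smul (hA.hasDerivWithinAt hx hs.1)).sub_const x
      convert! this using 1
      rw [map_sub, map_smul, smul_sub, mul_smul, neg_smul, smul_neg, sub_eq_add_neg]
    · simp [hf0]
    · intro s
      have := ((hE s).const_sub 1).const_mul (M * N / l)
      convert! this using 1
      field_simp
    · intro s _
      rw [norm_smul, Real.norm_of_nonneg (Real.exp_pos _).le, mul_comm]
      gcongr
      exact (S.T _).le_of_opNorm_le (hM _) _
  have hM0 : 0 ≤ M := (norm_nonneg _).trans (hM 0)
  have hbd : ∀ t : ℝ, 0 ≤ t → ‖x‖ ≤ M * N / l + Real.exp (-l * t) * (M * ‖x‖) := by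
    intro t ht
    have h1 := key t ht
    have h2 : ‖f t‖ ≤ Real.exp (-l * t) * (M * ‖x‖) := by
      rw [hf]
      simp only
      rw [norm_smul, Real.norm_of_nonneg (Real.exp_pos _).le]
      gcongr
      exact (S.T _).le_of_opNorm_le (hM _) _
    have h3 : ‖x‖ ≤ ‖f t‖ + ‖f t - x‖ := by
      have := norm_sub_le (f t) (f t - x)
      simpa using this
    have h4 : M * N / l * (1 - Real.exp (-l * t)) ≤ M * N / l := by
      have : 0 ≤ M * N / l := by positivity
      nlinarith [Real.exp_pos (-l * t)]
    linarith
  have hlim : Tendsto (fun t : ℝ => M * N / l + Real.exp (-l * t) * (M * ‖x‖)) atTop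
      (𝓝 (M * N / l + 0 * (M * ‖x‖))) := by
    refine (Tendsto.mul_const _ ?_).const_add _
    exact Real.tendsto_exp_atBot.comp (tendsto_id.const_mul_atTop_of_neg (by linarith))
  have := ge_of_tendsto hlim ((eventually_ge_atTop 0).mono hbd)
  rw [zero_mul, add_zero, le_div_iff₀ hl] at this
  linarith

end C0Semigroup

/-! ### Trajectories of a linear time-invariant system and their convolutions in time. -/

section Trajectory

variable {X W U Y : Type*} [NormedAddCommGroup X] [NormedSpace ℝ X]
  [NormedAddCommGroup W] [NormedSpace ℝ W] [NormedAddCommGroup U] [NormedSpace ℝ U]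
  [NormedAddCommGroup Y] [NormedSpace ℝ Y]

/-- A `C¹` curve `x` with derivative `x'` such that `(x, x')` stays in the kernel of `N`. -/
structure IsTrajectory (N : X × X →L[ℝ] W) (x x' : ℝ → X) : Prop where
  deriv : ∀ t, HasDerivAt x (x' t) t
  cont : Continuous x'
  mem : ∀ t, N (x t, x' t) = 0

namespace IsTrajectory

variable {N : X × X →L[ℝ] W} {x x' z z' : ℝ → X}

theorem continuous (h : IsTrajectory N x x') : Continuous x :=
  continuous_iff_continuousAt.2 fun t => (h.deriv t).continuousAt

theorem continuous_apply (h : IsTrajectory N x x') (L : X × X →L[ℝ] Y) :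
    Continuous fun t => L (x t, x' t) :=
  L.continuous.comp (h.continuous.prodMk h.cont)

theorem add (h : IsTrajectory N x x') (k : IsTrajectory N z z') :
    IsTrajectory N (fun t => x t + z t) (fun t => x' t + z' t) where
  deriv t := (h.deriv t).add (k.deriv t)
  cont := h.cont.add k.cont
  mem t := by rw [← Prod.mk_add_mk, map_add, h.mem, k.mem, add_zero]

theorem sub (h : IsTrajectory N x x') (k : IsTrajectory N z z') :
    IsTrajectory N (fun t => x t - z t) (fun t => x' t - z' t) where
  deriv t := (h.deriv t).sub (k.deriv t)
  cont := h.cont.sub k.cont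
  mem t := by rw [← Prod.mk_sub_mk, map_sub, h.mem, k.mem, sub_zero]

theorem zero : IsTrajectory N (fun _ => 0) (fun _ => 0) where
  deriv t := hasDerivAt_const t 0
  cont := continuous_const
  mem t := by rw [Prod.mk_zero_zero, map_zero]

theorem sum {ι : Type*} (s : Finset ι) {x x' : ι → ℝ → X}
    (h : ∀ i, IsTrajectory N (x i) (x' i)) :
    IsTrajectory N (fun t => ∑ i ∈ s, x i t) (fun t => ∑ i ∈ s, x' i t) := by
  classical
  induction s using Finset.induction_on with
  | empty => simpa using zero
  | insert i s hi ih => simpa [Finset.sum_insert hi] using (h i).add ih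

end IsTrajectory

theorem continuous_integral_comp_sub {k : ℝ → ℝ} (hk : Continuous k) {x : ℝ → X}
    (hx : Continuous x) (a b : ℝ) : Continuous fun t => ∫ s in a..b, k s • x (t - s) := by
  refine intervalIntegral.continuous_parametric_intervalIntegral_of_continuous' ?_ a b
  exact (hk.comp continuous_snd).smul (hx.comp (continuous_fst.sub continuous_snd))

theorem hasDerivAt_integral_comp_sub {k : ℝ → ℝ} (hk : Continuous k) {x x' : ℝ → X}
    (hx : ∀ t, HasDerivAt x (x' t) t) (hx' : Continuous x') (a b t : ℝ) :
    HasDerivAt (fun t => ∫ s in a..b, k s • x (t - s)) (∫ s in a..b, k s • x' (t - s)) t := by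
  have hxc : Continuous x := continuous_iff_continuousAt.2 fun t => (hx t).continuousAt
  have hF' : Continuous fun q : ℝ × ℝ => k q.2 • x' (q.1 - q.2) :=
    (hk.comp continuous_snd).smul (hx'.comp (continuous_fst.sub continuous_snd))
  obtain ⟨C, hC⟩ := ((isCompact_closedBall t 1).prod (isCompact_uIcc (a := a) (b := b))
    ).exists_bound_of_continuousOn hF'.continuousOn
  refine (intervalIntegral.hasDerivAt_integral_of_dominated_loc_of_deriv_le
    (F := fun t s => k s • x (t - s)) (F' := fun t s => k s • x' (t - s))
    (bound := fun _ => C) (Metric.ball_mem_nhds t one_pos) ?_ ?_ ?_ ?_ ?_ ?_).2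
  · exact Eventually.of_forall fun t =>
      (hk.smul (hxc.comp (continuous_const.sub continuous_id))).aestronglyMeasurable
  · exact (hk.smul (hxc.comp (continuous_const.sub continuous_id))).intervalIntegrable _ _
  · exact (hk.smul (hx'.comp (continuous_const.sub continuous_id))).aestronglyMeasurable
  · exact ae_of_all _ fun s hs r hr =>
      hC (r, s) ⟨Metric.ball_subset_closedBall hr, uIoc_subset_uIcc hs⟩
  · exact intervalIntegrable_const
  · refine ae_of_all _ fun s _ r _ => ?_
    exact ((hx (r - s)).comp_sub_const r s).const_smul (k s)

theorem map_integral_pair [CompleteSpace X] [CompleteSpace Y] (L : X × X →L[ℝ] Y) {k : ℝ → ℝ}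
    (hk : Continuous k)
    {x x' : ℝ → X} (hx : Continuous x) (hx' : Continuous x') (a b t : ℝ) :
    L (∫ s in a..b, k s • x (t - s), ∫ s in a..b, k s • x' (t - s)) =
      ∫ s in a..b, k s • L (x (t - s), x' (t - s)) := by
  have h1 : IntervalIntegrable (fun s => k s • x (t - s)) volume a b :=
    (hk.smul (hx.comp (continuous_const.sub continuous_id))).intervalIntegrable _ _
  have h2 : IntervalIntegrable (fun s => k s • x' (t - s)) volume a b :=
    (hk.smul (hx'.comp (continuous_const.sub continuous_id))).intervalIntegrable _ _
  have h3 : ∀ p q : X, L (p, q) = L.comp (ContinuousLinearMap.inl ℝ X X) p +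
      L.comp (ContinuousLinearMap.inr ℝ X X) q := by
    intro p q
    simp [← map_add]
  rw [h3, ← ContinuousLinearMap.intervalIntegral_comp_comm _ h1,
    ← ContinuousLinearMap.intervalIntegral_comp_comm _ h2, ← intervalIntegral.integral_add]
  · congr 1
    ext s
    rw [map_smul, map_smul, ← smul_add, ← h3]
  · exact (ContinuousLinearMap.continuous _ |>.comp
      (hk.smul (hx.comp (continuous_const.sub continuous_id)))).intervalIntegrable _ _
  · exact (ContinuousLinearMap.continuous _ |>.comp
      (hk.smul (hx'.comp (continuous_const.sub continuous_id)))).intervalIntegrable _ _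

/-- Superposition: the system is linear and time invariant and its trajectories live on the whole
line, so a scalar convolution in time stays inside it. -/
theorem IsTrajectory.integral_comp_sub [CompleteSpace X] [CompleteSpace W]
    {N : X × X →L[ℝ] W} {x x' : ℝ → X} (h : IsTrajectory N x x') {k : ℝ → ℝ} (hk : Continuous k)
    (a b : ℝ) :
    IsTrajectory N (fun t => ∫ s in a..b, k s • x (t - s))
      (fun t => ∫ s in a..b, k s • x' (t - s)) where
  deriv t := hasDerivAt_integral_comp_sub hk h.deriv h.cont a b t
  cont := continuous_integral_comp_sub hk h.cont a b
  mem t := by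
    rw [map_integral_pair N hk h.continuous h.cont]
    simp [h.mem]

end Trajectory

/-! ### Mollified impulse responses and their uniform `L¹` bound. -/

section ImpulseResponse

variable {X W U Y : Type*} [NormedAddCommGroup X] [NormedSpace ℝ X]
  [NormedAddCommGroup W] [NormedSpace ℝ W] [NormedAddCommGroup U] [NormedSpace ℝ U]
  [NormedAddCommGroup Y] [NormedSpace ℝ Y]

/-- On time intervals of fixed length, the state and the `L¹`-norm of the output `c (x, x')` are
controlled by the initial state and the `L¹`-norm of the input `d (x, x')`. -/
def EnergyEstimate (N : X × X →L[ℝ] W) (d : X × X →L[ℝ] U) (c : X × X →L[ℝ] Y) : Prop :=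
  ∀ τ : ℝ, 0 ≤ τ → ∃ K : ℝ, 0 ≤ K ∧ ∀ x x' : ℝ → X, IsTrajectory N x x' → ∀ t₀ : ℝ,
    ‖x (t₀ + τ)‖ ≤ K * (‖x t₀‖ + ∫ t in t₀..t₀ + τ, ‖d (x t, x' t)‖) ∧
    ∫ t in t₀..t₀ + τ, ‖c (x t, x' t)‖ ≤ K * (‖x t₀‖ + ∫ t in t₀..t₀ + τ, ‖d (x t, x' t)‖)

variable [CompleteSpace X]

/-- The boundary input is lifted by `φ q`. The remainder `x - φ q` has homogeneous boundary values
and solves `z' = A z + φ p - φ' q`, which Duhamel's formula does. Two derivatives of `φ` are needed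
because `φ'` is itself a forcing. -/
theorem exists_response {S : C0Semigroup ℝ X} {N : X × X →L[ℝ] W} {d : X × X →L[ℝ] U}
    (hS : S.IsGenerator {p | N p = 0 ∧ d p = 0}) {M : ℝ} (hM : ∀ t, ‖S.T t‖ ≤ M) {q p : X}
    (hqp : N (q, p) = 0) {φ : ℝ → ℝ} (hφ : ContDiff ℝ 2 φ) (hsupp : tsupport φ ⊆ Ioo 0 1) :
    ∃ x x' : ℝ → X, IsTrajectory N x x' ∧ (∀ t ≤ 0, x t = 0 ∧ x' t = 0) ∧
      (∀ t, d (x t, x' t) = φ t • d (q, p)) ∧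
      ∀ t, 1 ≤ t → x t = S.T (t - 1).toNNReal (x 1) := by
  have hc : HasCompactSupport φ :=
    isCompact_Icc.of_isClosed_subset (isClosed_tsupport φ) (hsupp.trans Ioo_subset_Icc_self)
  have hc' : HasCompactSupport (deriv φ) := hc.deriv
  have hc'' : HasCompactSupport (deriv (deriv φ)) := hc'.deriv
  have hφ1 : ContDiff ℝ 1 φ := hφ.of_le (by norm_num)
  have hφ' : ContDiff ℝ 1 (deriv φ) := by
    have := (contDiff_succ_iff_deriv (n := 1)).1 hφ
    exact this.2.2
  have hφ'' : Continuous (deriv (deriv φ)) := hφ'.continuous_deriv le_rfl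
  have hs' : tsupport (deriv φ) ⊆ Ioo 0 1 := tsupport_deriv_subset.trans hsupp
  have hs'' : tsupport (deriv (deriv φ)) ⊆ Ioo 0 1 := tsupport_deriv_subset.trans hs'
  have z0 : ∀ {f : ℝ → ℝ}, tsupport f ⊆ Ioo 0 1 → ∀ r ≤ 0, f r = 0 := fun hf r hr =>
    image_eq_zero_of_notMem_tsupport fun h => absurd (hf h).1 (not_lt.2 hr)
  have z1 : ∀ {f : ℝ → ℝ}, tsupport f ⊆ Ioo 0 1 → ∀ r, 1 ≤ r → f r = 0 := fun hf r hr =>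
    image_eq_zero_of_notMem_tsupport fun h => absurd (hf h).2 (not_lt.2 hr)
  have hm1 := fun t => hS.duhamel_mem hM hφ1 hc p t
  have hm2 := fun t => hS.duhamel_mem hM hφ' hc' q t
  -- The pair is `φ t • (q, p)` plus elements of the graph of the generator, on which both `N` and
  -- `d` vanish.
  have hpair : ∀ t, (φ t • q + S.duhamel φ p t - S.duhamel (deriv φ) q t,
      deriv φ t • q + S.duhamel (deriv φ) p t - S.duhamel (deriv (deriv φ)) q t) =
      φ t • (q, p) + (S.duhamel φ p t, S.duhamel (deriv φ) p t - φ t • p) -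
      (S.duhamel (deriv φ) q t, S.duhamel (deriv (deriv φ)) q t - deriv φ t • q) := by
    intro t
    ext
    · simp
    · simp only [Prod.smul_mk, Prod.mk_add_mk, Prod.mk_sub_mk]
      abel
  refine ⟨fun t => φ t • q + S.duhamel φ p t - S.duhamel (deriv φ) q t,
    fun t => deriv φ t • q + S.duhamel (deriv φ) p t - S.duhamel (deriv (deriv φ)) q t,
    ⟨fun t => ?_, ?_, fun t => ?_⟩, fun t ht => ⟨?_, ?_⟩, fun t => ?_, fun t ht => ?_⟩
  · exact (((hφ1.differentiable one_ne_zero t).hasDerivAt.smul_const q).add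
      (S.hasDerivAt_duhamel hM hφ1 hc p t)).sub (S.hasDerivAt_duhamel hM hφ' hc' q t)
  · exact ((hφ'.continuous.smul continuous_const).add
      (S.continuous_duhamel hM hφ'.continuous hc' p)).sub
      (S.continuous_duhamel hM hφ'' hc'' q)
  · rw [hpair, map_sub, map_add, (hm1 t).1, (hm2 t).1, map_smul, hqp]
    simp
  · simp [z0 hsupp t ht, S.duhamel_of_nonpos (z0 hsupp) p ht, S.duhamel_of_nonpos (z0 hs') q ht]
  · simp [z0 hs' t ht, S.duhamel_of_nonpos (z0 hs') p ht, S.duhamel_of_nonpos (z0 hs'') q ht]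
  · rw [hpair, map_sub, map_add, (hm1 t).2, (hm2 t).2, map_smul]
    simp
  · simp only [z1 hsupp t ht, z1 hsupp 1 le_rfl, zero_smul, zero_add, map_sub]
    rw [S.duhamel_eq_of_ge hM hφ.continuous hc p (z1 hsupp) ht,
      S.duhamel_eq_of_ge hM hφ'.continuous hc' q (z1 hs') ht]

/-- `K` is independent of `φ`: only the unit mass of `φ` enters, so the bound survives when `φ`
concentrates to an impulse. On `[0, 1]` the energy estimate starts from the zero state; on later
unit intervals there is no input and the initial state is an exponentially small orbit value. -/
theorem exists_impulseResponse_bound {S : C0Semigroup ℝ X} {N : X × X →L[ℝ] W}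
    {d : X × X →L[ℝ] U} {c : X × X →L[ℝ] Y}
    (hS : S.IsGenerator {p | N p = 0 ∧ d p = 0}) (hstab : S.IsExponentiallyStable)
    (henergy : EnergyEstimate N d c) {q p : X} (hqp : N (q, p) = 0) :
    ∃ K : ℝ, 0 ≤ K ∧ ∀ φ : ℝ → ℝ, ContDiff ℝ 2 φ → tsupport φ ⊆ Ioo 0 1 → (∀ r, 0 ≤ φ r) →
      ∫ r in (0 : ℝ)..1, φ r = 1 →
      ∃ x x' : ℝ → X, IsTrajectory N x x' ∧ (∀ t ≤ 0, x t = 0 ∧ x' t = 0) ∧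
        (∀ t, d (x t, x' t) = φ t • d (q, p)) ∧
        ∀ t, -1 ≤ t → ∫ s in (-1)..t, ‖c (x s, x' s)‖ ≤ K := by
  obtain ⟨M, ω, hω, hMω⟩ := hstab
  obtain ⟨K, hK, hen⟩ := henergy 1 zero_le_one
  have hM0 : 0 ≤ M := by
    have := (norm_nonneg _).trans (hMω 0)
    simpa using this
  have hM : ∀ t, ‖S.T t‖ ≤ M := fun t => (hMω t).trans <| by
    have : Real.exp (-ω * t) ≤ 1 := Real.exp_le_one_iff.2 (by nlinarith [t.2, t.coe_nonneg])
    nlinarith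
  set e := ‖d (q, p)‖
  set r := Real.exp (-ω) with hr
  have hr1 : r < 1 := by
    rw [hr, ← Real.exp_zero]
    exact Real.exp_lt_exp.2 (by linarith)
  have hr0 : 0 < r := Real.exp_pos _
  -- The first summand bounds the output on `[0, 1]`, the second serves `[k, k + 1]` for `k ≥ 1`;
  -- the decay runs from time `1`, whence the factor `r⁻¹`.
  set K₁ := K * e + K * (M * r⁻¹ * (K * e)) with hK₁
  have hK₁0 : 0 ≤ K₁ := by positivity
  refine ⟨K₁ / (1 - r), div_nonneg hK₁0 (by linarith), fun φ hφ hsupp hφ0 hφ1 => ?_⟩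
  obtain ⟨x, x', hx, hneg, hd, hdecay⟩ := exists_response hS hM hqp hφ hsupp
  refine ⟨x, x', hx, hneg, hd, fun t ht => ?_⟩
  have hcc : Continuous fun s => ‖c (x s, x' s)‖ := (hx.continuous_apply c).norm
  have hx1 : ‖x 1‖ ≤ K * e ∧ ∫ s in (0 : ℝ)..1, ‖c (x s, x' s)‖ ≤ K * e := by
    have := hen x x' hx 0
    have h2 : ∫ t in (0 : ℝ)..0 + 1, ‖d (x t, x' t)‖ = e := by
      simp only [hd, norm_smul, Real.norm_of_nonneg (hφ0 _), zero_add]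
      rw [intervalIntegral.integral_mul_const, hφ1, one_mul]
    rw [h2, (hneg 0 le_rfl).1] at this
    simpa using this
  have hstep : ∀ k : ℕ, ∫ s in (k : ℝ)..((k + 1 : ℕ) : ℝ), ‖c (x s, x' s)‖ ≤ K₁ * r ^ k := by
    intro k
    rcases Nat.eq_zero_or_pos k with rfl | hk
    · have : 0 ≤ K * (M * r⁻¹ * (K * e)) := by positivity
      simp only [Nat.cast_zero, zero_add, Nat.cast_one, pow_zero, mul_one, hK₁]
      linarith [hx1.2]
    · have hk1 : (1 : ℝ) ≤ k := by exact_mod_cast hk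
      have h1 := (hen x x' hx k).2
      have h2 : ∫ t in (k : ℝ)..k + 1, ‖d (x t, x' t)‖ = 0 := by
        rw [intervalIntegral.integral_congr (g := fun _ => (0 : ℝ)), intervalIntegral.integral_zero]
        intro s hs
        rw [uIcc_of_le (by linarith)] at hs
        have : φ s = 0 := image_eq_zero_of_notMem_tsupport fun h =>
          absurd (hsupp h).2 (not_lt.2 (hk1.trans hs.1))
        simp [hd, this]
      have h3 : ‖x k‖ ≤ M * r⁻¹ * (K * e) * r ^ k := by
        rw [hdecay k hk1]
        refine ((S.T _).le_of_opNorm_le (hMω _) _).trans ?_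
        have h4 : Real.exp (-ω * ((k - 1 : ℝ).toNNReal : ℝ)) = r⁻¹ * r ^ k := by
          rw [Real.coe_toNNReal _ (by linarith), hr, ← Real.exp_nat_mul, ← Real.exp_neg,
            ← Real.exp_add]
          congr 1
          ring
        rw [h4]
        calc M * (r⁻¹ * r ^ k) * ‖x 1‖ ≤ M * (r⁻¹ * r ^ k) * (K * e) := by gcongr; exact hx1.1
          _ = _ := by ring
      rw [h2, add_zero] at h1
      push_cast
      refine h1.trans ?_
      calc K * ‖x k‖ ≤ K * (M * r⁻¹ * (K * e) * r ^ k) := by gcongr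
        _ ≤ K₁ * r ^ k := by
          have : 0 ≤ K * e * r ^ k := by positivity
          rw [hK₁]
          linarith
  have hsum : ∀ m : ℕ, ∫ s in (0 : ℝ)..m, ‖c (x s, x' s)‖ ≤ K₁ / (1 - r) := by
    intro m
    have := intervalIntegral.sum_integral_adjacent_intervals (f := fun s => ‖c (x s, x' s)‖)
      (a := fun k : ℕ => (k : ℝ)) (n := m) (μ := volume)
      (fun k _ => hcc.intervalIntegrable _ _)
    rw [Nat.cast_zero] at this
    rw [← this]
    calc ∑ k ∈ Finset.range m, ∫ s in (k : ℝ)..((k + 1 : ℕ) : ℝ), ‖c (x s, x' s)‖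
        ≤ ∑ k ∈ Finset.range m, K₁ * r ^ k := Finset.sum_le_sum fun k _ => hstep k
      _ = K₁ * ∑ k ∈ Finset.range m, r ^ k := by rw [Finset.mul_sum]
      _ ≤ K₁ * (1 - r)⁻¹ := by
          gcongr
          exact (summable_geometric_of_lt_one hr0.le hr1).sum_le_tsum _ (fun _ _ => by positivity)
            |>.trans_eq (tsum_geometric_of_lt_one hr0.le hr1)
      _ = _ := by rw [div_eq_mul_inv]
  obtain ⟨m, hm⟩ := exists_nat_ge t
  have h0 : ∫ s in (-1 : ℝ)..0, ‖c (x s, x' s)‖ = 0 := by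
    rw [intervalIntegral.integral_congr (g := fun _ => (0 : ℝ)), intervalIntegral.integral_zero]
    intro s hs
    rw [uIcc_of_le (by norm_num)] at hs
    obtain ⟨h1, h2⟩ := hneg s hs.2
    simp only [h1, h2, Prod.mk_zero_zero, map_zero, norm_zero]
  have hmono : ∫ s in (-1)..t, ‖c (x s, x' s)‖ ≤ ∫ s in (-1)..(m : ℝ), ‖c (x s, x' s)‖ :=
    intervalIntegral.integral_mono_interval le_rfl ht hm (ae_of_all _ fun _ => norm_nonneg _)
      (hcc.intervalIntegrable _ _)
  refine hmono.trans ?_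
  rw [← intervalIntegral.integral_add_adjacent_intervals (hcc.intervalIntegrable _ 0)
    (hcc.intervalIntegrable _ _), h0, zero_add]
  exact hsum m

end ImpulseResponse

/-! ### From impulse responses to a supremum bound for the output. -/

section BIBO

variable {X W U Y : Type*} [NormedAddCommGroup X] [NormedSpace ℝ X]
  [NormedAddCommGroup W] [NormedSpace ℝ W]
  [NormedAddCommGroup U] [NormedSpace ℝ U]
  [NormedAddCommGroup Y] [NormedSpace ℝ Y]

theorem IsTrajectory.deriv_eq_zero {N : X × X →L[ℝ] W} {x x' : ℝ → X} (h : IsTrajectory N x x')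
    {T t : ℝ} (h0 : ∀ t ≤ T, x t = 0) (ht : t ≤ T) : x' t = 0 := by
  have h1 : EqOn x' (fun _ => 0) (Iio T) := by
    intro s hs
    have : x =ᶠ[𝓝 s] fun _ => 0 := by
      filter_upwards [Iio_mem_nhds hs] with r hr using h0 r (le_of_lt hr)
    exact (h.deriv s).unique ((hasDerivAt_const s (0 : X)).congr_of_eventuallyEq this)
  have h2 := h1.closure h.cont continuous_const
  rw [closure_Iio] at h2
  exact h2 ht

theorem EnergyEstimate.eq_zero {N : X × X →L[ℝ] W} {d : X × X →L[ℝ] U} {c : X × X →L[ℝ] Y}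
    (henergy : EnergyEstimate N d c) {x x' : ℝ → X} (hx : IsTrajectory N x x') (h0 : x 0 = 0)
    {T : ℝ} (hd : ∀ t ∈ Icc 0 T, d (x t, x' t) = 0) {t : ℝ} (ht : t ∈ Icc 0 T) : x t = 0 := by
  obtain ⟨K, _, hK⟩ := henergy t ht.1
  have h1 := (hK x x' hx 0).1
  have h2 : ∫ s in (0 : ℝ)..0 + t, ‖d (x s, x' s)‖ = 0 := by
    rw [intervalIntegral.integral_congr (g := fun _ => (0 : ℝ)), intervalIntegral.integral_zero]
    intro s hs
    rw [zero_add, uIcc_of_le ht.1] at hs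
    simp [hd s ⟨hs.1, hs.2.trans ht.2⟩]
  rw [h2, h0] at h1
  simpa using h1

variable [CompleteSpace X]

theorem map_sum_integral_sub [CompleteSpace Y] (L : X × X →L[ℝ] Y) {ι : Type*} [Fintype ι]
    {k : ℝ → ℝ} (hk : Continuous k) {x x' : ℝ → X} (hx : Continuous x) (hx' : Continuous x')
    {u : ι → ℝ → ℝ} (hu : ∀ i, Continuous (u i)) {z z' : ι → ℝ → X}
    (hz : ∀ i, Continuous (z i)) (hz' : ∀ i, Continuous (z' i)) (a b a' b' r : ℝ) :
    L ((∑ i, ∫ s in a..b, u i s • z i (r - s)) - ∫ s in a'..b', k s • x (r - s),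
        (∑ i, ∫ s in a..b, u i s • z' i (r - s)) - ∫ s in a'..b', k s • x' (r - s))
      = (∑ i, ∫ s in a..b, u i s • L (z i (r - s), z' i (r - s))) -
        ∫ s in a'..b', k s • L (x (r - s), x' (r - s)) := by
  have hsum : (∑ i, ∫ s in a..b, u i s • z i (r - s), ∑ i, ∫ s in a..b, u i s • z' i (r - s)) =
      ∑ i, (∫ s in a..b, u i s • z i (r - s), ∫ s in a..b, u i s • z' i (r - s)) := by
    ext <;> simp [Prod.fst_sum, Prod.snd_sum]
  rw [← Prod.mk_sub_mk, map_sub, map_integral_pair L hk hx hx', hsum, map_sum]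
  congr 1
  exact Finset.sum_congr rfl fun i _ => map_integral_pair L (hu i) (hz i) (hz' i) a b r

/-- Both sides are the convolution of `φ` and `u` over the whole line: the supports of `φ` and `u`
and the bound `r ≤ T` make the finite limits harmless. -/
theorem integral_mul_comp_sub_comm {φ u : ℝ → ℝ} (hsupp : tsupport φ ⊆ Ioo 0 1)
    (hu0 : ∀ t ≤ 0, u t = 0) {r T : ℝ} (hrT : r ≤ T) :
    ∫ s in (0 : ℝ)..1, φ s * u (r - s) = ∫ s in (0 : ℝ)..T, u s * φ (r - s) := by
  have hφ : ∀ r, φ r ≠ 0 → r ∈ Ioo (0 : ℝ) 1 := fun r hr =>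
    hsupp (subset_tsupport _ hr)
  have h1 : ∫ s in (0 : ℝ)..1, φ s * u (r - s) = ∫ s in r - 1..r, u s * φ (r - s) := by
    have := intervalIntegral.integral_comp_sub_left (fun s => u s * φ (r - s)) r (a := 0) (b := 1)
    rw [sub_zero] at this
    rw [← this]
    simp [mul_comm]
  rw [h1, intervalIntegral.integral_eq_integral_of_support_subset,
    intervalIntegral.integral_eq_integral_of_support_subset]
  · intro s hs
    have hs1 : 0 < s := by
      by_contra h
      exact hs (by simp [hu0 s (not_lt.1 h)])
    have := hφ (r - s) fun h => hs (by simp [h])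
    exact ⟨hs1, by linarith [this.1]⟩
  · intro s hs
    have := hφ (r - s) fun h => hs (by simp [h])
    exact ⟨by linarith [this.2], by linarith [this.1]⟩

/-- Both sides are outputs of trajectories with the same input, the convolution of `φ` with `d (x,
x')`, and with zero history. Their difference `D` vanishes by the energy estimate, hence so does its
derivative, and the outputs agree. -/
theorem response_identity [CompleteSpace W] [CompleteSpace U] [CompleteSpace Y]
    {N : X × X →L[ℝ] W} {d : X × X →L[ℝ] U} {c : X × X →L[ℝ] Y}
    (henergy : EnergyEstimate N d c) {ι : Type*} [Fintype ι] (e : ι → U) {φ : ℝ → ℝ}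
    (hφ : Continuous φ) (hsupp : tsupport φ ⊆ Ioo 0 1)
    {z z' : ι → ℝ → X} (hz : ∀ i, IsTrajectory N (z i) (z' i)) (hz0 : ∀ i, ∀ t ≤ 0, z i t = 0)
    (hzd : ∀ i t, d (z i t, z' i t) = φ t • e i)
    {x x' : ℝ → X} (hx : IsTrajectory N x x') (hx0 : ∀ t ≤ 0, x t = 0)
    {u : ι → ℝ → ℝ} (hu : ∀ i, Continuous (u i)) (hu0 : ∀ i, ∀ t ≤ 0, u i t = 0)
    (hxd : ∀ t, d (x t, x' t) = ∑ i, u i t • e i) {t : ℝ} (ht : 0 ≤ t) :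
    ∫ s in (0 : ℝ)..1, φ s • c (x (t - s), x' (t - s)) =
      ∑ i, ∫ s in (0 : ℝ)..t + 1, u i s • c (z i (t - s), z' i (t - s)) := by
  have h1 := hx.integral_comp_sub hφ 0 1
  have h2 := IsTrajectory.sum Finset.univ fun i => (hz i).integral_comp_sub (hu i) 0 (t + 1)
  have h3 := h2.sub h1
  set D := fun r => (∑ i, ∫ s in (0 : ℝ)..t + 1, u i s • z i (r - s)) -
    ∫ s in (0 : ℝ)..1, φ s • x (r - s) with hD
  have hneg : ∀ r ≤ 0, D r = 0 := by
    intro r hr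
    have e1 : ∫ s in (0 : ℝ)..1, φ s • x (r - s) = 0 := by
      rw [intervalIntegral.integral_congr (g := fun _ => (0 : X)), intervalIntegral.integral_zero]
      intro s hs
      rw [uIcc_of_le zero_le_one] at hs
      simp [hx0 (r - s) (by linarith [hs.1])]
    have e2 : ∀ i, ∫ s in (0 : ℝ)..t + 1, u i s • z i (r - s) = 0 := by
      intro i
      rw [intervalIntegral.integral_congr (g := fun _ => (0 : X)), intervalIntegral.integral_zero]
      intro s hs
      rw [uIcc_of_le (by linarith)] at hs
      simp [hz0 i (r - s) (by linarith [hs.1])]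
    simp [hD, e1, e2]
  have hzero : ∀ r ≤ t + 1, D r = 0 := by
    intro r hr
    rcases le_total r 0 with h | h
    · exact hneg r h
    refine henergy.eq_zero h3 (hneg 0 le_rfl) (T := t + 1) (fun r hr => ?_) ⟨h, hr⟩
    rw [map_sum_integral_sub d hφ hx.continuous hx.cont hu (fun i => (hz i).continuous)
      (fun i => (hz i).cont)]
    simp only [hzd, hxd, Finset.smul_sum, smul_smul]
    rw [intervalIntegral.integral_finsetSum, sub_eq_zero]
    · refine Finset.sum_congr rfl fun i _ => ?_
      rw [intervalIntegral.integral_smul_const, intervalIntegral.integral_smul_const,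
        integral_mul_comp_sub_comm hsupp (hu0 i) hr.2]
    · intro i _
      refine Continuous.intervalIntegrable ?_ _ _
      have := hu i
      fun_prop
  have := map_sum_integral_sub c hφ hx.continuous hx.cont hu (fun i => (hz i).continuous)
    (fun i => (hz i).cont) 0 (t + 1) 0 1 t
  rw [show ((∑ i, ∫ s in (0 : ℝ)..t + 1, u i s • z i (t - s)) -
      ∫ s in (0 : ℝ)..1, φ s • x (t - s)) = 0 from hzero t (by linarith),
    h3.deriv_eq_zero hzero (by linarith : t ≤ t + 1), Prod.mk_zero_zero, map_zero] at this
  exact (sub_eq_zero.1 this.symm).symm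

theorem exists_bump {ε : ℝ} (hε : 0 < ε) (hε1 : ε ≤ 1) :
    ∃ φ : ℝ → ℝ, ContDiff ℝ 2 φ ∧ tsupport φ ⊆ Ioo 0 ε ∧ (∀ r, 0 ≤ φ r) ∧
      ∫ r in (0 : ℝ)..1, φ r = 1 := by
  -- These radii keep the closed support inside `[ε / 4, 3 ε / 4]`.
  let f : ContDiffBump (ε / 2) := ⟨ε / 8, ε / 4, by positivity, by linarith⟩
  have hs : tsupport (f.normed volume) ⊆ Ioo 0 ε := by
    rw [f.tsupport_normed_eq, Real.closedBall_eq_Icc]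
    intro r hr
    have h1 : ε / 2 - ε / 4 ≤ r := hr.1
    have h2 : r ≤ ε / 2 + ε / 4 := hr.2
    exact ⟨by linarith, by linarith⟩
  refine ⟨f.normed volume, f.contDiff_normed, hs, fun r => f.nonneg_normed r, ?_⟩
  rw [intervalIntegral.integral_eq_integral_of_support_subset, f.integral_normed]
  exact (subset_tsupport _).trans (hs.trans fun r hr => ⟨hr.1, (hr.2.trans_le hε1).le⟩)

/-- A bounded-input-bounded-output estimate from exponential stability and the finite time
`L¹`-energy estimate. -/
theorem exists_output_bound [CompleteSpace W] [FiniteDimensional ℝ U] [CompleteSpace Y]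
    {S : C0Semigroup ℝ X} {N : X × X →L[ℝ] W} {d : X × X →L[ℝ] U} {c : X × X →L[ℝ] Y}
    (hS : S.IsGenerator {p | N p = 0 ∧ d p = 0}) (hstab : S.IsExponentiallyStable)
    (henergy : EnergyEstimate N d c) (hsurj : ∀ u, ∃ q p, N (q, p) = 0 ∧ d (q, p) = u) :
    ∃ C : ℝ, 0 ≤ C ∧ ∀ x x' : ℝ → X, IsTrajectory N x x' → (∀ t ≤ 0, x t = 0) →
      ∀ t B : ℝ, 0 ≤ t → (∀ s ∈ Icc 0 t, ‖d (x s, x' s)‖ ≤ B) → ‖c (x t, x' t)‖ ≤ C * B := by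
  have : CompleteSpace U := FiniteDimensional.complete ℝ U
  let b := Module.finBasis ℝ U
  choose q p hN hd using fun i => hsurj (b i)
  choose K hK0 hK using fun i => exists_impulseResponse_bound hS hstab henergy (hN i)
  let f : ∀ i, U →L[ℝ] ℝ := fun i => LinearMap.toContinuousLinearMap (b.coord i)
  -- `f i` reads off the `i`-th input coordinate and `K i` bounds the `L¹` norm of the response to
  -- an impulse in the direction `b i`.
  refine ⟨∑ i, ‖f i‖ * K i, Finset.sum_nonneg fun i _ => mul_nonneg (norm_nonneg _) (hK0 i),
    fun x x' hx hx0 t B ht hB => ?_⟩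
  have hB0 : 0 ≤ B := (norm_nonneg _).trans (hB 0 ⟨le_rfl, ht⟩)
  have hy : Continuous fun s => c (x (t - s), x' (t - s)) :=
    (hx.continuous_apply c).comp (continuous_const.sub continuous_id)
  refine le_of_forall_pos_le_add fun δ hδ => ?_
  -- Continuity of the output at time `t` decides how concentrated `φ` must be for its average to be
  -- `δ`-close to the value at `t`; the `K i` do not change with `φ`.
  obtain ⟨ε₀, hε₀, hε₀'⟩ := Metric.continuousAt_iff.1 (hy.continuousAt (x := 0)) δ hδ
  obtain ⟨φ, hφ2, hφε, hφ0, hφ1⟩ := exists_bump (lt_min hε₀ one_pos) (min_le_right ε₀ 1)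
  have hsupp : tsupport φ ⊆ Ioo 0 1 := hφε.trans (Ioo_subset_Ioo_right (min_le_right _ _))
  choose z z' hz hz0 hzd hzK using fun i => hK i φ hφ2 hsupp hφ0 hφ1
  have hu0 : ∀ t ≤ 0, d (x t, x' t) = 0 := fun t ht => by
    rw [hx0 t ht, hx.deriv_eq_zero hx0 ht, Prod.mk_zero_zero, map_zero]
  have hid := response_identity henergy b hφ2.continuous hsupp hz (fun i t ht => (hz0 i t ht).1)
    (fun i t => by rw [hzd, hd]) hx hx0 (u := fun i t => f i (d (x t, x' t)))
    (fun i => (f i).continuous.comp (hx.continuous_apply d))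
    (fun i t ht => by simp only [hu0 t ht, map_zero])
    (fun t => by
      conv_lhs => rw [← b.sum_repr (d (x t, x' t))]
      rfl) ht
  have hterm : ∀ i, ‖∫ s in (0 : ℝ)..t + 1,
      f i (d (x s, x' s)) • c (z i (t - s), z' i (t - s))‖ ≤ ‖f i‖ * K i * B := by
    intro i
    have hcc : Continuous fun s => ‖c (z i s, z' i s)‖ := ((hz i).continuous_apply c).norm
    calc _ ≤ ∫ s in (0 : ℝ)..t + 1, ‖f i‖ * B * ‖c (z i (t - s), z' i (t - s))‖ := by
          refine intervalIntegral.norm_integral_le_of_norm_le (by linarith) (ae_of_all _ ?_) ?_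
          · intro s hs
            rcases le_or_gt s t with h | h
            · rw [norm_smul]
              gcongr
              exact (f i).le_of_opNorm_le_of_le le_rfl (hB s ⟨hs.1.le, h⟩)
            -- For `s > t` nothing is known about the size of the input, but the response is still
            -- at rest.
            · obtain ⟨e1, e2⟩ := hz0 i (t - s) (by linarith)
              rw [e1, e2, Prod.mk_zero_zero, map_zero]
              simp
          · exact ((hcc.comp (continuous_const.sub continuous_id)).const_mul _
              ).intervalIntegrable _ _
      _ = ‖f i‖ * B * ∫ s in (-1)..t, ‖c (z i s, z' i s)‖ := by
          rw [intervalIntegral.integral_const_mul,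
            intervalIntegral.integral_comp_sub_left (fun s => ‖c (z i s, z' i s)‖) t]
          congr 2 <;> ring
      _ ≤ ‖f i‖ * B * K i := by
          gcongr
          exact hzK i t (by linarith)
      _ = _ := by ring
  have hφi : IntervalIntegrable φ volume 0 1 := hφ2.continuous.intervalIntegrable _ _
  have hdiff : ‖c (x t, x' t) - ∫ s in (0 : ℝ)..1, φ s • c (x (t - s), x' (t - s))‖ ≤ δ := by
    have e1 : c (x t, x' t) = ∫ s in (0 : ℝ)..1, φ s • c (x t, x' t) := by
      rw [intervalIntegral.integral_smul_const, hφ1, one_smul]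
    have i1 : IntervalIntegrable (fun s => φ s • c (x t, x' t)) volume 0 1 :=
      (hφ2.continuous.smul continuous_const).intervalIntegrable _ _
    have i2 : IntervalIntegrable (fun s => φ s • c (x (t - s), x' (t - s))) volume 0 1 :=
      (hφ2.continuous.smul hy).intervalIntegrable _ _
    rw [e1, ← intervalIntegral.integral_sub i1 i2]
    calc _ ≤ ∫ s in (0 : ℝ)..1, φ s * δ := by
          refine intervalIntegral.norm_integral_le_of_norm_le zero_le_one (ae_of_all _ ?_)
            (hφi.mul_const δ)
          intro s hs
          rw [← smul_sub, norm_smul, Real.norm_of_nonneg (hφ0 s)]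
          by_cases h : φ s = 0
          · simp [h]
          · have h1 := hφε (subset_tsupport _ h)
            have h2 := hε₀' (x := s) (by
              rw [Real.dist_eq, sub_zero, abs_of_pos h1.1]
              exact h1.2.trans_le (min_le_left _ _))
            rw [dist_comm, dist_eq_norm, sub_zero] at h2
            exact mul_le_mul_of_nonneg_left h2.le (hφ0 s)
      _ = δ := by rw [intervalIntegral.integral_mul_const, hφ1, one_mul]
  calc ‖c (x t, x' t)‖ ≤ ‖∫ s in (0 : ℝ)..1, φ s • c (x (t - s), x' (t - s))‖ + δ := by
        have := norm_sub_norm_le (c (x t, x' t))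
          (∫ s in (0 : ℝ)..1, φ s • c (x (t - s), x' (t - s)))
        linarith
    _ ≤ (∑ i, ‖f i‖ * K i) * B + δ := by
        rw [hid, Finset.sum_mul]
        gcongr
        exact (norm_sum_le _ _).trans (Finset.sum_le_sum fun i _ => hterm i)

end BIBO

/-! ### Convex Lyapunov functionals, Grönwall, and the energy estimate. -/

section Dissipation

theorem le_of_forall_pos_le_add_mul {a b k : ℝ} (hk : 0 ≤ k) (h : ∀ η > 0, a ≤ b + k * η) :
    a ≤ b := by
  refine le_of_forall_pos_le_add fun δ hδ => ?_
  refine (h (δ / (k + 1)) (by positivity)).trans ?_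
  have : k * (δ / (k + 1)) ≤ δ := by
    rw [mul_div_assoc', div_le_iff₀ (by positivity)]
    nlinarith
  linarith

variable {X : Type*} [NormedAddCommGroup X] [NormedSpace ℝ X]

theorem continuous_of_subgradient {J : X → ℝ} {L : X → X →ₗ[ℝ] ℝ} {C : ℝ}
    (hJ : ∀ x y, J x - J y ≤ L x (x - y)) (hL : ∀ x h, |L x h| ≤ C * ‖h‖) : Continuous J := by
  have hC : ∀ x y, J x - J y ≤ C.toNNReal * dist x y := fun x y => by
    have := (hJ x y).trans ((le_abs_self _).trans (hL x (x - y)))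
    rw [← dist_eq_norm] at this
    refine this.trans ?_
    gcongr
    exact Real.le_coe_toNNReal C
  refine (LipschitzWith.of_dist_le_mul (K := C.toNNReal) fun x y => ?_).continuous
  rw [Real.dist_eq, abs_le]
  constructor
  · have := hC y x
    rw [dist_comm] at this
    linarith
  · exact hC x y

/-- The chain rule inequality for a functional with subgradients along a differentiable curve. -/
theorem sub_le_integral_of_subgradient {J : X → ℝ} {L : X → X →ₗ[ℝ] ℝ} {C : ℝ}
    (hJ : ∀ x y, J x - J y ≤ L x (x - y)) (hL : ∀ x h, |L x h| ≤ C * ‖h‖) {x x' : ℝ → X}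
    (hx : ∀ t, HasDerivAt x (x' t) t) {r : ℝ → ℝ} (hr : Continuous r)
    (hLr : ∀ t, L (x t) (x' t) ≤ r t) {t₀ t₁ : ℝ} (ht : t₀ ≤ t₁) :
    J (x t₁) - J (x t₀) ≤ ∫ t in t₀..t₁, r t := by
  have hJc : Continuous J := continuous_of_subgradient hJ hL
  have hxc : Continuous x := continuous_iff_continuousAt.2 fun t => (hx t).continuousAt
  have hLc : ∀ x, Continuous (L x) := fun x => by
    refine AddMonoidHomClass.continuous_of_bound (L x) C fun h => ?_
    exact hL x h
  -- The subgradient inequality at `x t` bounds difference quotients towards earlier times from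
  -- above. The comparison lemma uses right slopes, so time is reversed.
  have key := image_le_of_liminf_slope_right_le_deriv_boundary (a := 0) (b := t₁ - t₀)
    (f := fun s => -J (x (t₁ - s))) (B := fun s => -J (x t₁) + ∫ t in t₁ - s..t₁, r t)
    (B' := fun s => r (t₁ - s)) ?_ ?_ ?_ ?_ ?_ (x := t₁ - t₀)
    (right_mem_Icc.2 (by linarith))
  · rw [sub_sub_cancel] at key
    linarith
  · exact (hJc.comp (hxc.comp (continuous_const.sub continuous_id))).neg.continuousOn
  · simp
  · have h1 : Continuous fun s => ∫ t in t₁..s, r t :=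
      intervalIntegral.continuous_primitive (fun a b => hr.intervalIntegrable a b) t₁
    have h2 : (fun s => -J (x t₁) + ∫ t in t₁ - s..t₁, r t) =
        fun s => -J (x t₁) + -∫ t in t₁..t₁ - s, r t := by
      ext s
      rw [intervalIntegral.integral_symm]
    rw [h2]
    exact (continuous_const.add (h1.comp (continuous_const.sub continuous_id)).neg).continuousOn
  · intro s _
    have h1 : HasDerivAt (fun s => ∫ t in t₁..s, r t) (r (t₁ - s)) (t₁ - s) :=
      intervalIntegral.integral_hasDerivAt_right (hr.intervalIntegrable _ _)
        hr.aestronglyMeasurable.stronglyMeasurableAtFilter hr.continuousAt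
    have h2 := (h1.comp_const_sub t₁ s).neg.const_add (-J (x t₁))
    rw [neg_neg] at h2
    refine (h2.congr_of_eventuallyEq (Eventually.of_forall fun q => ?_)).hasDerivWithinAt
    simp only
    rw [intervalIntegral.integral_symm]
    rfl
  · intro s _ ρ hρ
    refine Eventually.frequently ?_
    have h1 : HasDerivAt (fun q => x (t₁ - q)) (-x' (t₁ - s)) s := (hx (t₁ - s)).comp_const_sub t₁ s
    have h2 := (hasDerivAt_iff_tendsto_slope.1 h1).mono_left
      (nhdsWithin_mono s (fun q (hq : s < q) => hq.ne'))
    have h3 := ((hLc (x (t₁ - s))).tendsto _).comp h2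
    have h4 : -ρ < L (x (t₁ - s)) (-x' (t₁ - s)) := by
      rw [map_neg]
      linarith [hLr (t₁ - s)]
    filter_upwards [h3.eventually_const_lt h4, self_mem_nhdsWithin] with q hq hsq
    have hsq : s < q := hsq
    simp only [Function.comp_apply, slope_def_module, map_smul, smul_eq_mul] at hq
    rw [slope_def_field, div_lt_iff₀ (sub_pos.2 hsq)]
    have h5 := hJ (x (t₁ - s)) (x (t₁ - q))
    have h6 : L (x (t₁ - s)) (x (t₁ - q) - x (t₁ - s)) =
        -L (x (t₁ - s)) (x (t₁ - s) - x (t₁ - q)) := by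
      rw [← map_neg, neg_sub]
    rw [h6, inv_mul_eq_div, lt_div_iff₀ (sub_pos.2 hsq)] at hq
    linarith

variable {W U Y : Type*} [NormedAddCommGroup W] [NormedSpace ℝ W] [NormedAddCommGroup U]
  [NormedSpace ℝ U] [NormedAddCommGroup Y] [NormedSpace ℝ Y]

/-- Grönwall's inequality in integral form. -/
theorem le_exp_mul_of_le_integral {j f : ℝ → ℝ} (hj : Continuous j) (hf : Continuous f)
    (hf0 : ∀ t, 0 ≤ f t) {k a t₀ t₁ : ℝ} (hk : 0 ≤ k) (ht : t₀ ≤ t₁)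
    (h : ∀ t, t₀ ≤ t → j t ≤ a + ∫ s in t₀..t, (f s + k * j s)) :
    a + ∫ s in t₀..t₁, (f s + k * j s) ≤
      Real.exp (k * (t₁ - t₀)) * (a + ∫ s in t₀..t₁, f s) := by
  set P : ℝ → ℝ := fun t => a + ∫ s in t₀..t, (f s + k * j s) with hP
  have hint : ∀ {g : ℝ → ℝ}, Continuous g → ∀ t, HasDerivAt (fun t => ∫ s in t₀..t, g s) (g t) t :=
    fun hg t => intervalIntegral.integral_hasDerivAt_right (hg.intervalIntegrable _ _)
      hg.aestronglyMeasurable.stronglyMeasurableAtFilter hg.continuousAt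
  have hP' : ∀ t, HasDerivAt P (f t + k * j t) t := fun t =>
    (hint (hf.add (continuous_const.mul hj)) t).const_add a
  have hE : ∀ t : ℝ, HasDerivAt (fun t : ℝ => Real.exp (-k * (t - t₀)))
      (Real.exp (-k * (t - t₀)) * (-k)) t := by
    intro t
    simpa using (((hasDerivAt_id t).sub_const t₀).const_mul (-k)).exp
  -- `Q` is antitone: `P' = f + k j ≤ f + k P`, and the exponential factor in front of `f ≥ 0` is at
  -- most one.
  set Q : ℝ → ℝ := fun t => Real.exp (-k * (t - t₀)) * P t - ∫ s in t₀..t, f s with hQ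
  have hQ' : ∀ t, HasDerivAt Q (Real.exp (-k * (t - t₀)) * (-k) * P t +
      Real.exp (-k * (t - t₀)) * (f t + k * j t) - f t) t := fun t =>
    ((hE t).mul (hP' t)).sub (hint hf t)
  have hanti : AntitoneOn Q (Ici t₀) := by
    refine antitoneOn_of_deriv_nonpos (convex_Ici t₀)
      (fun t _ => (hQ' t).continuousAt.continuousWithinAt)
      (fun t _ => (hQ' t).differentiableAt.differentiableWithinAt) fun t hts => ?_
    rw [interior_Ici] at hts
    have hts : t₀ < t := hts
    rw [(hQ' t).deriv]
    have h1 : j t ≤ P t := h t hts.le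
    have h2 : Real.exp (-k * (t - t₀)) ≤ 1 := Real.exp_le_one_iff.2 (by nlinarith)
    have h3 := Real.exp_pos (-k * (t - t₀))
    nlinarith [mul_nonneg h3.le (mul_nonneg hk (sub_nonneg.2 h1)), hf0 t]
  have h1 : Q t₁ ≤ Q t₀ := hanti self_mem_Ici ht ht
  simp only [hQ, hP, sub_self, mul_zero, Real.exp_zero, one_mul, intervalIntegral.integral_same,
    add_zero, sub_zero] at h1
  have h2 : Real.exp (k * (t₁ - t₀)) * Real.exp (-k * (t₁ - t₀)) = 1 := by
    rw [← Real.exp_add]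
    simp
  have h3 := mul_le_mul_of_nonneg_left (sub_le_iff_le_add.1 h1) (Real.exp_pos (k * (t₁ - t₀))).le
  rwa [← mul_assoc, h2, one_mul] at h3

/-- Integrating the dissipation inequality bounds the state and the integral of `o` at once, and `o`
together with the input dominates the output. The parameter `η` is the error of smoothing the norm;
since `c₀` and `C` do not depend on it, it can be sent to zero at the end. -/
theorem energyEstimate_of_dissipative {N : X × X →L[ℝ] W} {d : X × X →L[ℝ] U}
    {c : X × X →L[ℝ] Y} {o : X × X → ℝ} (ho : Continuous o) (ho0 : ∀ p, 0 ≤ o p) {c₀ C : ℝ}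
    (hc₀ : 0 < c₀) (hC : 0 ≤ C) (hc : ∀ p, N p = 0 → ‖c p‖ ≤ C * (o p + ‖d p‖))
    (hJ : ∀ η > 0, ∃ (J : X → ℝ) (L : X → X →ₗ[ℝ] ℝ),
      (∀ x, c₀ * ‖x‖ ≤ J x ∧ J x ≤ C * (‖x‖ + η)) ∧ (∀ x y, J x - J y ≤ L x (x - y)) ∧
      (∀ x h, |L x h| ≤ C * ‖h‖) ∧
      ∀ x z, N (x, z) = 0 → L x z ≤ -o (x, z) + C * (‖d (x, z)‖ + ‖x‖ + η)) :
    EnergyEstimate N d c := by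
  intro τ hτ
  -- Chosen so that `C ‖x‖ ≤ k J x`; it is the Grönwall growth rate.
  set k := C / c₀ with hk
  have hk0 : 0 ≤ k := by positivity
  set E := Real.exp (k * τ) with hE
  have hE0 : 0 < E := Real.exp_pos _
  -- The first summand is the constant for the state, the second the one for the output.
  refine ⟨E * C / c₀ + C * (E * C + 1), by positivity, fun x x' hx t₀ => ?_⟩
  set I := ∫ t in t₀..t₀ + τ, ‖d (x t, x' t)‖ with hI
  have hdc : Continuous fun t => ‖d (x t, x' t)‖ := (hx.continuous_apply d).norm
  have hoc : Continuous fun t => o (x t, x' t) := ho.comp (hx.continuous.prodMk hx.cont)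
  have hI0 : 0 ≤ I :=
    intervalIntegral.integral_nonneg (by linarith) fun _ _ => norm_nonneg _
  have main : ∀ η > 0, c₀ * ‖x (t₀ + τ)‖ + ∫ t in t₀..t₀ + τ, o (x t, x' t) ≤
      E * C * (‖x t₀‖ + I) + E * C * (1 + τ) * η := by
    intro η hη
    obtain ⟨J, L, hJb, hJL, hLb, hdis⟩ := hJ η hη
    have hJc : Continuous fun s => J (x s) :=
      (continuous_of_subgradient hJL hLb).comp hx.continuous
    have hfc : Continuous fun s => C * (‖d (x s, x' s)‖ + η) + k * J (x s) :=
      ((hdc.add continuous_const).const_mul C).add (hJc.const_mul k)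
    have hcurve : ∀ t, t₀ ≤ t → J (x t) + ∫ s in t₀..t, o (x s, x' s) ≤
        J (x t₀) + ∫ s in t₀..t, (C * (‖d (x s, x' s)‖ + η) + k * J (x s)) := by
      intro t ht
      have hr : Continuous fun s => C * (‖d (x s, x' s)‖ + η) + k * J (x s) - o (x s, x' s) :=
        hfc.sub hoc
      have h1 := sub_le_integral_of_subgradient hJL hLb hx.deriv hr (fun s => by
        have h2 := hdis (x s) (x' s) (hx.mem s)
        have h3 : C * ‖x s‖ ≤ k * J (x s) := by
          rw [hk, div_mul_eq_mul_div, le_div_iff₀ hc₀]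
          nlinarith [(hJb (x s)).1]
        linarith) ht
      rw [intervalIntegral.integral_sub (hfc.intervalIntegrable _ _)
        (hoc.intervalIntegrable _ _)] at h1
      linarith
    have hint0 : ∀ t, t₀ ≤ t → 0 ≤ ∫ s in t₀..t, o (x s, x' s) := fun t ht =>
      intervalIntegral.integral_nonneg ht fun s _ => ho0 _
    have hG := le_exp_mul_of_le_integral (j := fun s => J (x s))
      (f := fun s => C * (‖d (x s, x' s)‖ + η)) (k := k) (a := J (x t₀)) (t₀ := t₀) (t₁ := t₀ + τ)
      hJc ((hdc.add continuous_const).const_mul C) (fun s => by positivity) hk0 (by linarith)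
      (fun t ht => by linarith [hcurve t ht, hint0 t ht])
    have h1 := hcurve (t₀ + τ) (by linarith)
    have h2 : ∫ s in t₀..t₀ + τ, C * (‖d (x s, x' s)‖ + η) = C * (I + τ * η) := by
      rw [intervalIntegral.integral_const_mul, intervalIntegral.integral_add
        (hdc.intervalIntegrable _ _) intervalIntegrable_const]
      simp [hI]
    rw [h2, add_sub_cancel_left] at hG
    calc _ ≤ J (x (t₀ + τ)) + ∫ t in t₀..t₀ + τ, o (x t, x' t) := by
          gcongr; exact (hJb _).1
      _ ≤ E * (J (x t₀) + C * (I + τ * η)) := h1.trans hG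
      _ ≤ E * (C * (‖x t₀‖ + η) + C * (I + τ * η)) := by gcongr; exact (hJb _).2
      _ = _ := by ring
  have main' := le_of_forall_pos_le_add_mul (by positivity) main
  have ho1 : 0 ≤ ∫ t in t₀..t₀ + τ, o (x t, x' t) :=
    intervalIntegral.integral_nonneg (by linarith) fun s _ => ho0 _
  have hn := norm_nonneg (x (t₀ + τ))
  have hsum : 0 ≤ ‖x t₀‖ + I := by positivity
  constructor
  · have h1 : ‖x (t₀ + τ)‖ ≤ E * C / c₀ * (‖x t₀‖ + I) := by
      rw [div_mul_eq_mul_div, le_div_iff₀ hc₀]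
      linarith
    have h2 : 0 ≤ C * (E * C + 1) * (‖x t₀‖ + I) := by positivity
    linarith
  · have h1 : ∫ t in t₀..t₀ + τ, ‖c (x t, x' t)‖ ≤
        ∫ t in t₀..t₀ + τ, C * (o (x t, x' t) + ‖d (x t, x' t)‖) := by
      refine intervalIntegral.integral_mono_on (by linarith)
        ((hx.continuous_apply c).norm.intervalIntegrable _ _)
        (((hoc.add hdc).const_mul C).intervalIntegrable _ _) fun t _ => hc _ (hx.mem t)
    rw [intervalIntegral.integral_const_mul, intervalIntegral.integral_add
      (hoc.intervalIntegrable _ _) (hdc.intervalIntegrable _ _)] at h1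
    have h2 : 0 ≤ E * C / c₀ * (‖x t₀‖ + I) := by positivity
    have h3 : ∫ t in t₀..t₀ + τ, o (x t, x' t) ≤ E * C * (‖x t₀‖ + I) := by
      nlinarith
    have h4 : C * ((∫ t in t₀..t₀ + τ, o (x t, x' t)) + I) ≤
        C * (E * C * (‖x t₀‖ + I) + (‖x t₀‖ + I)) := by
      gcongr
      linarith [norm_nonneg (x t₀)]
    nlinarith

end Dissipation

/-! ### Multiplication and integration as bounded operators on `L¹`. -/

section L1Operators

variable {E F : Type*} [NormedAddCommGroup E] [NormedSpace ℝ E]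
  [NormedAddCommGroup F] [NormedSpace ℝ F]

theorem exists_mulOp {α : Type*} [MeasurableSpace α] {μ : Measure α} {N : α → E →L[ℝ] F}
    (hN : MemLp N ∞ μ) :
    ∃ M : Lp E 1 μ →L[ℝ] Lp F 1 μ, ∀ x, M x =ᵐ[μ] fun ξ => N ξ (x ξ) := by
  refine ⟨(ContinuousLinearMap.id ℝ (E →L[ℝ] F)).holderL μ ∞ 1 1 (hN.toLp N), fun x => ?_⟩
  have h1 := (ContinuousLinearMap.id ℝ (E →L[ℝ] F)).coeFn_holder (r := 1) (hN.toLp N) x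
  filter_upwards [h1, hN.coeFn_toLp] with ξ h2 h3
  rw [h3] at h2
  exact h2

theorem L1.integrableOn {E : Type*} [NormedAddCommGroup E] {a b : ℝ}
    (g : Lp E 1 (volume.restrict (Icc a b))) :
    IntegrableOn g (Icc a b) := L1.integrable_coeFn g

theorem L1.intervalIntegrable {E : Type*} [NormedAddCommGroup E] {a b : ℝ}
    (g : Lp E 1 (volume.restrict (Icc a b))) {s t : ℝ}
    (hs : s ∈ Icc a b) (ht : t ∈ Icc a b) : IntervalIntegrable g volume s t :=
  ((L1.integrableOn g).mono_set (uIcc_subset_Icc hs ht)).intervalIntegrable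

theorem intervalIntegral_congr_ae_Icc {a b : ℝ} {f g : ℝ → E}
    (h : f =ᵐ[volume.restrict (Icc a b)] g) {s t : ℝ} (hs : s ∈ Icc a b) (ht : t ∈ Icc a b) :
    ∫ r in s..t, f r = ∫ r in s..t, g r := by
  refine intervalIntegral.integral_congr_ae ?_
  have := (ae_restrict_iff' measurableSet_Icc).1 h
  filter_upwards [this] with r hr hrs
  exact hr (uIcc_subset_Icc hs ht (uIoc_subset_uIcc hrs))

theorem continuousOn_primitive_of_integrableOn {a b : ℝ} {g : ℝ → E}
    (hg : IntegrableOn g (Icc a b)) : ContinuousOn (fun ξ => ∫ s in a..ξ, g s) (Icc a b) := by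
  rcases le_or_gt a b with h | h
  · have := intervalIntegral.continuousOn_primitive_interval (a := a) (b := b) (f := g)
      (μ := volume) (by rwa [uIcc_of_le h])
    rwa [uIcc_of_le h] at this
  · rw [Icc_eq_empty (not_le.2 h)]
    exact continuousOn_empty _

theorem norm_primitive_le {a b : ℝ} (g : Lp E 1 (volume.restrict (Icc a b))) {ξ : ℝ}
    (hξ : ξ ∈ Icc a b) : ‖∫ s in a..ξ, g s‖ ≤ ‖g‖ := by
  rw [L1.norm_eq_integral_norm, intervalIntegral.integral_of_le hξ.1]
  refine (norm_integral_le_integral_norm _).trans ?_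
  exact setIntegral_mono_set (L1.integrableOn g).norm (ae_of_all _ fun _ => norm_nonneg _)
    (Eventually.of_forall fun s hs => ⟨hs.1.le, hs.2.trans hξ.2⟩)

theorem exists_primitiveOp (a b : ℝ) :
    ∃ I : Lp E 1 (volume.restrict (Icc a b)) →L[ℝ] Lp E 1 (volume.restrict (Icc a b)),
      ∀ g, I g =ᵐ[volume.restrict (Icc a b)] fun ξ => ∫ s in a..ξ, g s := by
  have hint : ∀ g : Lp E 1 (volume.restrict (Icc a b)),
      Integrable (fun ξ => ∫ s in a..ξ, g s) (volume.restrict (Icc a b)) := fun g =>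
    (continuousOn_primitive_of_integrableOn (L1.integrableOn g)).integrableOn_compact isCompact_Icc
  let I : Lp E 1 (volume.restrict (Icc a b)) →ₗ[ℝ] Lp E 1 (volume.restrict (Icc a b)) :=
    { toFun := fun g => (hint g).toL1 _
      map_add' := fun f g => by
        rw [← Integrable.toL1_add]
        refine (Integrable.toL1_eq_toL1_iff _ _ _ _).2 ?_
        filter_upwards [ae_restrict_mem measurableSet_Icc] with ξ hξ
        have ha : a ∈ Icc a b := ⟨le_rfl, hξ.1.trans hξ.2⟩
        rw [Pi.add_apply, ← intervalIntegral.integral_add (L1.intervalIntegrable f ha hξ)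
          (L1.intervalIntegrable g ha hξ)]
        exact intervalIntegral_congr_ae_Icc (Lp.coeFn_add f g) ha hξ
      map_smul' := fun c f => by
        rw [RingHom.id_apply, ← Integrable.toL1_smul]
        refine (Integrable.toL1_eq_toL1_iff _ _ _ _).2 ?_
        filter_upwards [ae_restrict_mem measurableSet_Icc] with ξ hξ
        have ha : a ∈ Icc a b := ⟨le_rfl, hξ.1.trans hξ.2⟩
        rw [← intervalIntegral.integral_smul]
        exact intervalIntegral_congr_ae_Icc (Lp.coeFn_smul c f) ha hξ }
  refine ⟨I.mkContinuous (b - a) fun g => ?_, fun g => (hint g).coeFn_toL1⟩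
  change ‖(hint g).toL1 _‖ ≤ _
  rcases le_or_gt a b with hab | hab
  · rw [L1.norm_of_fun_eq_integral_norm]
    have h1 : ∫ ξ in Icc a b, ‖∫ s in a..ξ, g s‖ ≤ ∫ _ in Icc a b, ‖g‖ := by
      refine setIntegral_mono_on (hint g).norm (integrableOn_const (by simp)) measurableSet_Icc
        fun ξ hξ => norm_primitive_le g hξ
    refine h1.trans_eq ?_
    simp [hab]
  · have : volume.restrict (Icc a b) = 0 := by rw [Icc_eq_empty (not_le.2 hab)]; simp
    have h2 : ∀ f : Lp E 1 (volume.restrict (Icc a b)), ‖f‖ = 0 := fun f => by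
      rw [L1.norm_eq_integral_norm]
      generalize hf : (f : ℝ → E) = f'
      rw [this]
      simp
    rw [h2, h2, mul_zero]

end L1Operators

/-- Coefficients of the first order differential expression `x ↦ P (H x)' + Q (H x)` on `[a,b]`. -/
structure FirstOrderData (E : Type*) [NormedAddCommGroup E] [NormedSpace ℝ E] (a b : ℝ) where
  a_lt_b : a < b
  P : E →L[ℝ] E
  Pinv : E →L[ℝ] E
  P_Pinv : ∀ v, P (Pinv v) = v
  Pinv_P : ∀ v, Pinv (P v) = v
  Q : ℝ → E →L[ℝ] E
  memLp_Q : MemLp Q ∞ (volume.restrict (Icc a b))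
  H : ℝ → E →L[ℝ] E
  memLp_H : MemLp H ∞ (volume.restrict (Icc a b))

/-! ### The maximal operator and its boundary traces. -/

namespace FirstOrderData

variable {E : Type*} [NormedAddCommGroup E] [NormedSpace ℝ E] {a b : ℝ} (D : FirstOrderData E a b)

/-- `v` is the continuous representative of `H x`, with weak derivative `g`, and
`z = P (H x)' + Q (H x)`. -/
structure IsDiff (x z : Lp E 1 (volume.restrict (Icc a b))) (v g : ℝ → E) : Prop where
  v_ae : ∀ᵐ ξ ∂volume.restrict (Icc a b), v ξ = D.H ξ (x ξ)
  g_int : IntegrableOn g (Icc a b)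
  v_eq : ∀ ξ ∈ Icc a b, v ξ = v a + ∫ s in a..ξ, g s
  z_ae : ∀ᵐ ξ ∂volume.restrict (Icc a b), z ξ = D.P (g ξ) + D.Q ξ (v ξ)

variable [CompleteSpace E]

/-- The graph of the maximal operator is the kernel of a bounded operator, and the boundary values
are bounded functionals on it. -/
theorem exists_graph :
    ∃ (N : Lp E 1 (volume.restrict (Icc a b)) × Lp E 1 (volume.restrict (Icc a b)) →L[ℝ]
        Lp E 1 (volume.restrict (Icc a b)))
      (va vb : Lp E 1 (volume.restrict (Icc a b)) × Lp E 1 (volume.restrict (Icc a b)) →L[ℝ] E),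
      (∀ x z, N (x, z) = 0 → ∃ v g, D.IsDiff x z v g) ∧
      ∀ x z v g, D.IsDiff x z v g → N (x, z) = 0 ∧ v a = va (x, z) ∧ v b = vb (x, z) := by
  have hab := D.a_lt_b
  set μ := volume.restrict (Icc a b) with hμ
  have ha : a ∈ Icc a b := left_mem_Icc.2 hab.le
  have hb : b ∈ Icc a b := right_mem_Icc.2 hab.le
  obtain ⟨MH, hMH⟩ := exists_mulOp D.memLp_H
  obtain ⟨MQ, hMQ⟩ := exists_mulOp D.memLp_Q
  obtain ⟨MP, hMP⟩ := exists_mulOp (memLp_const (μ := μ) (p := ∞) D.Pinv)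
  obtain ⟨I, hI⟩ := exists_primitiveOp (E := E) a b
  let X := Lp E 1 μ
  let fst := ContinuousLinearMap.fst ℝ X X
  let snd := ContinuousLinearMap.snd ℝ X X
  let G : X × X →L[ℝ] X := MP.comp (snd - MQ.comp (MH.comp fst))
  let J : X →L[ℝ] E := L1.integralCLM
  -- A point value is not bounded on `L¹`, but if `v` has derivative `G`, then `v a` is the mean
  -- value over `[a, b]` of `v` minus the primitive of `G`, and this is bounded.
  let va : X × X →L[ℝ] E := (b - a)⁻¹ • J.comp (MH.comp fst - I.comp G)
  let K : E →L[ℝ] X := Lp.constL 1 μ ℝ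
  have hJ : ∀ f : X, J f = ∫ ξ, f ξ ∂μ := fun f => by
    rw [← L1.integral_eq_integral, L1.integral_eq]
  have hK : ∀ e : E, K e =ᵐ[μ] fun _ => e := fun e => Lp.coeFn_const 1 μ e
  have hG : ∀ x z : X, G (x, z) =ᵐ[μ] fun ξ => D.Pinv (z ξ - D.Q ξ (D.H ξ (x ξ))) := by
    intro x z
    filter_upwards [hMP (z - MQ (MH x)), Lp.coeFn_sub z (MQ (MH x)), hMQ (MH x), hMH x]
      with ξ h1 h2 h3 h4
    change (MP (z - MQ (MH x))) ξ = _
    rw [h1, h2, Pi.sub_apply, h3, h4]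
  -- `N (x, z) = 0` says that `H x` is the primitive of `G (x, z)` with initial value `va (x, z)`.
  refine ⟨MH.comp fst - K.comp va - I.comp G, va, va + J.comp G, fun x z hN => ?_,
    fun x z v g h => ?_⟩
  · have hN' : MH x = K (va (x, z)) + I (G (x, z)) := by
      have : MH x - K (va (x, z)) - I (G (x, z)) = 0 := hN
      rw [sub_sub, sub_eq_zero] at this
      exact this
    have hv : ∀ᵐ ξ ∂μ, va (x, z) + ∫ s in a..ξ, G (x, z) s = D.H ξ (x ξ) := by
      have h0 : MH x =ᵐ[μ] ⇑(K (va (x, z)) + I (G (x, z))) := by rw [hN']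
      filter_upwards [h0, Lp.coeFn_add (K (va (x, z))) (I (G (x, z))), hK (va (x, z)),
        hI (G (x, z)), hMH x] with ξ h1 h2 h3 h4 h5
      rw [← h5, h1, h2, Pi.add_apply, h3, h4]
    refine ⟨fun ξ => va (x, z) + ∫ s in a..ξ, G (x, z) s, G (x, z), hv, L1.integrableOn _,
      fun ξ _ => by simp, ?_⟩
    filter_upwards [hv, hG x z] with ξ h1 h2
    rw [h1, h2, D.P_Pinv]
    abel
  · have hg : G (x, z) =ᵐ[μ] g := by
      filter_upwards [hG x z, h.v_ae, h.z_ae] with ξ h1 h2 h3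
      rw [h1, h3, ← h2, add_sub_cancel_right, D.Pinv_P]
    have hMv : ∀ᵐ ξ ∂μ, MH x ξ = v a + I (G (x, z)) ξ := by
      filter_upwards [hMH x, h.v_ae, hI (G (x, z)), ae_restrict_mem measurableSet_Icc]
        with ξ h1 h2 h3 h4
      rw [h1, ← h2, h3, h.v_eq ξ h4, intervalIntegral_congr_ae_Icc hg ha h4]
    have hva : va (x, z) = v a := by
      change (b - a)⁻¹ • J (MH x - I (G (x, z))) = v a
      rw [hJ]
      have : (MH x - I (G (x, z)) : X) =ᵐ[μ] fun _ => v a := by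
        filter_upwards [Lp.coeFn_sub (MH x) (I (G (x, z))), hMv] with ξ h1 h2
        rw [h1, Pi.sub_apply, h2, add_sub_cancel_right]
      rw [integral_congr_ae this, integral_const]
      have hm : μ.real univ = b - a := by simp [hμ, hab.le]
      rw [hm, smul_smul, inv_mul_cancel₀ (by linarith), one_smul]
    refine ⟨?_, hva.symm, ?_⟩
    · change MH x - K (va (x, z)) - I (G (x, z)) = 0
      rw [sub_sub, sub_eq_zero]
      refine Lp.ext ?_
      filter_upwards [hMv, Lp.coeFn_add (K (va (x, z))) (I (G (x, z))), hK (va (x, z))]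
        with ξ h1 h2 h3
      rw [h1, h2, Pi.add_apply, h3, hva]
    · change v b = va (x, z) + J (G (x, z))
      rw [hva, hJ, h.v_eq b hb, intervalIntegral_congr_ae_Icc hg.symm ha hb,
        intervalIntegral.integral_of_le hab.le, ← integral_Icc_eq_integral_Ioc]

end FirstOrderData

/-! ### A smooth convex approximation of the absolute value. -/

section SmoothNorm

variable {𝕜 : Type*} [RCLike 𝕜]

/-- The real inner product on `𝕜`. -/
def reInner (w h : 𝕜) : ℝ := RCLike.re w * RCLike.re h + RCLike.im w * RCLike.im h

/-- A smooth approximation of the norm on `𝕜`. -/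
noncomputable def smoothNorm (η : ℝ) (w : 𝕜) : ℝ := √(‖w‖ ^ 2 + η ^ 2)

/-- The derivative of `smoothNorm η` at `w` in direction `h`. -/
noncomputable def smoothNormDeriv (η : ℝ) (w h : 𝕜) : ℝ := reInner w h / smoothNorm η w

theorem norm_sq_eq_re_im (w : 𝕜) : ‖w‖ ^ 2 = RCLike.re w ^ 2 + RCLike.im w ^ 2 := by
  rw [← RCLike.normSq_eq_def', RCLike.normSq_apply]
  ring

theorem abs_reInner_le (w h : 𝕜) : |reInner w h| ≤ ‖w‖ * ‖h‖ := by
  refine abs_le_of_sq_le_sq ?_ (by positivity)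
  rw [mul_pow, norm_sq_eq_re_im, norm_sq_eq_re_im, reInner]
  nlinarith [sq_nonneg (RCLike.re w * RCLike.im h - RCLike.im w * RCLike.re h)]

theorem reInner_self (w : 𝕜) : reInner w w = ‖w‖ ^ 2 := by
  rw [norm_sq_eq_re_im, reInner]
  ring

theorem reInner_add (w h k : 𝕜) : reInner w (h + k) = reInner w h + reInner w k := by
  simp only [reInner, map_add]
  ring

theorem reInner_smul (w h : 𝕜) (r : ℝ) : reInner w (r • h) = r * reInner w h := by
  simp only [reInner, RCLike.smul_re, RCLike.smul_im]
  ring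

theorem reInner_sub (w h k : 𝕜) : reInner w (h - k) = reInner w h - reInner w k := by
  simp only [reInner, map_sub]
  ring

theorem norm_le_smoothNorm (η : ℝ) (w : 𝕜) : ‖w‖ ≤ smoothNorm η w :=
  Real.le_sqrt_of_sq_le (by nlinarith [sq_nonneg η])

theorem smoothNorm_le {η : ℝ} (hη : 0 ≤ η) (w : 𝕜) : smoothNorm η w ≤ ‖w‖ + η :=
  Real.sqrt_le_iff.2 ⟨by positivity, by nlinarith [norm_nonneg w]⟩

theorem smoothNorm_pos {η : ℝ} (hη : 0 < η) (w : 𝕜) : 0 < smoothNorm η w :=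
  Real.sqrt_pos.2 (by positivity)

theorem smoothNorm_sq (η : ℝ) (w : 𝕜) : smoothNorm η w ^ 2 = ‖w‖ ^ 2 + η ^ 2 :=
  Real.sq_sqrt (by positivity)

theorem continuous_smoothNorm (η : ℝ) : Continuous (smoothNorm η : 𝕜 → ℝ) := by
  unfold smoothNorm
  fun_prop

theorem continuous_smoothNormDeriv {η : ℝ} (hη : 0 < η) :
    Continuous fun p : 𝕜 × 𝕜 => smoothNormDeriv η p.1 p.2 := by
  unfold smoothNormDeriv reInner
  refine Continuous.div ?_ ((continuous_smoothNorm η).comp continuous_fst)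
    fun p => (smoothNorm_pos hη _).ne'
  have h1 : Continuous (RCLike.re : 𝕜 → ℝ) := RCLike.continuous_re
  have h2 : Continuous (RCLike.im : 𝕜 → ℝ) := RCLike.continuous_im
  fun_prop

theorem abs_smoothNormDeriv_le {η : ℝ} (hη : 0 < η) (w h : 𝕜) : |smoothNormDeriv η w h| ≤ ‖h‖ := by
  rw [smoothNormDeriv, abs_div, abs_of_pos (smoothNorm_pos hη w), div_le_iff₀ (smoothNorm_pos hη w)]
  refine (abs_reInner_le w h).trans ?_
  rw [mul_comm]
  gcongr
  exact norm_le_smoothNorm η w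

theorem smoothNormDeriv_add (η : ℝ) (w h k : 𝕜) :
    smoothNormDeriv η w (h + k) = smoothNormDeriv η w h + smoothNormDeriv η w k := by
  rw [smoothNormDeriv, reInner_add, add_div]
  rfl

theorem smoothNormDeriv_smul (η : ℝ) (w h : 𝕜) (r : ℝ) :
    smoothNormDeriv η w (r • h) = r * smoothNormDeriv η w h := by
  rw [smoothNormDeriv, reInner_smul, mul_div_assoc]
  rfl

/-- `smoothNorm η w` is the Euclidean norm of `(w, η)`, so this convexity inequality is
Cauchy–Schwarz for `(w, η)` and `(v, η)`. -/
theorem smoothNorm_sub_le {η : ℝ} (hη : 0 < η) (w v : 𝕜) :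
    smoothNorm η w - smoothNorm η v ≤ smoothNormDeriv η w (w - v) := by
  have hw := smoothNorm_pos hη w
  have hv := smoothNorm_pos hη v
  rw [smoothNormDeriv, le_div_iff₀ hw, reInner_sub, reInner_self]
  have h1 : reInner w v + η ^ 2 ≤ smoothNorm η w * smoothNorm η v := by
    refine le_of_abs_le (abs_le_of_sq_le_sq ?_ (by positivity))
    rw [mul_pow, smoothNorm_sq, smoothNorm_sq]
    have h2 := abs_reInner_le w v
    have h3 : reInner w v ^ 2 ≤ (‖w‖ * ‖v‖) ^ 2 := sq_le_sq' (abs_le.1 h2).1 (abs_le.1 h2).2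
    nlinarith [(abs_le.1 h2).2, mul_nonneg (sq_nonneg η) (sq_nonneg (‖w‖ - ‖v‖)), sq_nonneg η]
  nlinarith [smoothNorm_sq η w]

theorem dist_smoothNorm_le {η : ℝ} (hη : 0 < η) (w v : 𝕜) :
    dist (smoothNorm η w) (smoothNorm η v) ≤ dist w v := by
  rw [Real.dist_eq, dist_eq_norm, abs_le]
  constructor
  · have := (smoothNorm_sub_le hη v w).trans
      ((le_abs_self _).trans (abs_smoothNormDeriv_le hη v _))
    rw [norm_sub_rev] at this
    linarith
  · exact (smoothNorm_sub_le hη w v).trans ((le_abs_self _).trans (abs_smoothNormDeriv_le hη w _))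

theorem HasDerivAt.smoothNorm {η : ℝ} (hη : 0 < η) {w : ℝ → 𝕜} {w' : 𝕜} {t : ℝ}
    (hw : HasDerivAt w w' t) :
    HasDerivAt (fun s => smoothNorm η (w s)) (smoothNormDeriv η (w t) w') t := by
  have h1 : HasDerivAt (fun s => RCLike.re (w s)) (RCLike.re w') t :=
    (RCLike.reCLM (K := 𝕜)).hasFDerivAt.comp_hasDerivAt t hw
  have h2 : HasDerivAt (fun s => RCLike.im (w s)) (RCLike.im w') t :=
    (RCLike.imCLM (K := 𝕜)).hasFDerivAt.comp_hasDerivAt t hw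
  have h3 := (((h1.pow 2).add (h2.pow 2)).add_const (η ^ 2)).sqrt (by
    have : 0 < η ^ 2 := by positivity
    simp only [Pi.add_apply, Pi.pow_apply]
    positivity)
  have h4 : (fun s => _root_.smoothNorm η (w s)) =
      fun s => √(RCLike.re (w s) ^ 2 + RCLike.im (w s) ^ 2 + η ^ 2) := by
    ext s
    rw [_root_.smoothNorm, norm_sq_eq_re_im]
  rw [h4]
  convert! h3 using 1
  rw [smoothNormDeriv, _root_.smoothNorm, norm_sq_eq_re_im, reInner]
  simp only [Pi.add_apply, Pi.pow_apply]
  rw [div_eq_div_iff (by positivity) (by positivity)]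
  push_cast
  ring

end SmoothNorm

/-! ### Integration by parts for absolutely continuous functions. -/

section AbsolutelyContinuous

theorem AbsolutelyContinuousOnInterval.of_dist_le {Y Z : Type*} [PseudoMetricSpace Y]
    [PseudoMetricSpace Z] {f : ℝ → Y} {g : ℝ → Z} {a b C : ℝ} (hC : 0 ≤ C)
    (hg : AbsolutelyContinuousOnInterval g a b)
    (h : ∀ s ∈ uIcc a b, ∀ t ∈ uIcc a b, dist (f s) (f t) ≤ C * dist (g s) (g t)) :
    AbsolutelyContinuousOnInterval f a b := by
  rw [absolutelyContinuousOnInterval_iff] at hg ⊢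
  intro ε hε
  obtain ⟨δ, hδ, hδ'⟩ := hg (ε / (C + 1)) (by positivity)
  refine ⟨δ, hδ, fun I hI hlen => ?_⟩
  have h1 := hδ' I hI hlen
  rw [lt_div_iff₀ (by positivity)] at h1
  have h2 : ∑ i ∈ Finset.range I.1, dist (f (I.2 i).1) (f (I.2 i).2) ≤
      C * ∑ i ∈ Finset.range I.1, dist (g (I.2 i).1) (g (I.2 i).2) := by
    rw [Finset.mul_sum]
    refine Finset.sum_le_sum fun i hi => ?_
    have := hI.1 i hi
    exact h _ this.1 _ this.2
  have h3 : 0 ≤ ∑ i ∈ Finset.range I.1, dist (g (I.2 i).1) (g (I.2 i).2) :=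
    Finset.sum_nonneg fun _ _ => dist_nonneg
  linarith

variable {𝕜 : Type*} [RCLike 𝕜]

/-- Integration by parts for `smoothNorm η ∘ w` with `w` absolutely continuous. -/
theorem integral_smoothNormDeriv {η : ℝ} (hη : 0 < η) {a b : ℝ} (hab : a ≤ b) {w w' : ℝ → 𝕜}
    (hw : AbsolutelyContinuousOnInterval w a b)
    (hw' : ∀ᵐ ξ ∂volume.restrict (Icc a b), HasDerivAt w (w' ξ) ξ) {ρ : ℝ → ℝ} {β : ℝ}
    (hρ : ∀ ξ, HasDerivAt ρ β ξ) :
    ∫ ξ in Icc a b, ρ ξ * smoothNormDeriv η (w ξ) (w' ξ) =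
      ρ b * smoothNorm η (w b) - ρ a * smoothNorm η (w a) -
        β * ∫ ξ in Icc a b, smoothNorm η (w ξ) := by
  have h1 : AbsolutelyContinuousOnInterval (fun ξ => smoothNorm η (w ξ)) a b :=
    .of_dist_le zero_le_one hw fun s _ t _ => by
      rw [one_mul]
      exact dist_smoothNorm_le hη _ _
  have hρd : deriv ρ = fun _ => β := funext fun ξ => (hρ ξ).deriv
  have h2 : AbsolutelyContinuousOnInterval ρ a b := by
    refine ContDiffOn.absolutelyContinuousOnInterval (ContDiff.contDiffOn ?_)
    rw [contDiff_one_iff_deriv, hρd]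
    exact ⟨fun ξ => (hρ ξ).differentiableAt, continuous_const⟩
  have h3 := h2.integral_mul_deriv_eq_deriv_mul h1
  rw [hρd] at h3
  simp only [intervalIntegral.integral_const_mul] at h3
  rw [intervalIntegral.integral_of_le hab, intervalIntegral.integral_of_le hab,
    ← integral_Icc_eq_integral_Ioc, ← integral_Icc_eq_integral_Ioc] at h3
  rw [← h3]
  refine integral_congr_ae ?_
  filter_upwards [hw'] with ξ hξ
  rw [(hξ.smoothNorm hη).deriv]

end AbsolutelyContinuous

/-! ### `C¹` coefficients acting on `W^{1,1}` functions. -/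

section Primitive

variable {E F : Type*} [NormedAddCommGroup E] [NormedSpace ℝ E] [NormedAddCommGroup F]
  [NormedSpace ℝ F] {a b : ℝ} {v g : ℝ → E}

theorem exists_dist_le_of_hasDerivAt {S S' : ℝ → F} (hS : ∀ ξ, HasDerivAt S (S' ξ) ξ)
    (hS' : Continuous S') (a b : ℝ) :
    ∃ C, 0 ≤ C ∧ ∀ s ∈ Icc a b, ∀ t ∈ Icc a b, dist (S s) (S t) ≤ C * dist s t := by
  obtain ⟨C, hC⟩ := isCompact_Icc.exists_bound_of_continuousOn (s := Icc a b) hS'.continuousOn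
  refine ⟨max C 0, le_max_right _ _, fun s hs t ht => ?_⟩
  rw [dist_eq_norm, dist_eq_norm]
  exact (convex_Icc a b).norm_image_sub_le_of_norm_hasDerivWithin_le
    (fun x _ => (hS x).hasDerivWithinAt) (fun x hx => (hC x hx).trans (le_max_left _ _)) ht hs

/-- The increments are dominated by those of the scalar function `∫ ‖g‖ + ξ`: the integral accounts
for `v`, the linear term for the Lipschitz function `S`. -/
theorem absolutelyContinuousOnInterval_clm_apply (hab : a ≤ b) (hg : IntegrableOn g (Icc a b))
    (hv : ∀ ξ ∈ Icc a b, v ξ = v a + ∫ s in a..ξ, g s) {S S' : ℝ → E →L[ℝ] F}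
    (hS : ∀ ξ, HasDerivAt S (S' ξ) ξ) (hS' : Continuous S') :
    AbsolutelyContinuousOnInterval (fun ξ => S ξ (v ξ)) a b := by
  have hii : ∀ {s t}, s ∈ Icc a b → t ∈ Icc a b → IntervalIntegrable g volume s t := fun hs ht =>
    (hg.mono_set (uIcc_subset_Icc hs ht)).intervalIntegrable
  have ha : a ∈ Icc a b := left_mem_Icc.2 hab
  have hb : b ∈ Icc a b := right_mem_Icc.2 hab
  have hN1 : AbsolutelyContinuousOnInterval (fun ξ => ∫ s in a..ξ, ‖g s‖) a b :=
    (hii ha hb).norm.absolutelyContinuousOnInterval_intervalIntegral left_mem_uIcc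
  have hN2 : AbsolutelyContinuousOnInterval (fun ξ : ℝ => ξ) a b :=
    contDiff_id.contDiffOn.absolutelyContinuousOnInterval
  have hN := hN1.add hN2
  obtain ⟨L, hL0, hL⟩ := exists_dist_le_of_hasDerivAt hS hS' a b
  have hSc : Continuous S := continuous_iff_continuousAt.2 fun ξ => (hS ξ).continuousAt
  obtain ⟨CS, hCS⟩ := isCompact_Icc.exists_bound_of_continuousOn (s := Icc a b) hSc.continuousOn
  have hvc : ContinuousOn v (Icc a b) :=
    (continuousOn_const.add (continuousOn_primitive_of_integrableOn hg)).congr hv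
  obtain ⟨Cv, hCv⟩ := isCompact_Icc.exists_bound_of_continuousOn (s := Icc a b) hvc
  have hCS0 : 0 ≤ CS := (norm_nonneg _).trans (hCS a ha)
  have hCv0 : 0 ≤ Cv := (norm_nonneg _).trans (hCv a ha)
  refine .of_dist_le (C := CS + L * Cv) (by positivity) hN ?_
  rw [uIcc_of_le hab]
  have key : ∀ s ∈ Icc a b, ∀ t ∈ Icc a b, s ≤ t → dist (S s (v s)) (S t (v t)) ≤
      (CS + L * Cv) * dist ((∫ r in a..s, ‖g r‖) + s) ((∫ r in a..t, ‖g r‖) + t) := by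
    intro s hs t ht hst
    have h1 : ‖v t - v s‖ ≤ ∫ r in s..t, ‖g r‖ := by
      rw [hv t ht, hv s hs, add_sub_add_left_eq_sub,
        intervalIntegral.integral_interval_sub_left (hii ha ht) (hii ha hs)]
      exact intervalIntegral.norm_integral_le_integral_norm hst
    have h2 : (∫ r in a..t, ‖g r‖) - ∫ r in a..s, ‖g r‖ = ∫ r in s..t, ‖g r‖ :=
      intervalIntegral.integral_interval_sub_left (hii ha ht).norm (hii ha hs).norm
    have h3 : 0 ≤ ∫ r in s..t, ‖g r‖ :=
      intervalIntegral.integral_nonneg hst fun _ _ => norm_nonneg _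
    have h4 : dist ((∫ r in a..s, ‖g r‖) + s) ((∫ r in a..t, ‖g r‖) + t) =
        (∫ r in s..t, ‖g r‖) + (t - s) := by
      rw [dist_comm, Real.dist_eq, abs_of_nonneg] <;> linarith
    have h5 : S s (v s) - S t (v t) = (S s - S t) (v s) - S t (v t - v s) := by
      simp
    rw [h4, dist_eq_norm, h5]
    have h6 : ‖(S s - S t) (v s)‖ ≤ L * (t - s) * Cv := by
      refine (S s - S t).le_of_opNorm_le_of_le ?_ (hCv s hs)
      have := hL s hs t ht
      rwa [dist_eq_norm, dist_comm, Real.dist_eq, abs_of_nonneg (by linarith)] at this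
    have h7 : ‖S t (v t - v s)‖ ≤ CS * ∫ r in s..t, ‖g r‖ :=
      (S t).le_of_opNorm_le_of_le (hCS t ht) h1
    have h8 : 0 ≤ t - s := by linarith
    calc _ ≤ L * (t - s) * Cv + CS * ∫ r in s..t, ‖g r‖ :=
          (norm_sub_le _ _).trans (add_le_add h6 h7)
      _ ≤ _ := by nlinarith [mul_nonneg hCS0 h8, mul_nonneg (mul_nonneg hL0 hCv0) h3]
  intro s hs t ht
  rcases le_total s t with h | h
  · exact key s hs t ht h
  · rw [dist_comm]
    refine (key t ht s hs h).trans_eq ?_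
    rw [dist_comm]
    rfl

theorem ae_hasDerivAt_clm_apply [CompleteSpace E] (hab : a ≤ b) (hg : IntegrableOn g (Icc a b))
    (hv : ∀ ξ ∈ Icc a b, v ξ = v a + ∫ s in a..ξ, g s) {S S' : ℝ → E →L[ℝ] F}
    (hS : ∀ ξ, HasDerivAt S (S' ξ) ξ) :
    ∀ᵐ ξ ∂volume.restrict (Icc a b),
      HasDerivAt (fun ξ => S ξ (v ξ)) (S' ξ (v ξ) + S ξ (g ξ)) ξ := by
  rw [← restrict_Ioo_eq_restrict_Icc, ae_restrict_iff' measurableSet_Ioo]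
  have hii : IntervalIntegrable g volume a b :=
    (hg.mono_set (uIcc_of_le hab).subset).intervalIntegrable
  filter_upwards [hii.ae_hasDerivAt_integral] with ξ h1 hξ
  have h2 := h1 (uIcc_of_le hab ▸ Ioo_subset_Icc_self hξ) a left_mem_uIcc
  have h3 : HasDerivAt v (g ξ) ξ := by
    refine (h2.const_add (v a)).congr_of_eventuallyEq ?_
    filter_upwards [Ioo_mem_nhds hξ.1 hξ.2] with s hs using hv s (Ioo_subset_Icc_self hs)
  exact (hS ξ).clm_apply h3

end Primitive

/-- First order data together with a `C¹`-diagonalisation of the principal part: with `R = S⁻¹`,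
`S P H S⁻¹` is, in the coordinates `π`, the diagonal matrix with entries `σ i * d i`. -/
structure DiagForm (𝕜 E ι : Type*) [RCLike 𝕜] [NormedAddCommGroup E] [NormedSpace ℝ E] [Fintype ι]
    (a b : ℝ) extends FirstOrderData E a b where
  π : ι → E →L[ℝ] 𝕜
  norm_π_le : ∀ i v, ‖π i v‖ ≤ ‖v‖
  norm_le : ∀ v, ‖v‖ ≤ ∑ i, ‖π i v‖
  emb : (ι → 𝕜) →L[ℝ] E
  π_emb : ∀ i c, π i (emb c) = c i
  S : ℝ → E →L[ℝ] E
  S' : ℝ → E →L[ℝ] E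
  R : ℝ → E →L[ℝ] E
  R' : ℝ → E →L[ℝ] E
  hasDerivAt_S : ∀ ξ, HasDerivAt S (S' ξ) ξ
  continuous_S' : Continuous S'
  hasDerivAt_R : ∀ ξ, HasDerivAt R (R' ξ) ξ
  continuous_R' : Continuous R'
  R_S : ∀ ξ ∈ Icc a b, ∀ v, R ξ (S ξ v) = v
  S_R : ∀ ξ ∈ Icc a b, ∀ v, S ξ (R ξ v) = v
  d : ι → ℝ → ℝ
  continuous_d : ∀ i, Continuous (d i)
  d_pos : ∀ i ξ, 0 < d i ξ
  σ : ι → ℝ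
  σ_eq : ∀ i, σ i = 1 ∨ σ i = -1
  S_P_H : ∀ ξ ∈ Icc a b, ∀ x i, π i (S ξ (P (H ξ x))) = (σ i * d i ξ) • π i (S ξ x)

/-! ### Characteristic coordinates and their boundary values. -/

namespace DiagForm

variable {𝕜 E ι : Type*} [RCLike 𝕜] [NormedAddCommGroup E] [NormedSpace ℝ E] [Fintype ι]
  {a b : ℝ} (D : DiagForm 𝕜 E ι a b)

theorem continuous_S : Continuous D.S :=
  continuous_iff_continuousAt.2 fun ξ => (D.hasDerivAt_S ξ).continuousAt

theorem continuous_R : Continuous D.R :=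
  continuous_iff_continuousAt.2 fun ξ => (D.hasDerivAt_R ξ).continuousAt

/-- The `i`-th outgoing boundary value, in characteristic coordinates. -/
noncomputable def outgoing (va vb : E) (i : ι) : 𝕜 :=
  if D.σ i = 1 then D.π i (D.S a (D.P va)) else D.π i (D.S b (D.P vb))

/-- The `i`-th incoming boundary value, in characteristic coordinates. -/
noncomputable def incoming (va vb : E) (i : ι) : 𝕜 :=
  if D.σ i = 1 then D.π i (D.S b (D.P vb)) else D.π i (D.S a (D.P va))

end DiagForm

theorem Continuous.memLp_top_restrict_Icc {F : Type*} [NormedAddCommGroup F] {a b : ℝ}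
    {f : ℝ → F} (hf : Continuous f) :
    MemLp f ∞ (volume.restrict (Icc a b)) := by
  obtain ⟨C, hC⟩ := isCompact_Icc.exists_bound_of_continuousOn (s := Icc a b) hf.continuousOn
  exact memLp_top_of_bound hf.aestronglyMeasurable C
    ((ae_restrict_mem measurableSet_Icc).mono fun ξ hξ => hC ξ hξ)

theorem MemLp.clm_comp {E F G α : Type*} [NormedAddCommGroup E] [NormedSpace ℝ E]
    [NormedAddCommGroup F] [NormedSpace ℝ F] [NormedAddCommGroup G] [NormedSpace ℝ G]
    [MeasurableSpace α] {μ : Measure α} {A : α → F →L[ℝ] G} {B : α → E →L[ℝ] F}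
    (hA : MemLp A ∞ μ) (hB : MemLp B ∞ μ) : MemLp (fun ξ => (A ξ).comp (B ξ)) ∞ μ := by
  refine memLp_top_of_bound (C := (eLpNormEssSup A μ).toReal * (eLpNormEssSup B μ).toReal) ?_ ?_
  · exact (ContinuousLinearMap.compL ℝ E F G).aestronglyMeasurable_comp₂ hA.1 hB.1
  · have h1 : eLpNormEssSup A μ < ∞ := by simpa [eLpNorm_exponent_top] using hA.2
    have h2 : eLpNormEssSup B μ < ∞ := by simpa [eLpNorm_exponent_top] using hB.2
    filter_upwards [ae_le_eLpNormEssSup (f := A) (μ := μ), ae_le_eLpNormEssSup (f := B) (μ := μ)]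
      with ξ h3 h4
    refine ((A ξ).opNorm_comp_le (B ξ)).trans ?_
    have h5 := ENNReal.toReal_mono h1.ne h3
    have h6 := ENNReal.toReal_mono h2.ne h4
    simp only [toReal_enorm] at h5 h6
    gcongr

/-! ### Integrability of the weighted smoothed norms. -/

section WeightedIntegrals

variable {𝕜 : Type*} [RCLike 𝕜] {a b : ℝ}

theorem integrable_mul_smoothNormDeriv {η : ℝ} (hη : 0 < η) {ρ : ℝ → ℝ} (hρ : Continuous ρ)
    (hρ1 : ∀ ξ ∈ Icc a b, |ρ ξ| ≤ 1) {f h : ℝ → 𝕜}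
    (hf : AEStronglyMeasurable f (volume.restrict (Icc a b))) (hh : IntegrableOn h (Icc a b)) :
    IntegrableOn (fun ξ => ρ ξ * smoothNormDeriv η (f ξ) (h ξ)) (Icc a b) ∧
      |∫ ξ in Icc a b, ρ ξ * smoothNormDeriv η (f ξ) (h ξ)| ≤ ∫ ξ in Icc a b, ‖h ξ‖ := by
  have hb : ∀ᵐ ξ ∂volume.restrict (Icc a b),
      ‖ρ ξ * smoothNormDeriv η (f ξ) (h ξ)‖ ≤ ‖h ξ‖ := by
    filter_upwards [ae_restrict_mem measurableSet_Icc] with ξ hξ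
    rw [norm_mul, Real.norm_eq_abs, Real.norm_eq_abs]
    calc _ ≤ 1 * ‖h ξ‖ := by
          gcongr
          · exact hρ1 ξ hξ
          · exact abs_smoothNormDeriv_le hη _ _
      _ = _ := one_mul _
  have hm : AEStronglyMeasurable (fun ξ => ρ ξ * smoothNormDeriv η (f ξ) (h ξ))
      (volume.restrict (Icc a b)) :=
    hρ.aestronglyMeasurable.mul
      ((continuous_smoothNormDeriv hη).comp_aestronglyMeasurable (hf.prodMk hh.1))
  refine ⟨Integrable.mono hh hm hb, ?_⟩
  rw [← Real.norm_eq_abs]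
  exact norm_integral_le_of_norm_le hh.norm hb

theorem integrable_mul_smoothNorm {η : ℝ} (hη : 0 < η) {ρ : ℝ → ℝ} (hρ : Continuous ρ)
    {f : ℝ → 𝕜} (hf : IntegrableOn f (Icc a b)) :
    IntegrableOn (fun ξ => ρ ξ * smoothNorm η (f ξ)) (Icc a b) := by
  have h1 : IntegrableOn (fun ξ => smoothNorm η (f ξ)) (Icc a b) := by
    refine Integrable.mono' (hf.norm.add (integrableOn_const (C := η) (by simp)))
      ((continuous_smoothNorm η).comp_aestronglyMeasurable hf.1) (ae_of_all _ fun ξ => ?_)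
    rw [Real.norm_of_nonneg (smoothNorm_pos hη _).le]
    exact smoothNorm_le hη.le _
  exact h1.continuousOn_mul hρ.continuousOn isCompact_Icc

end WeightedIntegrals

/-! ### The weighted `L¹` Lyapunov functional. -/

namespace DiagForm

variable {𝕜 E ι : Type*} [RCLike 𝕜] [NormedAddCommGroup E] [NormedSpace ℝ E] [Fintype ι]
  {a b : ℝ} (D : DiagForm 𝕜 E ι a b)

/-- An affine weight which is `1` at the outgoing end and `δ` at the incoming end. -/
noncomputable def weight (δ : ℝ) (i : ι) (ξ : ℝ) : ℝ :=
  (if D.σ i = 1 then 1 else δ) + -(D.σ i * ((1 - δ) / (b - a))) * (ξ - a)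

theorem hasDerivAt_weight (δ : ℝ) (i : ι) (ξ : ℝ) :
    HasDerivAt (D.weight δ i) (-(D.σ i * ((1 - δ) / (b - a)))) ξ := by
  have := (((hasDerivAt_id ξ).sub_const a).const_mul
    (-(D.σ i * ((1 - δ) / (b - a))))).const_add (if D.σ i = 1 then 1 else δ)
  rwa [mul_one] at this

theorem continuous_weight (δ : ℝ) (i : ι) : Continuous (D.weight δ i) := by
  unfold weight
  fun_prop

theorem weight_mem {δ : ℝ} (hδ : δ ≤ 1) (i : ι) {ξ : ℝ} (hξ : ξ ∈ Icc a b) :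
    D.weight δ i ξ ∈ Icc δ 1 := by
  have hab := D.a_lt_b
  have h1 : 0 ≤ (ξ - a) / (b - a) := div_nonneg (by linarith [hξ.1]) (by linarith)
  have h2 : (ξ - a) / (b - a) ≤ 1 := (div_le_one (by linarith)).2 (by linarith [hξ.2])
  unfold weight
  rcases D.σ_eq i with h | h
  · have h3 : (if D.σ i = 1 then 1 else δ) + -(D.σ i * ((1 - δ) / (b - a))) * (ξ - a) =
        1 - (1 - δ) * ((ξ - a) / (b - a)) := by
      rw [if_pos h, h]
      ring
    rw [h3]
    constructor <;> nlinarith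
  · have h3 : (if D.σ i = 1 then 1 else δ) + -(D.σ i * ((1 - δ) / (b - a))) * (ξ - a) =
        δ + (1 - δ) * ((ξ - a) / (b - a)) := by
      rw [if_neg (by rw [h]; norm_num), h]
      ring
    rw [h3]
    constructor <;> nlinarith

/-- For `σ i = 1` transport runs from `b` to `a`, so `a` is the outgoing end with weight one and `b`
the incoming end with weight `δ`; for `σ i = -1` the ends are exchanged. Smoothing costs `η` only at
the incoming end. -/
theorem boundary_term_le {δ η : ℝ} (hδ0 : 0 < δ) (hη : 0 < η) (i : ι) (va vb : E) :
    D.σ i * (D.weight δ i b * smoothNorm η (D.π i (D.S b (D.P vb))) -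
      D.weight δ i a * smoothNorm η (D.π i (D.S a (D.P va)))) ≤
    δ * ‖D.incoming va vb i‖ - ‖D.outgoing va vb i‖ + δ * η := by
  have hab : b - a ≠ 0 := by linarith [D.a_lt_b]
  unfold weight incoming outgoing
  rcases D.σ_eq i with h | h
  · have h1 := smoothNorm_le hη.le (D.π i (D.S b (D.P vb)))
    have h2 := norm_le_smoothNorm η (D.π i (D.S a (D.P va)))
    simp only [h, if_true, sub_self, mul_zero, add_zero, one_mul, neg_mul,
      div_mul_cancel₀ _ hab]
    nlinarith
  · have h1 := smoothNorm_le hη.le (D.π i (D.S a (D.P va)))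
    have h2 := norm_le_smoothNorm η (D.π i (D.S b (D.P vb)))
    have h3 : ¬ (-1 : ℝ) = 1 := by norm_num
    simp only [h, h3, if_false, sub_self, mul_zero, add_zero, neg_mul, one_mul, neg_neg,
      div_mul_cancel₀ _ hab]
    nlinarith

variable [CompleteSpace E]

/-- With `w = S P H x`, the functional is the sum of the integrals of `weight * d⁻¹ * smoothNorm η
w_i`. As `w_i = σ_i d_i (S x)_i`, the factor `d⁻¹` cancels the speed, and the derivative in the
direction `z` contains `(S z)_i` only. Since `S z` is `w'` plus a bounded operator applied to `x`,
integration by parts leaves boundary terms and terms controlled by `‖x‖ + η`. The constants do not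
depend on `η`. -/
theorem exists_dissipative {δ : ℝ} (hδ0 : 0 < δ) (hδ1 : δ ≤ 1) :
    ∃ c₀ C : ℝ, 0 < c₀ ∧ 0 ≤ C ∧ ∀ η > 0,
      ∃ (J : Lp E 1 (volume.restrict (Icc a b)) → ℝ)
        (L : Lp E 1 (volume.restrict (Icc a b)) → Lp E 1 (volume.restrict (Icc a b)) →ₗ[ℝ] ℝ),
      (∀ x, c₀ * ‖x‖ ≤ J x ∧ J x ≤ C * (‖x‖ + η)) ∧ (∀ x y, J x - J y ≤ L x (x - y)) ∧
      (∀ x h, |L x h| ≤ C * ‖h‖) ∧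
      ∀ x z v g, D.IsDiff x z v g → L x z ≤
        ∑ i, (δ * ‖D.incoming (v a) (v b) i‖ - ‖D.outgoing (v a) (v b) i‖) + C * (‖x‖ + η) := by
  have hab := D.a_lt_b
  set μ := volume.restrict (Icc a b) with hμ
  have hmS : MemLp D.S ∞ μ := D.continuous_S.memLp_top_restrict_Icc
  have hmS' : MemLp D.S' ∞ μ := D.continuous_S'.memLp_top_restrict_Icc
  have hmP : MemLp (fun _ : ℝ => D.P) ∞ μ := memLp_const _
  obtain ⟨MS, hMS⟩ := exists_mulOp hmS
  obtain ⟨MW, hMW⟩ := exists_mulOp (MemLp.clm_comp hmS (MemLp.clm_comp hmP D.memLp_H))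
  -- `MB` is the zero order remainder `S Q H - S' P H` in `S z = (S P v)' + MB x`.
  obtain ⟨MB, hMB⟩ := exists_mulOp ((MemLp.clm_comp hmS (MemLp.clm_comp D.memLp_Q D.memLp_H)).sub
    (MemLp.clm_comp hmS' (MemLp.clm_comp hmP D.memLp_H)))
  simp only [ContinuousLinearMap.comp_apply, Pi.sub_apply, sub_apply]
    at hMW hMB
  obtain ⟨CR, hCR⟩ := isCompact_Icc.exists_bound_of_continuousOn (s := Icc a b)
    D.continuous_R.continuousOn
  have hCR' : ∀ ξ ∈ Icc a b, ‖D.R ξ‖ ≤ max CR 1 := fun ξ hξ => (hCR ξ hξ).trans (le_max_left _ _)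
  have hCR0 : 0 < max CR 1 := lt_max_of_lt_right one_pos
  set K := ∑ i, ∫ ξ in Icc a b, (D.d i ξ)⁻¹ with hK
  have hdinv : ∀ i, Continuous fun ξ => (D.d i ξ)⁻¹ := fun i =>
    (D.continuous_d i).inv₀ fun ξ => (D.d_pos i ξ).ne'
  have hK0 : 0 ≤ K :=
    Finset.sum_nonneg fun i _ => integral_nonneg fun ξ => (inv_pos.2 (D.d_pos i ξ)).le
  set m : ℝ := (Fintype.card ι : ℝ) with hm
  have hm0 : 0 ≤ m := Nat.cast_nonneg _
  set C := m * ‖MS‖ + K + m * ‖MB‖ + m * ((b - a)⁻¹ * ‖MW‖) + m + m with hC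
  have hba : 0 < (b - a)⁻¹ := inv_pos.2 (by linarith)
  -- `δ` is the least value of the weights, and `max CR 1` bounds `R = S⁻¹` while staying positive.
  refine ⟨δ / max CR 1, C, by positivity, by positivity, fun η hη => ?_⟩
  have hπint : ∀ (f : Lp E 1 μ) i, IntegrableOn (fun ξ => D.π i (f ξ)) (Icc a b) := fun f i =>
    (D.π i).integrable_comp (L1.integrable_coeFn f)
  have hπle : ∀ (f : Lp E 1 μ) i, ∫ ξ in Icc a b, ‖D.π i (f ξ)‖ ≤ ‖f‖ := fun f i => by
    rw [L1.norm_eq_integral_norm]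
    exact integral_mono (hπint f i).norm (L1.integrable_coeFn f).norm fun ξ => D.norm_π_le i _
  have hρ1 : ∀ i, ∀ ξ ∈ Icc a b, |D.weight δ i ξ| ≤ 1 := fun i ξ hξ => by
    have := D.weight_mem hδ1 i hξ
    rw [abs_of_nonneg (hδ0.le.trans this.1)]
    exact this.2
  have hσ : ∀ i, |D.σ i| = 1 := fun i => by
    rcases D.σ_eq i with h | h <;> simp [h]
  have hder : ∀ (f h : Lp E 1 μ) i, _ := fun f h i =>
    integrable_mul_smoothNormDeriv hη (D.continuous_weight δ i) (hρ1 i) (hπint f i).1 (hπint h i)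
  -- the subgradient
  let L : Lp E 1 μ → Lp E 1 μ →ₗ[ℝ] ℝ := fun x =>
    { toFun := fun h => ∑ i, D.σ i * ∫ ξ in Icc a b,
        D.weight δ i ξ * smoothNormDeriv η (D.π i (MW x ξ)) (D.π i (MS h ξ))
      map_add' := fun h k => by
        rw [← Finset.sum_add_distrib]
        refine Finset.sum_congr rfl fun i _ => ?_
        rw [← mul_add, ← integral_add (hder _ _ i).1 (hder _ _ i).1]
        congr 1
        refine integral_congr_ae ?_
        rw [map_add]
        filter_upwards [Lp.coeFn_add (MS h) (MS k)] with ξ hξ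
        rw [hξ, Pi.add_apply, map_add, smoothNormDeriv_add, mul_add]
      map_smul' := fun r h => by
        rw [RingHom.id_apply, smul_eq_mul, Finset.mul_sum]
        refine Finset.sum_congr rfl fun i _ => ?_
        rw [mul_left_comm, ← integral_const_mul r]
        congr 1
        refine integral_congr_ae ?_
        rw [map_smul]
        filter_upwards [Lp.coeFn_smul r (MS h)] with ξ hξ
        rw [hξ, Pi.smul_apply, (D.π i).map_smul, smoothNormDeriv_smul]
        ring }
  have hLdef : ∀ x h, L x h = ∑ i, D.σ i * ∫ ξ in Icc a b,
      D.weight δ i ξ * smoothNormDeriv η (D.π i (MW x ξ)) (D.π i (MS h ξ)) := fun _ _ => rfl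
  -- the functional
  let q : ι → ℝ → ℝ := fun i ξ => D.weight δ i ξ * (D.d i ξ)⁻¹
  have hq : ∀ i, Continuous (q i) := fun i => (D.continuous_weight δ i).mul (hdinv i)
  have hJi : ∀ x i, IntegrableOn (fun ξ => q i ξ * smoothNorm η (D.π i (MW x ξ))) (Icc a b) :=
    fun x i => integrable_mul_smoothNorm hη (hq i) (hπint _ i)
  have hWS : ∀ (x : Lp E 1 μ), ∀ᵐ ξ ∂μ, ∀ i,
      D.π i (MW x ξ) = (D.σ i * D.d i ξ) • D.π i (MS x ξ) := fun x => by
    filter_upwards [hMW x, hMS x, ae_restrict_mem measurableSet_Icc] with ξ h1 h2 h3 i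
    rw [h1, h2, D.S_P_H ξ h3]
  have hWSn : ∀ (x : Lp E 1 μ), ∀ᵐ ξ ∂μ, ∀ i,
      (D.d i ξ)⁻¹ * ‖D.π i (MW x ξ)‖ = ‖D.π i (MS x ξ)‖ := fun x => by
    filter_upwards [hWS x] with ξ h1 i
    rw [h1, norm_smul, Real.norm_eq_abs, abs_mul, hσ, one_mul, abs_of_pos (D.d_pos i ξ),
      inv_mul_cancel_left₀ (D.d_pos i ξ).ne']
  refine ⟨fun x => ∑ i, ∫ ξ in Icc a b, q i ξ * smoothNorm η (D.π i (MW x ξ)), L,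
    fun x => ⟨?_, ?_⟩, fun x y => ?_, fun x h => ?_, fun x z v g hvg => ?_⟩
  · beta_reduce
    rw [L1.norm_eq_integral_norm, div_mul_eq_mul_div, div_le_iff₀ hCR0, ← integral_const_mul,
      ← integral_finsetSum _ fun i _ => hJi x i, ← integral_mul_const]
    refine integral_mono_ae ((L1.integrable_coeFn x).norm.const_mul δ)
      ((integrable_finsetSum _ fun i _ => hJi x i).mul_const _) ?_
    filter_upwards [hMS x, hWSn x, ae_restrict_mem measurableSet_Icc] with ξ h1 h2 h3
    have h4 : ‖x ξ‖ ≤ max CR 1 * ∑ i, ‖D.π i (MS x ξ)‖ := by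
      conv_lhs => rw [← D.R_S ξ h3 (x ξ)]
      refine (D.R ξ).le_of_opNorm_le_of_le (hCR' ξ h3) ?_
      rw [← h1]
      exact D.norm_le _
    have h5 : ∀ i, δ * ‖D.π i (MS x ξ)‖ ≤ q i ξ * smoothNorm η (D.π i (MW x ξ)) := fun i => by
      rw [← h2 i, mul_assoc]
      have := D.d_pos i ξ
      exact mul_le_mul (D.weight_mem hδ1 i h3).1 (by gcongr; exact norm_le_smoothNorm η _)
        (by positivity) (hδ0.le.trans (D.weight_mem hδ1 i h3).1)
    calc δ * ‖x ξ‖ ≤ δ * (max CR 1 * ∑ i, ‖D.π i (MS x ξ)‖) := by gcongr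
      _ = (∑ i, δ * ‖D.π i (MS x ξ)‖) * max CR 1 := by rw [← Finset.mul_sum]; ring
      _ ≤ _ := mul_le_mul_of_nonneg_right (Finset.sum_le_sum fun i _ => h5 i) hCR0.le
  · have h1 : ∀ i, ∫ ξ in Icc a b, q i ξ * smoothNorm η (D.π i (MW x ξ)) ≤
        ‖MS‖ * ‖x‖ + η * ∫ ξ in Icc a b, (D.d i ξ)⁻¹ := by
      intro i
      have hdi : IntegrableOn (fun ξ => (D.d i ξ)⁻¹) (Icc a b) :=
        (hdinv i).continuousOn.integrableOn_compact isCompact_Icc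
      calc _ ≤ ∫ ξ in Icc a b, (‖D.π i (MS x ξ)‖ + η * (D.d i ξ)⁻¹) := by
            refine integral_mono_ae (hJi x i) ((hπint _ i).norm.add (hdi.const_mul η)) ?_
            filter_upwards [hWSn x, ae_restrict_mem measurableSet_Icc] with ξ h2 h3
            have h4 := inv_pos.2 (D.d_pos i ξ)
            calc q i ξ * smoothNorm η (D.π i (MW x ξ))
                ≤ 1 * (D.d i ξ)⁻¹ * (‖D.π i (MW x ξ)‖ + η) := by
                  gcongr
                  · exact (smoothNorm_pos hη _).le
                  · exact mul_le_mul_of_nonneg_right (D.weight_mem hδ1 i h3).2 h4.le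
                  · exact smoothNorm_le hη.le _
              _ = _ := by rw [← h2 i]; ring
        _ = (∫ ξ in Icc a b, ‖D.π i (MS x ξ)‖) + η * ∫ ξ in Icc a b, (D.d i ξ)⁻¹ := by
            rw [integral_add (hπint _ i).norm (hdi.const_mul η), integral_const_mul]
        _ ≤ _ := by
            gcongr
            exact (hπle _ i).trans (MS.le_opNorm x)
    calc _ ≤ ∑ i, (‖MS‖ * ‖x‖ + η * ∫ ξ in Icc a b, (D.d i ξ)⁻¹) :=
          Finset.sum_le_sum fun i _ => h1 i
      _ = m * ‖MS‖ * ‖x‖ + K * η := by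
          rw [Finset.sum_add_distrib, Finset.sum_const, Finset.card_univ, nsmul_eq_mul,
            ← Finset.mul_sum]
          ring
      _ ≤ (m * ‖MS‖ + K) * (‖x‖ + η) := by
          nlinarith [norm_nonneg x, mul_nonneg (mul_nonneg hm0 (norm_nonneg MS)) hη.le,
            mul_nonneg hK0 (norm_nonneg x)]
      _ ≤ C * (‖x‖ + η) := by
          gcongr
          have : 0 ≤ m * ‖MB‖ + m * ((b - a)⁻¹ * ‖MW‖) + m + m := by positivity
          linarith
  · rw [hLdef, ← Finset.sum_sub_distrib]
    refine Finset.sum_le_sum fun i _ => ?_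
    rw [← integral_sub (hJi x i) (hJi y i), ← integral_const_mul]
    refine integral_mono_ae ((hJi x i).sub (hJi y i)) ((hder _ _ i).1.const_mul _) ?_
    have hMWsub : MW x - MW y = MW (x - y) := (map_sub _ _ _).symm
    filter_upwards [hWS (x - y), Lp.coeFn_sub (MW x) (MW y), ae_restrict_mem measurableSet_Icc]
      with ξ h1 h2 h3
    rw [hMWsub] at h2
    have h4 := smoothNorm_sub_le hη (D.π i (MW x ξ)) (D.π i (MW y ξ))
    have h5 : D.π i (MW x ξ) - D.π i (MW y ξ) = (D.σ i * D.d i ξ) • D.π i (MS (x - y) ξ) := by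
      rw [← h1 i, h2, Pi.sub_apply, map_sub]
    rw [h5, smoothNormDeriv_smul] at h4
    have h6 : 0 ≤ q i ξ := mul_nonneg (hδ0.le.trans (D.weight_mem hδ1 i h3).1)
      (inv_pos.2 (D.d_pos i ξ)).le
    have h7 := mul_le_mul_of_nonneg_left h4 h6
    rw [mul_sub] at h7
    refine h7.trans_eq ?_
    change D.weight δ i ξ * (D.d i ξ)⁻¹ * _ = _
    have := (D.d_pos i ξ).ne'
    field_simp
  · rw [hLdef]
    calc _ ≤ ∑ i, ‖MS‖ * ‖h‖ := by
          refine (Finset.abs_sum_le_sum_abs _ _).trans (Finset.sum_le_sum fun i _ => ?_)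
          rw [abs_mul, hσ, one_mul]
          exact (hder _ _ i).2.trans ((hπle _ i).trans (MS.le_opNorm h))
      _ = m * ‖MS‖ * ‖h‖ := by
          rw [Finset.sum_const, Finset.card_univ, nsmul_eq_mul]
          ring
      _ ≤ C * ‖h‖ := by
          gcongr
          have : 0 ≤ K + m * ‖MB‖ + m * ((b - a)⁻¹ * ‖MW‖) + m + m := by positivity
          linarith
  · have hSP : ∀ ξ, HasDerivAt (fun ξ => (D.S ξ).comp D.P) ((D.S' ξ).comp D.P) ξ := fun ξ => by
      have := (D.hasDerivAt_S ξ).clm_comp (hasDerivAt_const ξ D.P)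
      simpa using this
    have hSP' : Continuous fun ξ => (D.S' ξ).comp D.P := D.continuous_S'.clm_comp continuous_const
    have hac := absolutelyContinuousOnInterval_clm_apply hab.le hvg.g_int hvg.v_eq hSP hSP'
    have hae := ae_hasDerivAt_clm_apply hab.le hvg.g_int hvg.v_eq hSP
    have hW : ∀ᵐ ξ ∂μ, MW x ξ = D.S ξ (D.P (v ξ)) := by
      filter_upwards [hMW x, hvg.v_ae] with ξ h1 h2
      rw [h1, h2]
    have hZ : ∀ᵐ ξ ∂μ, MS z ξ = (D.S' ξ (D.P (v ξ)) + D.S ξ (D.P (g ξ))) + MB x ξ := by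
      filter_upwards [hMS z, hvg.z_ae, hvg.v_ae, hMB x] with ξ h1 h2 h3 h4
      rw [h1, h2, h4, ← h3, map_add]
      abel
    have key : ∀ i, D.σ i * ∫ ξ in Icc a b,
        D.weight δ i ξ * smoothNormDeriv η (D.π i (MW x ξ)) (D.π i (MS z ξ)) ≤
        (δ * ‖D.incoming (v a) (v b) i‖ - ‖D.outgoing (v a) (v b) i‖) + η +
          ((b - a)⁻¹ * ‖MW‖ * ‖x‖ + η) + ‖MB‖ * ‖x‖ := by
      intro i
      have e1 : ∫ ξ in Icc a b,
          D.weight δ i ξ * smoothNormDeriv η (D.π i (MW x ξ)) (D.π i (MS z ξ)) =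
          (∫ ξ in Icc a b, D.weight δ i ξ * smoothNormDeriv η (D.π i (D.S ξ (D.P (v ξ))))
            (D.π i (D.S' ξ (D.P (v ξ)) + D.S ξ (D.P (g ξ))))) +
          ∫ ξ in Icc a b, D.weight δ i ξ * smoothNormDeriv η (D.π i (MW x ξ)) (D.π i (MB x ξ)) := by
        rw [← sub_eq_iff_eq_add, ← integral_sub (hder _ _ i).1 (hder _ _ i).1]
        refine integral_congr_ae ?_
        filter_upwards [hW, hZ] with ξ h1 h2
        rw [h1, h2, map_add (D.π i) (_ + _), smoothNormDeriv_add]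
        ring
      have hac' : AbsolutelyContinuousOnInterval (fun ξ => D.π i (D.S ξ (D.P (v ξ)))) a b := by
        refine .of_dist_le zero_le_one hac fun s _ t _ => ?_
        rw [one_mul, dist_eq_norm, dist_eq_norm, ← map_sub]
        exact D.norm_π_le i _
      have hae' : ∀ᵐ ξ ∂volume.restrict (Icc a b), HasDerivAt (fun ξ => D.π i (D.S ξ (D.P (v ξ))))
          (D.π i (D.S' ξ (D.P (v ξ)) + D.S ξ (D.P (g ξ)))) ξ := by
        filter_upwards [hae] with ξ hξ
        exact (D.π i).hasFDerivAt.comp_hasDerivAt ξ hξ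
      rw [e1, integral_smoothNormDeriv hη hab.le hac' hae' (D.hasDerivAt_weight δ i), mul_add,
        mul_sub]
      have b1 := D.boundary_term_le hδ0 hη i (v a) (v b)
      have b2 : D.σ i * ∫ ξ in Icc a b,
          D.weight δ i ξ * smoothNormDeriv η (D.π i (MW x ξ)) (D.π i (MB x ξ)) ≤ ‖MB‖ * ‖x‖ := by
        refine (le_abs_self _).trans ?_
        rw [abs_mul, hσ, one_mul]
        exact (hder _ _ i).2.trans ((hπle _ i).trans (MB.le_opNorm x))
      have b3 : ∫ ξ in Icc a b, smoothNorm η (D.π i (D.S ξ (D.P (v ξ)))) ≤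
          ‖MW‖ * ‖x‖ + η * (b - a) := by
        have h1 : ∫ ξ in Icc a b, smoothNorm η (D.π i (D.S ξ (D.P (v ξ)))) ≤
            ∫ ξ in Icc a b, (‖D.π i (MW x ξ)‖ + η) := by
          refine integral_mono_of_nonneg (ae_of_all _ fun ξ => (smoothNorm_pos hη _).le)
            ((hπint _ i).norm.add (integrableOn_const (by simp))) ?_
          filter_upwards [hW] with ξ h1
          rw [h1]
          exact smoothNorm_le hη.le _
        rw [integral_add (hπint _ i).norm (integrableOn_const (by simp))] at h1
        have h2 : ∫ _ in Icc a b, η = η * (b - a) := by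
          simp [hab.le, mul_comm]
        rw [h2] at h1
        linarith [(hπle (MW x) i).trans (MW.le_opNorm x)]
      -- The weight decreases towards the incoming end, so this bulk term has the unfavourable sign;
      -- being of order zero, it is absorbed into the multiple of `‖x‖ + η`.
      have b4 : -(D.σ i * (-(D.σ i * ((1 - δ) / (b - a))) *
          ∫ ξ in Icc a b, smoothNorm η (D.π i (D.S ξ (D.P (v ξ)))))) ≤
          (b - a)⁻¹ * ‖MW‖ * ‖x‖ + η := by
        have h1 : D.σ i * D.σ i = 1 := by rcases D.σ_eq i with h | h <;> simp [h]
        have h2 : 0 ≤ ∫ ξ in Icc a b, smoothNorm η (D.π i (D.S ξ (D.P (v ξ)))) :=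
          integral_nonneg fun ξ => (smoothNorm_pos hη _).le
        set I := ∫ ξ in Icc a b, smoothNorm η (D.π i (D.S ξ (D.P (v ξ))))
        calc _ = (D.σ i * D.σ i) * ((1 - δ) * ((b - a)⁻¹ * I)) := by ring
          _ = (1 - δ) * ((b - a)⁻¹ * I) := by rw [h1, one_mul]
          _ ≤ 1 * ((b - a)⁻¹ * I) := by
              gcongr
              linarith
          _ ≤ 1 * ((b - a)⁻¹ * (‖MW‖ * ‖x‖ + η * (b - a))) := by gcongr
          _ = _ := by
              have : b - a ≠ 0 := by linarith
              field_simp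
      have b5 : δ * η ≤ η := by nlinarith
      linarith
    rw [hLdef]
    calc _ ≤ ∑ i, ((δ * ‖D.incoming (v a) (v b) i‖ - ‖D.outgoing (v a) (v b) i‖) + η +
          ((b - a)⁻¹ * ‖MW‖ * ‖x‖ + η) + ‖MB‖ * ‖x‖) := Finset.sum_le_sum fun i _ => key i
      _ = ∑ i, (δ * ‖D.incoming (v a) (v b) i‖ - ‖D.outgoing (v a) (v b) i‖) +
          (m * η + (m * ((b - a)⁻¹ * ‖MW‖) * ‖x‖ + m * η) + m * ‖MB‖ * ‖x‖) := by
          simp only [Finset.sum_add_distrib, Finset.sum_const, Finset.card_univ, nsmul_eq_mul]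
          ring
      _ ≤ _ := by
          gcongr
          have h1 : 0 ≤ (m * ‖MS‖ + K) * (‖x‖ + η) := by positivity
          have h2 : 0 ≤ (m * ‖MB‖ + m * ((b - a)⁻¹ * ‖MW‖)) * η := by positivity
          have h3 : 0 ≤ (m + m) * ‖x‖ := by positivity
          rw [hC]
          linarith

end DiagForm

theorem setIntegral_sub_midpoint {a b : ℝ} (hab : a ≤ b) :
    ∫ ξ in Icc a b, (ξ - (a + b) / 2) = 0 := by
  rw [integral_Icc_eq_integral_Ioc, ← intervalIntegral.integral_of_le hab,
    intervalIntegral.integral_sub (continuous_id'.intervalIntegrable _ _) intervalIntegrable_const,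
    integral_id,
    intervalIntegral.integral_const, smul_eq_mul]
  ring

theorem exists_norm_le_on_Icc {F : Type*} [NormedAddCommGroup F] {f : ℝ → F} (hf : Continuous f)
    (a b : ℝ) : ∃ C, 0 ≤ C ∧ ∀ ξ ∈ Icc a b, ‖f ξ‖ ≤ C := by
  obtain ⟨C, hC⟩ := isCompact_Icc.exists_bound_of_continuousOn (s := Icc a b) hf.continuousOn
  exact ⟨max C 0, le_max_right _ _, fun ξ hξ => (hC ξ hξ).trans (le_max_left _ _)⟩

/-! ### Boundary layers, and why the boundary condition determines the incoming values. -/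

namespace DiagForm

variable {𝕜 E ι : Type*} [RCLike 𝕜] [NormedAddCommGroup E] [NormedSpace ℝ E] [Fintype ι]
  {a b : ℝ} (D : DiagForm 𝕜 E ι a b)

theorem ext_π {v w : E} (h : ∀ i, D.π i v = D.π i w) : v = w := by
  have h1 := D.norm_le (v - w)
  simp only [map_sub, h, sub_self, norm_zero, Finset.sum_const_zero] at h1
  exact sub_eq_zero.1 (norm_le_zero_iff.1 h1)

/-- The travel time from `a` to `ξ` along the `i`-th characteristic. -/
noncomputable def travelTime (i : ι) (ξ : ℝ) : ℝ := ∫ s in a..ξ, (D.d i s)⁻¹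

theorem hasDerivAt_travelTime (i : ι) (ξ : ℝ) :
    HasDerivAt (D.travelTime i) (D.d i ξ)⁻¹ ξ := by
  have hc : Continuous fun ξ => (D.d i ξ)⁻¹ :=
    (D.continuous_d i).inv₀ fun ξ => (D.d_pos i ξ).ne'
  exact intervalIntegral.integral_hasDerivAt_right (hc.intervalIntegrable _ _)
    hc.aestronglyMeasurable.stronglyMeasurableAtFilter hc.continuousAt

theorem monotone_travelTime (i : ι) : Monotone (D.travelTime i) :=
  monotone_of_hasDerivAt_nonneg (D.hasDerivAt_travelTime i)
    fun ξ => (inv_pos.2 (D.d_pos i ξ)).le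

/-- An exponential, equal to `1` at the incoming end, solving `σ d e' = l e`. -/
noncomputable def profile (l : ℝ) (i : ι) (ξ : ℝ) : ℝ :=
  Real.exp (l * (D.σ i * (D.travelTime i ξ - D.travelTime i (if D.σ i = 1 then b else a))))

theorem hasDerivAt_profile (l : ℝ) (i : ι) (ξ : ℝ) :
    HasDerivAt (D.profile l i) (D.profile l i ξ * (l * (D.σ i * (D.d i ξ)⁻¹))) ξ :=
  ((((D.hasDerivAt_travelTime i ξ).sub_const _).const_mul (D.σ i)).const_mul l).exp

theorem continuous_profile (l : ℝ) (i : ι) : Continuous (D.profile l i) :=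
  continuous_iff_continuousAt.2 fun ξ => (D.hasDerivAt_profile l i ξ).continuousAt

theorem profile_pos (l : ℝ) (i : ι) (ξ : ℝ) : 0 < D.profile l i ξ := Real.exp_pos _

theorem sub_mul_profile_sub_nonneg {l : ℝ} (hl : 0 ≤ l) (i : ι) (s t : ℝ) :
    0 ≤ D.σ i * (s - t) * (D.profile l i s - D.profile l i t) := by
  have key : ∀ s t, t ≤ s → 0 ≤ D.σ i * (s - t) * (D.profile l i s - D.profile l i t) := by
    intro s t hst
    have h1 := D.monotone_travelTime i hst
    rcases D.σ_eq i with h | h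
    · have h2 : D.profile l i t ≤ D.profile l i s := by
        unfold profile
        rw [h]
        gcongr
      rw [h]
      nlinarith
    · have h2 : D.profile l i s ≤ D.profile l i t := by
        unfold profile
        rw [h]
        refine Real.exp_le_exp.2 (mul_le_mul_of_nonneg_left ?_ hl)
        linarith
      rw [h]
      nlinarith
  rcases le_total t s with h | h
  · exact key s t h
  · have := key t s h
    linarith

theorem one_sub_weight_zero (i : ι) (ξ : ℝ) :
    1 - D.weight 0 i ξ - 1 / 2 = D.σ i * (ξ - (a + b) / 2) / (b - a) := by
  have hab : b - a ≠ 0 := by linarith [D.a_lt_b]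
  unfold weight
  rcases D.σ_eq i with h | h
  · rw [h, if_pos rfl]
    field_simp
    ring
  · rw [h, if_neg (by norm_num)]
    field_simp
    ring

/-- Chebyshev's inequality. The cut-off `1 - weight 0` minus its mean `1 / 2` is a multiple of `ξ -
m` with `m` the midpoint, and it is monotone in the same direction as the profile. Hence their
correlation is nonnegative, with a factor `2` that does not depend on `l`. -/
theorem integral_profile_le {l : ℝ} (hl : 0 ≤ l) (i : ι) :
    ∫ ξ in Icc a b, D.profile l i ξ ≤
      2 * ∫ ξ in Icc a b, (1 - D.weight 0 i ξ) * D.profile l i ξ := by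
  have hab := D.a_lt_b
  set m := (a + b) / 2 with hm
  have hint : ∀ {f : ℝ → ℝ}, Continuous f → IntegrableOn f (Icc a b) := fun hf =>
    hf.continuousOn.integrableOn_compact isCompact_Icc
  have hp := D.continuous_profile l i
  have hw := D.continuous_weight 0 i
  have h1 : 0 ≤ ∫ ξ in Icc a b, ((1 - D.weight 0 i ξ) * D.profile l i ξ -
      1 / 2 * D.profile l i ξ - D.σ i / (b - a) * D.profile l i m * (ξ - m)) := by
    refine integral_nonneg fun ξ => ?_
    have h2 := D.sub_mul_profile_sub_nonneg hl i ξ m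
    have h3 : (1 - D.weight 0 i ξ) * D.profile l i ξ -
        1 / 2 * D.profile l i ξ - D.σ i / (b - a) * D.profile l i m * (ξ - m) =
        D.σ i * (ξ - m) * (D.profile l i ξ - D.profile l i m) / (b - a) := by
      have h4 := D.one_sub_weight_zero i ξ
      rw [← hm] at h4
      have h5 : 1 - D.weight 0 i ξ = D.σ i * (ξ - m) / (b - a) + 1 / 2 := by linarith
      rw [h5]
      ring
    simp only [Pi.zero_apply]
    rw [h3]
    exact div_nonneg h2 (by linarith)
  rw [integral_sub (hint (by fun_prop)) (hint (by fun_prop)),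
    integral_sub (hint (by fun_prop)) (hint (by fun_prop)), integral_const_mul, integral_const_mul,
    setIntegral_sub_midpoint hab.le] at h1
  linarith

theorem continuous_weight_mul_profile (l : ℝ) (i : ι) :
    Continuous fun ξ => (1 - D.weight 0 i ξ) * D.profile l i ξ :=
  (continuous_const.sub (D.continuous_weight 0 i)).mul (D.continuous_profile l i)

/-- In characteristic coordinates, a profile concentrated at the incoming ends. -/
noncomputable def layer (l : ℝ) (c : ι → 𝕜) (ξ : ℝ) : E :=
  D.emb fun i => ((1 - D.weight 0 i ξ) * D.profile l i ξ) • c i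

/-- The derivative of `layer`. -/
noncomputable def layerDeriv (l : ℝ) (c : ι → 𝕜) (ξ : ℝ) : E :=
  D.emb fun i => (D.σ i / (b - a) * D.profile l i ξ +
    (1 - D.weight 0 i ξ) * (D.profile l i ξ * (l * (D.σ i * (D.d i ξ)⁻¹)))) • c i

theorem hasDerivAt_layer (l : ℝ) (c : ι → 𝕜) (ξ : ℝ) :
    HasDerivAt (D.layer l c) (D.layerDeriv l c ξ) ξ := by
  refine D.emb.hasFDerivAt.comp_hasDerivAt ξ (hasDerivAt_pi.2 fun i => ?_)
  have h1 := (((D.hasDerivAt_weight 0 i ξ).const_sub 1).mul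
    (D.hasDerivAt_profile l i ξ)).smul_const (c i)
  convert! h1 using 2
  ring

theorem continuous_layerDeriv (l : ℝ) (c : ι → 𝕜) : Continuous (D.layerDeriv l c) := by
  refine D.emb.continuous.comp (continuous_pi fun i => ?_)
  have h1 := D.continuous_profile l i
  have h2 := D.continuous_weight 0 i
  have h3 : Continuous fun ξ => (D.d i ξ)⁻¹ :=
    (D.continuous_d i).inv₀ fun ξ => (D.d_pos i ξ).ne'
  fun_prop

theorem continuous_layer (l : ℝ) (c : ι → 𝕜) : Continuous (D.layer l c) :=
  continuous_iff_continuousAt.2 fun ξ => (D.hasDerivAt_layer l c ξ).continuousAt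

theorem π_layer (l : ℝ) (c : ι → 𝕜) (ξ : ℝ) (i : ι) :
    D.π i (D.layer l c ξ) = ((1 - D.weight 0 i ξ) * D.profile l i ξ) • c i := D.π_emb i _

/-- At the incoming end the cut-off and the profile are both one; at the outgoing end the cut-off is
zero, which matches a vanishing outgoing part. -/
theorem layer_eq {l : ℝ} {va vb : E} (hout : ∀ i, D.outgoing va vb i = 0) :
    D.layer l (D.incoming va vb) a = D.S a (D.P va) ∧
      D.layer l (D.incoming va vb) b = D.S b (D.P vb) := by
  have hab : b - a ≠ 0 := by linarith [D.a_lt_b]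
  have hout := fun i => hout i
  unfold outgoing at hout
  constructor
  · refine D.ext_π fun i => ?_
    rw [π_layer]
    have := hout i
    rcases D.σ_eq i with h | h
    · rw [if_pos h] at this
      simp [weight, h, this]
    · simp [weight, profile, incoming, h, show ¬ (-1 : ℝ) = 1 by norm_num]
  · refine D.ext_π fun i => ?_
    rw [π_layer]
    have := hout i
    rcases D.σ_eq i with h | h
    · simp [weight, profile, incoming, h, inv_mul_cancel₀ hab]
    · rw [if_neg (by rw [h]; norm_num)] at this
      simp [weight, h, this, show ¬ (-1 : ℝ) = 1 by norm_num, hab]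

/-- The state `H⁻¹ P⁻¹ R w` belonging to characteristic coordinates `w`. -/
noncomputable def stateOf (w : ℝ → E) (ξ : ℝ) : E :=
  D.R ξ (D.emb fun i => (D.σ i * (D.d i ξ)⁻¹) • D.π i (w ξ))

theorem continuous_stateOf {w : ℝ → E} (hw : Continuous w) : Continuous (D.stateOf w) := by
  refine D.continuous_R.clm_apply (D.emb.continuous.comp (continuous_pi fun i => ?_))
  have h3 : Continuous fun ξ => (D.d i ξ)⁻¹ :=
    (D.continuous_d i).inv₀ fun ξ => (D.d_pos i ξ).ne'
  exact (continuous_const.mul h3).smul ((D.π i).continuous.comp hw)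

theorem π_S_stateOf (w : ℝ → E) {ξ : ℝ} (hξ : ξ ∈ Icc a b) (i : ι) :
    D.π i (D.S ξ (D.stateOf w ξ)) = (D.σ i * (D.d i ξ)⁻¹) • D.π i (w ξ) := by
  rw [stateOf, D.S_R ξ hξ, D.π_emb]

theorem H_stateOf (w : ℝ → E) {ξ : ℝ} (hξ : ξ ∈ Icc a b) :
    D.H ξ (D.stateOf w ξ) = D.Pinv (D.R ξ (w ξ)) := by
  have h1 : D.S ξ (D.P (D.H ξ (D.stateOf w ξ))) = w ξ := by
    refine D.ext_π fun i => ?_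
    rw [D.S_P_H ξ hξ, D.π_S_stateOf w hξ, smul_smul]
    have h2 : D.σ i * D.d i ξ * (D.σ i * (D.d i ξ)⁻¹) = 1 := by
      have := (D.d_pos i ξ).ne'
      rcases D.σ_eq i with h | h <;> rw [h] <;> field_simp
    rw [h2, one_smul]
  rw [← h1, D.R_S ξ hξ, D.Pinv_P]

variable [CompleteSpace E]

/-- Every `C¹` function `w` of characteristic coordinates belongs to the maximal domain. -/
theorem exists_isDiff {w w' : ℝ → E} (hw : ∀ ξ, HasDerivAt w (w' ξ) ξ) (hw' : Continuous w') :
    ∃ x z : Lp E 1 (volume.restrict (Icc a b)),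
      D.IsDiff x z (fun ξ => D.Pinv (D.R ξ (w ξ)))
        (fun ξ => D.Pinv (D.R' ξ (w ξ) + D.R ξ (w' ξ))) ∧
      (∀ᵐ ξ ∂volume.restrict (Icc a b), x ξ = D.stateOf w ξ) := by
  have hwc : Continuous w := continuous_iff_continuousAt.2 fun ξ => (hw ξ).continuousAt
  have hint : ∀ {f : ℝ → E}, Continuous f → IntegrableOn f (Icc a b) := fun hf =>
    hf.continuousOn.integrableOn_compact isCompact_Icc
  have hv : Continuous fun ξ => D.Pinv (D.R ξ (w ξ)) :=
    D.Pinv.continuous.comp (D.continuous_R.clm_apply hwc)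
  have hg : Continuous fun ξ => D.Pinv (D.R' ξ (w ξ) + D.R ξ (w' ξ)) :=
    D.Pinv.continuous.comp ((D.continuous_R'.clm_apply hwc).add (D.continuous_R.clm_apply hw'))
  have hx := D.continuous_stateOf hwc
  obtain ⟨MQ, hMQ⟩ := exists_mulOp D.memLp_Q
  have hPg := D.P.continuous.comp hg
  have hvi := hint hv
  have hPgi := hint hPg
  have hxi := hint hx
  have hae : ∀ᵐ ξ ∂volume.restrict (Icc a b), (hxi.toL1 _ : ℝ → E) ξ = D.stateOf w ξ :=
    hxi.coeFn_toL1
  refine ⟨hxi.toL1 _, hPgi.toL1 _ + MQ (hvi.toL1 _), ⟨?_, hint hg, fun ξ _ => ?_, ?_⟩, hae⟩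
  · filter_upwards [hae, ae_restrict_mem measurableSet_Icc] with ξ h1 h2
    rw [h1, D.H_stateOf w h2]
  · have hd : ∀ ξ, HasDerivAt (fun ξ => D.Pinv (D.R ξ (w ξ)))
        (D.Pinv (D.R' ξ (w ξ) + D.R ξ (w' ξ))) ξ := fun ξ =>
      D.Pinv.hasFDerivAt.comp_hasDerivAt ξ ((D.hasDerivAt_R ξ).clm_apply (hw ξ))
    rw [intervalIntegral.integral_eq_sub_of_hasDerivAt (fun s _ => hd s)
      (hg.intervalIntegrable _ _)]
    abel
  · filter_upwards [Lp.coeFn_add (hPgi.toL1 _) (MQ (hvi.toL1 _)), hPgi.coeFn_toL1,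
      hMQ (hvi.toL1 _), hvi.coeFn_toL1] with ξ h1 h2 h3 h4
    rw [h1, Pi.add_apply, h2, h3, h4]
    rfl

/-- If the boundary conditions imposed on a generator of a bounded semigroup allow boundary values
without outgoing part, then these vanish: otherwise the profiles concentrated at the incoming ends
contradict the resolvent estimate. -/
theorem boundary_eq_zero {T : C0Semigroup ℝ (Lp E 1 (volume.restrict (Icc a b)))}
    {A : Set (Lp E 1 (volume.restrict (Icc a b)) × Lp E 1 (volume.restrict (Icc a b)))}
    (hA : T.IsGenerator A) {M : ℝ} (hM : ∀ t, ‖T.T t‖ ≤ M) {va vb : E}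
    (hout : ∀ i, D.outgoing va vb i = 0)
    (hmem : ∀ x z v g, D.IsDiff x z v g → v a = va → v b = vb → (x, z) ∈ A) :
    va = 0 ∧ vb = 0 := by
  have hab := D.a_lt_b
  have ha : a ∈ Icc a b := left_mem_Icc.2 hab.le
  have hb : b ∈ Icc a b := right_mem_Icc.2 hab.le
  set μ := volume.restrict (Icc a b) with hμ
  set c := D.incoming va vb with hc
  have hba : 0 < (b - a)⁻¹ := inv_pos.2 (by linarith)
  obtain ⟨CR, hCR0, hCR⟩ := exists_norm_le_on_Icc D.continuous_R a b
  obtain ⟨CR', hCR0', hCR'⟩ := exists_norm_le_on_Icc D.continuous_R' a b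
  obtain ⟨CS, hCS0, hCS⟩ := exists_norm_le_on_Icc D.continuous_S a b
  have hd : ∃ Cd, 0 ≤ Cd ∧ ∀ ξ ∈ Icc a b, ∀ i, D.d i ξ ≤ Cd := by
    obtain ⟨C, hC0, hC⟩ := exists_norm_le_on_Icc (continuous_pi fun i => D.continuous_d i) a b
    exact ⟨C, hC0, fun ξ hξ i => (le_abs_self _).trans ((norm_le_pi_norm _ i).trans (hC ξ hξ))⟩
  obtain ⟨Cd, hCd0, hCd⟩ := hd
  obtain ⟨CQ, hCQ0, hCQ⟩ : ∃ C, 0 ≤ C ∧ ∀ᵐ ξ ∂μ, ‖D.Q ξ‖ ≤ C := by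
    have h2 : eLpNormEssSup D.Q μ < ∞ := by simpa [eLpNorm_exponent_top] using D.memLp_Q.2
    refine ⟨(eLpNormEssSup D.Q μ).toReal, ENNReal.toReal_nonneg, ?_⟩
    filter_upwards [ae_le_eLpNormEssSup (f := D.Q) (μ := μ)] with ξ h3
    simpa using ENNReal.toReal_mono h2.ne h3
  -- `s l ξ` bounds the pointwise size of the profile
  let s : ℝ → ℝ → ℝ := fun l ξ => ∑ i, D.profile l i ξ * ‖c i‖
  have hs0 : ∀ l ξ, 0 ≤ s l ξ := fun l ξ =>
    Finset.sum_nonneg fun i _ => mul_nonneg (D.profile_pos l i ξ).le (norm_nonneg _)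
  have hsc : ∀ l, Continuous (s l) := fun l =>
    continuous_finsetSum _ fun i _ => (D.continuous_profile l i).mul continuous_const
  set C₁ := CR * (‖D.emb‖ * (b - a)⁻¹) + (CR' + CQ * (‖D.Pinv‖ * CR)) with hC₁
  have hC₁0 : 0 ≤ C₁ := by positivity
  set m : ℝ := (Fintype.card ι : ℝ) with hm
  set C₂ := C₁ * (2 * (m * (Cd * CS))) with hC₂
  have hC₂0 : 0 ≤ C₂ := by positivity
  have hM0 : 0 ≤ M := (norm_nonneg _).trans (hM 0)
  -- `C₂` was fixed without reference to `l`, so `l` may be taken larger than `M C₂`.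
  set l := M * C₂ + 1 with hl
  have hl0 : 0 < l := by positivity
  obtain ⟨x, z, hD, hx⟩ := D.exists_isDiff (D.hasDerivAt_layer l c) (D.continuous_layerDeriv l c)
  set w := D.layer l c with hw
  obtain ⟨hwa, hwb⟩ := D.layer_eq (l := l) hout
  have hva : D.Pinv (D.R a (w a)) = va := by rw [hw, hwa, D.R_S a ha, D.Pinv_P]
  have hvb : D.Pinv (D.R b (w b)) = vb := by rw [hw, hwb, D.R_S b hb, D.Pinv_P]
  have hres := hA.mul_norm_le hM (hmem x z _ _ hD hva hvb) hl0
  have hws : ∀ ξ ∈ Icc a b, ‖w ξ‖ ≤ s l ξ := fun ξ hξ => by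
    refine (D.norm_le _).trans (Finset.sum_le_sum fun i _ => ?_)
    have h1 := D.weight_mem zero_le_one i hξ
    have h2 := D.profile_pos l i ξ
    rw [hw, D.π_layer, norm_smul, Real.norm_eq_abs, abs_mul, abs_of_pos h2,
      abs_of_nonneg (by linarith [h1.2])]
    gcongr
    nlinarith [h1.1]
  -- The profile solves `σ d e' = l e`, so the terms of order `l` in `z` and `l • x` cancel. What
  -- remains comes from the derivative of the cut-off, from `R'` and from `Q`, with constants
  -- independent of `l`.
  have hpt : ∀ᵐ ξ ∂μ, ‖(z - l • x : Lp E 1 μ) ξ‖ ≤ C₁ * s l ξ := by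
    filter_upwards [Lp.coeFn_sub z (l • x), Lp.coeFn_smul l x, hx, hD.z_ae, hCQ,
      ae_restrict_mem measurableSet_Icc] with ξ h1 h2 h3 h4 h5 h6
    have e1 : D.layerDeriv l c ξ = D.emb (fun i => (D.σ i / (b - a) * D.profile l i ξ) • c i) +
        l • D.emb (fun i => (D.σ i * (D.d i ξ)⁻¹) • D.π i (w ξ)) := by
      rw [← map_smul, ← map_add]
      unfold layerDeriv
      congr 1
      ext i
      rw [Pi.add_apply, Pi.smul_apply, hw, D.π_layer, smul_smul, smul_smul, ← add_smul]
      congr 1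
      ring
    have e2 : (z - l • x : Lp E 1 μ) ξ =
        D.R ξ (D.emb (fun i => (D.σ i / (b - a) * D.profile l i ξ) • c i)) +
        (D.R' ξ (w ξ) + D.Q ξ (D.Pinv (D.R ξ (w ξ)))) := by
      rw [h1, Pi.sub_apply, h2, Pi.smul_apply, h3, h4, D.P_Pinv, e1, map_add (D.R ξ),
        map_smul (D.R ξ)]
      unfold stateOf
      abel
    rw [e2, hC₁, add_mul, add_mul]
    have b1 : ‖D.emb (fun i => (D.σ i / (b - a) * D.profile l i ξ) • c i)‖ ≤
        ‖D.emb‖ * (b - a)⁻¹ * s l ξ := by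
      rw [mul_assoc]
      refine D.emb.le_of_opNorm_le_of_le le_rfl ?_
      refine (pi_norm_le_iff_of_nonneg (mul_nonneg hba.le (hs0 l ξ))).2 fun i => ?_
      have h7 : |D.σ i| = 1 := by rcases D.σ_eq i with h | h <;> simp [h]
      rw [norm_smul, Real.norm_eq_abs, abs_mul, abs_div, h7, abs_of_pos (D.profile_pos l i ξ),
        abs_of_pos (by linarith : 0 < b - a), one_div, mul_assoc]
      gcongr
      exact Finset.single_le_sum (f := fun i => D.profile l i ξ * ‖c i‖)
        (fun i _ => mul_nonneg (D.profile_pos l i ξ).le (norm_nonneg _)) (Finset.mem_univ i)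
    refine (norm_add_le _ _).trans (add_le_add ?_ ((norm_add_le _ _).trans (add_le_add ?_ ?_)))
    · rw [mul_assoc]
      exact (D.R ξ).le_of_opNorm_le_of_le (hCR ξ h6) b1
    · exact (D.R' ξ).le_of_opNorm_le_of_le (hCR' ξ h6) (hws ξ h6)
    · rw [mul_assoc, mul_assoc]
      refine (D.Q ξ).le_of_opNorm_le_of_le h5 (D.Pinv.le_of_opNorm_le_of_le le_rfl ?_)
      exact (D.R ξ).le_of_opNorm_le_of_le (hCR ξ h6) (hws ξ h6)
  have hint : ∀ {f : ℝ → ℝ}, Continuous f → IntegrableOn f (Icc a b) := fun hf =>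
    hf.continuousOn.integrableOn_compact isCompact_Icc
  -- `s` lacks the cut-off; restoring it costs the factor `2` of `integral_profile_le`, and the
  -- cut-off profile is the characteristic coordinate `w` of `x`.
  have hsint : ∫ ξ in Icc a b, s l ξ ≤ 2 * (m * (Cd * CS)) * ‖x‖ := by
    have hi : ∀ i, ∫ ξ in Icc a b, D.profile l i ξ * ‖c i‖ ≤ 2 * (Cd * CS * ‖x‖) := by
      intro i
      have h1 : ∫ ξ in Icc a b, (1 - D.weight 0 i ξ) * D.profile l i ξ * ‖c i‖ ≤
          ∫ ξ in Icc a b, Cd * CS * ‖x ξ‖ := by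
        refine integral_mono_ae (hint ((D.continuous_weight_mul_profile l i).mul continuous_const))
          ((L1.integrable_coeFn x).norm.const_mul _) ?_
        filter_upwards [hx, ae_restrict_mem measurableSet_Icc] with ξ h2 h3
        have h4 : (1 - D.weight 0 i ξ) * D.profile l i ξ * ‖c i‖ = ‖D.π i (w ξ)‖ := by
          rw [hw, D.π_layer, norm_smul, Real.norm_of_nonneg]
          exact mul_nonneg (by linarith [(D.weight_mem zero_le_one i h3).2])
            (D.profile_pos l i ξ).le
        have h5 : D.π i (w ξ) = (D.σ i * D.d i ξ) • D.π i (D.S ξ (x ξ)) := by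
          rw [h2, D.π_S_stateOf w h3, smul_smul]
          have h6 : D.σ i * D.d i ξ * (D.σ i * (D.d i ξ)⁻¹) = 1 := by
            have := (D.d_pos i ξ).ne'
            rcases D.σ_eq i with h | h <;> rw [h] <;> field_simp
          rw [h6, one_smul]
        have h7 : |D.σ i| = 1 := by rcases D.σ_eq i with h | h <;> simp [h]
        rw [h4, h5, norm_smul, Real.norm_eq_abs, abs_mul, h7, one_mul, abs_of_pos (D.d_pos i ξ),
          mul_assoc]
        gcongr
        · exact hCd ξ h3 i
        · exact (D.norm_π_le i _).trans ((D.S ξ).le_of_opNorm_le (hCS ξ h3) _)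
      rw [integral_mul_const, integral_const_mul, ← L1.norm_eq_integral_norm] at h1
      rw [integral_mul_const]
      have h2 := mul_le_mul_of_nonneg_right (D.integral_profile_le hl0.le i) (norm_nonneg (c i))
      linarith
    calc ∫ ξ in Icc a b, s l ξ = ∑ i, ∫ ξ in Icc a b, D.profile l i ξ * ‖c i‖ :=
          integral_finsetSum _ fun i _ => hint ((D.continuous_profile l i).mul continuous_const)
      _ ≤ ∑ _i : ι, 2 * (Cd * CS * ‖x‖) := Finset.sum_le_sum fun i _ => hi i
      _ = _ := by
          rw [Finset.sum_const, Finset.card_univ, nsmul_eq_mul]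
          ring
  have hzx : ‖z - l • x‖ ≤ C₂ * ‖x‖ := by
    rw [L1.norm_eq_integral_norm]
    calc _ ≤ ∫ ξ in Icc a b, C₁ * s l ξ :=
          integral_mono_ae (L1.integrable_coeFn _).norm (hint ((hsc l).const_mul C₁)) hpt
      _ = C₁ * ∫ ξ in Icc a b, s l ξ := integral_const_mul _ _
      _ ≤ C₁ * (2 * (m * (Cd * CS)) * ‖x‖) := by gcongr
      _ = _ := by ring
  -- The two bounds combine to `(M C₂ + 1) ‖x‖ ≤ M C₂ ‖x‖`.
  have hx0 : x = 0 := by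
    have h1 := hres.trans (mul_le_mul_of_nonneg_left hzx hM0)
    rw [hl] at h1
    exact norm_le_zero_iff.1 (by nlinarith)
  have hv0 : ∀ᵐ ξ ∂μ, D.Pinv (D.R ξ (w ξ)) = 0 := by
    have h1 : x =ᵐ[μ] 0 := by
      rw [hx0]
      exact Lp.coeFn_zero _ _ _
    filter_upwards [hD.v_ae, h1] with ξ h2 h3
    rw [h2, h3, Pi.zero_apply, map_zero]
  have hvc : Continuous fun ξ => D.Pinv (D.R ξ (w ξ)) :=
    D.Pinv.continuous.comp (D.continuous_R.clm_apply (D.continuous_layer l c))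
  have h0 := Measure.eqOn_Icc_of_ae_eq volume hab.ne hv0 hvc.continuousOn continuousOn_const
  exact ⟨hva ▸ h0 ha, hvb ▸ h0 hb⟩

end DiagForm

/-- A `C¹` function on `[0, ∞)` that vanishes with its derivative at `0`, extended by zero. -/
theorem hasDerivAt_indicator_Ici {X : Type*} [NormedAddCommGroup X] [NormedSpace ℝ X]
    {x x' : ℝ → X} (hx : ∀ t ∈ Ici (0 : ℝ), HasDerivWithinAt x (x' t) (Ici 0) t) (h0 : x 0 = 0)
    (h0' : x' 0 = 0) (t : ℝ) :
    HasDerivAt ((Ici 0).indicator x) ((Ici 0).indicator x' t) t := by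
  rcases lt_trichotomy t 0 with h | rfl | h
  · rw [indicator_of_notMem (by simpa using h)]
    refine (hasDerivAt_const t (0 : X)).congr_of_eventuallyEq ?_
    filter_upwards [Iio_mem_nhds h] with s hs
    exact indicator_of_notMem (by simpa using hs) _
  · have h1 : HasDerivWithinAt ((Ici 0).indicator x) (x' 0) (Ici 0) 0 :=
      (hx 0 self_mem_Ici).congr (fun s hs => indicator_of_mem hs _)
        (indicator_of_mem self_mem_Ici _)
    have h2 : HasDerivWithinAt ((Ici 0).indicator x) (x' 0) (Iic 0) 0 := by
      rw [h0']
      have h3 : ∀ s ∈ Iic (0 : ℝ), (Ici 0).indicator x s = 0 := by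
        intro s hs
        rcases eq_or_lt_of_le (mem_Iic.1 hs) with rfl | h
        · rw [indicator_of_mem self_mem_Ici, h0]
        · exact indicator_of_notMem (by simpa using h) _
      exact (hasDerivWithinAt_const 0 _ (0 : X)).congr h3 (h3 0 self_mem_Iic)
    rw [indicator_of_mem self_mem_Ici]
    have h3 := h2.union h1
    rwa [Iic_union_Ici, hasDerivWithinAt_univ] at h3
  · rw [indicator_of_mem (mem_Ici.2 h.le)]
    refine ((hx t h.le).hasDerivAt (Ici_mem_nhds h)).congr_of_eventuallyEq ?_
    filter_upwards [Ioi_mem_nhds h] with s hs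
    exact indicator_of_mem (mem_Ici.2 (le_of_lt hs)) _

theorem continuous_indicator_Ici {X : Type*} [TopologicalSpace X] [Zero X] {f : ℝ → X}
    (hf : ContinuousOn f (Ici 0)) (h0 : f 0 = 0) : Continuous ((Ici (0 : ℝ)).indicator f) := by
  refine continuous_indicator ?_ (by rwa [closure_Ici])
  intro t ht
  rw [frontier_Ici, mem_singleton_iff] at ht
  rw [ht, h0]

/-! ### The energy estimate and the output bound in characteristic form. -/

namespace DiagForm

variable {𝕜 E ι U Y : Type*} [RCLike 𝕜] [NormedAddCommGroup E] [NormedSpace ℝ E] [Fintype ι]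
  [NormedAddCommGroup U] [NormedSpace ℝ U] [NormedAddCommGroup Y] [NormedSpace ℝ Y]
  {a b : ℝ} (D : DiagForm 𝕜 E ι a b)

/-- `outgoing` as a bounded operator. -/
noncomputable def outgoingL : E × E →L[ℝ] (ι → 𝕜) :=
  ContinuousLinearMap.pi fun i => if D.σ i = 1
    then (D.π i).comp ((D.S a).comp (D.P.comp (ContinuousLinearMap.fst ℝ E E)))
    else (D.π i).comp ((D.S b).comp (D.P.comp (ContinuousLinearMap.snd ℝ E E)))

/-- `incoming` as a bounded operator. -/
noncomputable def incomingL : E × E →L[ℝ] (ι → 𝕜) :=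
  ContinuousLinearMap.pi fun i => if D.σ i = 1
    then (D.π i).comp ((D.S b).comp (D.P.comp (ContinuousLinearMap.snd ℝ E E)))
    else (D.π i).comp ((D.S a).comp (D.P.comp (ContinuousLinearMap.fst ℝ E E)))

theorem outgoingL_apply (va vb : E) : D.outgoingL (va, vb) = D.outgoing va vb := by
  ext i
  unfold outgoingL outgoing
  rw [ContinuousLinearMap.pi_apply]
  split_ifs <;> rfl

theorem incomingL_apply (va vb : E) : D.incomingL (va, vb) = D.incoming va vb := by
  ext i
  unfold incomingL incoming
  rw [ContinuousLinearMap.pi_apply]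
  split_ifs <;> rfl

/-- The operator with boundary conditions `B (v a, v b) = 0`. -/
def graph (B : E × E →L[ℝ] U) :
    Set (Lp E 1 (volume.restrict (Icc a b)) × Lp E 1 (volume.restrict (Icc a b))) :=
  {p | ∃ v g, D.IsDiff p.1 p.2 v g ∧ B (v a, v b) = 0}

theorem sum_norm_incoming_le (va vb : E) :
    ∑ i, ‖D.incoming va vb i‖ ≤ Fintype.card ι * ‖D.incomingL‖ * ‖(va, vb)‖ := by
  rw [← incomingL_apply, mul_assoc]
  refine (Finset.sum_le_card_nsmul _ _ _ fun i _ =>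
    (norm_le_pi_norm _ i).trans (D.incomingL.le_opNorm _)).trans_eq ?_
  rw [Finset.card_univ, nsmul_eq_mul]

variable [CompleteSpace E]

/-- Affine interpolation of the characteristic coordinates between the two ends. -/
theorem exists_isDiff_boundary (va vb : E) : ∃ x z v g, D.IsDiff x z v g ∧ v a = va ∧ v b = vb := by
  have hab : b - a ≠ 0 := by linarith [D.a_lt_b]
  have ha : a ∈ Icc a b := left_mem_Icc.2 D.a_lt_b.le
  have hb : b ∈ Icc a b := right_mem_Icc.2 D.a_lt_b.le
  set e := (b - a)⁻¹ • (D.S b (D.P vb) - D.S a (D.P va)) with he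
  have hw : ∀ ξ, HasDerivAt (fun ξ : ℝ => D.S a (D.P va) + (ξ - a) • e) e ξ := fun ξ => by
    simpa using (((hasDerivAt_id ξ).sub_const a).smul_const e).const_add (D.S a (D.P va))
  obtain ⟨x, z, h, -⟩ := D.exists_isDiff hw continuous_const
  refine ⟨x, z, _, _, h, ?_, ?_⟩
  · simp [D.R_S a ha, D.Pinv_P]
  · simp only [he, smul_smul, mul_inv_cancel₀ hab, one_smul, add_sub_cancel, D.R_S b hb, D.Pinv_P]

variable [FiniteDimensional ℝ E]

/-- The boundary values are controlled by their outgoing part and the input. -/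
theorem exists_boundary_bound {B : E × E →L[ℝ] U}
    {T : C0Semigroup ℝ (Lp E 1 (volume.restrict (Icc a b)))} (hT : T.IsGenerator (D.graph B))
    {M : ℝ} (hM : ∀ t, ‖T.T t‖ ≤ M) :
    ∃ K, 0 ≤ K ∧ ∀ va vb, ‖(va, vb)‖ ≤ K * (∑ i, ‖D.outgoing va vb i‖ + ‖B (va, vb)‖) := by
  -- Outgoing part and input together are injective on boundary values by `boundary_eq_zero`; in
  -- finite dimension an injective linear map is bounded below.
  have hker : LinearMap.ker ((D.outgoingL.prod B : E × E →L[ℝ] (ι → 𝕜) × U) :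
      E × E →ₗ[ℝ] (ι → 𝕜) × U) = ⊥ := by
    rw [LinearMap.ker_eq_bot']
    rintro ⟨va, vb⟩ h
    have h1 : D.outgoingL (va, vb) = 0 := (Prod.ext_iff.1 h).1
    have h2 : B (va, vb) = 0 := (Prod.ext_iff.1 h).2
    rw [outgoingL_apply] at h1
    obtain ⟨h3, h4⟩ := D.boundary_eq_zero hT hM (va := va) (vb := vb) (fun i => congrFun h1 i)
      fun x z v g hD h5 h6 => ⟨v, g, hD, by rw [h5, h6, h2]⟩
    rw [h3, h4, Prod.mk_zero_zero]
  obtain ⟨K, -, hK⟩ := LinearMap.exists_antilipschitzWith _ hker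
  refine ⟨K, K.2, fun va vb => ?_⟩
  have h1 := hK.le_mul_dist (va, vb) 0
  rw [map_zero, dist_zero_right, dist_zero_right] at h1
  refine h1.trans (mul_le_mul_of_nonneg_left ?_ K.2)
  have hs : 0 ≤ ∑ i, ‖D.outgoing va vb i‖ := Finset.sum_nonneg fun i _ => norm_nonneg _
  refine max_le ?_ ?_
  · change ‖D.outgoingL (va, vb)‖ ≤ _
    rw [outgoingL_apply]
    refine le_add_of_le_of_nonneg ((pi_norm_le_iff_of_nonneg hs).2 fun i => ?_) (norm_nonneg _)
    exact Finset.single_le_sum (f := fun i => ‖D.outgoing va vb i‖)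
      (fun i _ => norm_nonneg _) (Finset.mem_univ i)
  · exact le_add_of_nonneg_left hs

theorem exists_energyEstimate {B : E × E →L[ℝ] U} (O : E × E →L[ℝ] Y)
    {T : C0Semigroup ℝ (Lp E 1 (volume.restrict (Icc a b)))} (hT : T.IsGenerator (D.graph B))
    {M : ℝ} (hM : ∀ t, ‖T.T t‖ ≤ M)
    {N : Lp E 1 (volume.restrict (Icc a b)) × Lp E 1 (volume.restrict (Icc a b)) →L[ℝ]
      Lp E 1 (volume.restrict (Icc a b))}
    {va vb : Lp E 1 (volume.restrict (Icc a b)) × Lp E 1 (volume.restrict (Icc a b)) →L[ℝ] E}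
    (hN : ∀ x z, N (x, z) = 0 → ∃ v g, D.IsDiff x z v g)
    (hv : ∀ x z v g, D.IsDiff x z v g → N (x, z) = 0 ∧ v a = va (x, z) ∧ v b = vb (x, z)) :
    EnergyEstimate N (B.comp (va.prod vb)) (O.comp (va.prod vb)) := by
  obtain ⟨K, hK0, hK⟩ := D.exists_boundary_bound hT hM
  set K' := Fintype.card ι * ‖D.incomingL‖ * K with hK'
  have hK'0 : 0 ≤ K' := by positivity
  -- The incoming values are at most `K'` times outgoing part plus input. With `δ K' ≤ 1 / 2`, they
  -- use up at most half of the outgoing dissipation.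
  set δ := (2 * K' + 1)⁻¹ with hδ
  have hδ0 : 0 < δ := by positivity
  have hδ1 : δ ≤ 1 := inv_le_one_of_one_le₀ (by linarith)
  have hδK : δ * K' ≤ 1 / 2 := by
    rw [hδ, inv_mul_le_iff₀ (by positivity)]
    linarith
  obtain ⟨c₀, C, hc₀, hC, hJ⟩ := D.exists_dissipative hδ0 hδ1
  have hin : ∀ wa wb : E, ∑ i, (δ * ‖D.incoming wa wb i‖ - ‖D.outgoing wa wb i‖) ≤
      -(1 / 2 * ∑ i, ‖D.outgoing wa wb i‖) + 1 / 2 * ‖B (wa, wb)‖ := fun wa wb => by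
    have h1 : ∑ i, ‖D.incoming wa wb i‖ ≤ K' * (∑ i, ‖D.outgoing wa wb i‖ + ‖B (wa, wb)‖) := by
      refine (D.sum_norm_incoming_le wa wb).trans ?_
      rw [hK', mul_assoc _ K]
      exact mul_le_mul_of_nonneg_left (hK wa wb) (by positivity)
    have h2 := mul_le_mul_of_nonneg_left h1 hδ0.le
    rw [← mul_assoc] at h2
    have hs : 0 ≤ ∑ i, ‖D.outgoing wa wb i‖ := Finset.sum_nonneg fun i _ => norm_nonneg _
    have h3 := mul_le_mul_of_nonneg_right hδK (add_nonneg hs (norm_nonneg (B (wa, wb))))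
    rw [Finset.sum_sub_distrib, ← Finset.mul_sum]
    linarith
  set o : Lp E 1 (volume.restrict (Icc a b)) × Lp E 1 (volume.restrict (Icc a b)) → ℝ :=
    fun p => 1 / 2 * ∑ i, ‖D.outgoing (va p) (vb p) i‖ with ho
  have hoc : Continuous o := by
    have h1 : ∀ i, Continuous fun p => D.outgoing (va p) (vb p) i := fun i => by
      simp only [← outgoingL_apply]
      exact (continuous_apply i).comp
        (D.outgoingL.continuous.comp (va.continuous.prodMk vb.continuous))
    exact continuous_const.mul (continuous_finsetSum _ fun i _ => (h1 i).norm)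
  have ho0 : ∀ p, 0 ≤ o p := fun p =>
    mul_nonneg (by norm_num) (Finset.sum_nonneg fun i _ => norm_nonneg _)
  set C' := C + 2 * (‖O‖ * K) + 1 with hC'
  have hOK : 0 ≤ ‖O‖ * K := by positivity
  refine energyEstimate_of_dissipative (o := o) hoc ho0 hc₀ (C := C') (by positivity) ?_ ?_
  · rintro p -
    have h1 : ‖O (va p, vb p)‖ ≤ ‖O‖ * K * (2 * o p + ‖B (va p, vb p)‖) := by
      rw [mul_assoc]
      refine O.le_of_opNorm_le_of_le le_rfl ((hK (va p) (vb p)).trans_eq ?_)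
      rw [ho]
      ring
    refine h1.trans ?_
    change _ ≤ C' * (o p + ‖B (va p, vb p)‖)
    have h2 := ho0 p
    have h3 := norm_nonneg (B (va p, vb p))
    nlinarith [mul_nonneg hOK h3, mul_nonneg hC h2, mul_nonneg hC h3]
  · intro η hη
    obtain ⟨J, L, h1, h2, h3, h4⟩ := hJ η hη
    have hCC : C ≤ C' := by linarith
    refine ⟨J, L, fun x => ⟨(h1 x).1, (h1 x).2.trans (by gcongr)⟩, h2,
      fun x h => (h3 x h).trans (by gcongr), fun x z hxz => ?_⟩
    obtain ⟨v, g, hD⟩ := hN x z hxz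
    obtain ⟨-, e1, e2⟩ := hv x z v g hD
    have h5 := h4 x z v g hD
    rw [e1, e2] at h5
    have h6 := hin (va (x, z)) (vb (x, z))
    have h7 := norm_nonneg (B (va (x, z), vb (x, z)))
    have h8 := norm_nonneg x
    change L x z ≤ -o (x, z) + C' * (‖B (va (x, z), vb (x, z))‖ + ‖x‖ + η)
    have h9 : C * (‖x‖ + η) ≤ C' * (‖x‖ + η) := by gcongr
    have h10 : 1 * ‖B (va (x, z), vb (x, z))‖ ≤ C' * ‖B (va (x, z), vb (x, z))‖ := by
      gcongr
      linarith
    simp only [ho]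
    linarith

theorem exists_output_bound [FiniteDimensional ℝ U] [CompleteSpace Y] {B : E × E →L[ℝ] U}
    (hB : Function.Surjective B) (O : E × E →L[ℝ] Y)
    {T : C0Semigroup ℝ (Lp E 1 (volume.restrict (Icc a b)))} (hT : T.IsGenerator (D.graph B))
    (hstab : T.IsExponentiallyStable) :
    ∃ C, 0 ≤ C ∧ ∀ (x x' : ℝ → Lp E 1 (volume.restrict (Icc a b))) (v g : ℝ → ℝ → E),
      (∀ t ∈ Ici (0 : ℝ), HasDerivWithinAt x (x' t) (Ici 0) t) → ContinuousOn x' (Ici 0) →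
      x 0 = 0 → (∀ t ∈ Ici (0 : ℝ), D.IsDiff (x t) (x' t) (v t) (g t)) → ∀ t β : ℝ, 0 ≤ t →
      (∀ s ∈ Icc 0 t, ‖B (v s a, v s b)‖ ≤ β) → ‖O (v t a, v t b)‖ ≤ C * β := by
  have ha : a ∈ Icc a b := left_mem_Icc.2 D.a_lt_b.le
  have hb : b ∈ Icc a b := right_mem_Icc.2 D.a_lt_b.le
  obtain ⟨M, hM⟩ : ∃ M, ∀ t, ‖T.T t‖ ≤ M := by
    obtain ⟨M, ω, hω, h⟩ := hstab
    refine ⟨|M|, fun t => (h t).trans ?_⟩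
    have h1 : Real.exp (-ω * t) ≤ 1 := Real.exp_le_one_iff.2 (by nlinarith [t.2, t.coe_nonneg])
    calc M * Real.exp (-ω * t) ≤ |M| * Real.exp (-ω * t) := by
          gcongr
          exact le_abs_self M
      _ ≤ |M| * 1 := by gcongr
      _ = |M| := mul_one _
  obtain ⟨N, va, vb, hN, hv⟩ := D.exists_graph
  have henergy := D.exists_energyEstimate O hT hM hN hv
  have hgraph : D.graph B = {p | N p = 0 ∧ (B.comp (va.prod vb)) p = 0} := by
    ext ⟨x, z⟩
    constructor
    · rintro ⟨v, g, hD, h⟩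
      obtain ⟨h1, h2, h3⟩ := hv x z v g hD
      rw [h2, h3] at h
      exact ⟨h1, h⟩
    · rintro ⟨h1, h⟩
      obtain ⟨v, g, hD⟩ := hN x z h1
      obtain ⟨-, h2, h3⟩ := hv x z v g hD
      refine ⟨v, g, hD, ?_⟩
      rw [h2, h3]
      exact h
  have hsurj : ∀ u, ∃ q p, N (q, p) = 0 ∧ (B.comp (va.prod vb)) (q, p) = u := fun u => by
    obtain ⟨⟨wa, wb⟩, h⟩ := hB u
    obtain ⟨x, z, v, g, hD, h1, h2⟩ := D.exists_isDiff_boundary wa wb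
    obtain ⟨h3, h4, h5⟩ := hv x z v g hD
    refine ⟨x, z, h3, ?_⟩
    change B (va (x, z), vb (x, z)) = u
    rw [← h4, ← h5, h1, h2, h]
  obtain ⟨C, hC0, hC⟩ := _root_.exists_output_bound (hgraph ▸ hT) hstab henergy hsurj
  refine ⟨C, hC0, fun x x' v g hx hx' hx0 hD t β ht hβ => ?_⟩
  -- `x 0 = 0` forces `v 0 = 0` on `[a, b]`, so `(0, x' 0)` lies in the graph of the generator,
  -- whose value at zero is zero. This makes the extension by zero to negative times continuously
  -- differentiable.
  have hx0' : x' 0 = 0 := by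
    have hD0 := hD 0 self_mem_Ici
    rw [hx0] at hD0
    have h1 : ∀ᵐ ξ ∂volume.restrict (Icc a b), v 0 ξ = 0 := by
      filter_upwards [hD0.v_ae, Lp.coeFn_zero E 1 (volume.restrict (Icc a b))] with ξ h2 h3
      rw [h2, h3, Pi.zero_apply, map_zero]
    have h2 : ContinuousOn (v 0) (Icc a b) :=
      (continuousOn_const.add (continuousOn_primitive_of_integrableOn hD0.g_int)).congr hD0.v_eq
    have h3 := Measure.eqOn_Icc_of_ae_eq volume D.a_lt_b.ne h1 h2 continuousOn_const
    have h4 : ((0 : Lp E 1 (volume.restrict (Icc a b))), x' 0) ∈ D.graph B :=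
      ⟨v 0, g 0, hD0, by rw [h3 ha, h3 hb, Prod.mk_zero_zero, map_zero]⟩
    have h5 := (hT 0 (x' 0)).1 h4
    simp only [map_zero, sub_zero, smul_zero] at h5
    exact tendsto_nhds_unique h5 tendsto_const_nhds
  have htraj : IsTrajectory N ((Ici 0).indicator x) ((Ici 0).indicator x') := by
    refine ⟨hasDerivAt_indicator_Ici hx hx0 hx0', continuous_indicator_Ici hx' hx0', fun t => ?_⟩
    by_cases h : t ∈ Ici (0 : ℝ)
    · rw [indicator_of_mem h, indicator_of_mem h]
      exact (hv _ _ _ _ (hD t h)).1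
    · rw [indicator_of_notMem h, indicator_of_notMem h, Prod.mk_zero_zero, map_zero]
  have hbd : ∀ s, 0 ≤ s → (va.prod vb) ((Ici 0).indicator x s, (Ici 0).indicator x' s) =
      (v s a, v s b) := fun s hs => by
    rw [indicator_of_mem (mem_Ici.2 hs), indicator_of_mem (mem_Ici.2 hs)]
    obtain ⟨-, h1, h2⟩ := hv _ _ _ _ (hD s hs)
    rw [h1, h2]
    rfl
  have hneg : ∀ s ≤ 0, (Ici 0).indicator x s = 0 := fun s hs => by
    rcases eq_or_lt_of_le hs with rfl | h
    · rw [indicator_of_mem self_mem_Ici, hx0]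
    · exact indicator_of_notMem (by simpa using h) _
  have h := hC _ _ htraj hneg t β ht fun s hs => by
    rw [ContinuousLinearMap.comp_apply, hbd s hs.1]
    exact hβ s hs
  rwa [ContinuousLinearMap.comp_apply, hbd t ht] at h

end DiagForm

/-! ### Continuous representatives of the coefficients. -/

theorem ContDiffOn.exists_hasDerivAt_extension {F : Type*} [NormedAddCommGroup F] [NormedSpace ℝ F]
    [CompleteSpace F] {f : ℝ → F} {a b : ℝ} (hab : a < b) (hf : ContDiffOn ℝ 1 f (Icc a b)) :
    ∃ g g' : ℝ → F, (∀ ξ, HasDerivAt g (g' ξ) ξ) ∧ Continuous g' ∧ EqOn g f (Icc a b) := by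
  have hd : ContinuousOn (derivWithin f (Icc a b)) (Icc a b) :=
    hf.continuousOn_derivWithin (uniqueDiffOn_Icc hab) le_rfl
  -- The derivative is continued by its endpoint values and then integrated.
  set g' := IccExtend hab.le ((Icc a b).domRestrict (derivWithin f (Icc a b))) with hg'
  have hc : Continuous g' := hd.domRestrict.Icc_extend'
  refine ⟨fun ξ => f a + ∫ s in a..ξ, g' s, g', fun ξ => ?_, hc, fun ξ hξ => ?_⟩
  · exact (intervalIntegral.integral_hasDerivAt_right (hc.intervalIntegrable _ _)
      hc.aestronglyMeasurable.stronglyMeasurableAtFilter hc.continuousAt).const_add _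
  · have h := intervalIntegral.integral_eq_sub_of_hasDeriv_right_of_le (f := f) (f' := g') hξ.1
      (hf.continuousOn.mono (Icc_subset_Icc_right hξ.2)) (fun x hx => ?_)
      (hc.intervalIntegrable _ _)
    · simp only [h]
      abel
    · have hx' : x ∈ Icc a b := ⟨hx.1.le, hx.2.le.trans hξ.2⟩
      have h1 : g' x = derivWithin f (Icc a b) x := IccExtend_of_mem _ _ hx'
      rw [h1]
      have h2 := (hf.differentiableOn one_ne_zero x hx').hasDerivWithinAt
      exact (h2.hasDerivAt (Icc_mem_nhds hx.1 (hx.2.trans_le hξ.2))).hasDerivWithinAt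

/-- The diagonalisation holds only almost everywhere, while `DiagForm` wants it on all of `[a, b]`.
So `H` is replaced by the continuous function `P⁻¹ R Δ S`, with `Δ` the diagonal part; since `P` and
`S` are invertible, it agrees with `H` almost everywhere. The other coefficients are extended from
`[a, b]` to the line. -/
theorem exists_diagForm {𝕜 E ι : Type*} [RCLike 𝕜] [NormedAddCommGroup E] [NormedSpace ℝ E]
    [FiniteDimensional ℝ E] [CompleteSpace E] [Fintype ι] {a b : ℝ} (hab : a < b)
    {P Pinv : E →L[ℝ] E} (hP : ∀ v, P (Pinv v) = v) (hP' : ∀ v, Pinv (P v) = v) {Q : ℝ → E →L[ℝ] E}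
    (hQ : MemLp Q ∞ (volume.restrict (Icc a b))) {π : ι → E →L[ℝ] 𝕜}
    (hπ : ∀ i v, ‖π i v‖ ≤ ‖v‖) (hπ' : ∀ v, ‖v‖ ≤ ∑ i, ‖π i v‖) {emb : (ι → 𝕜) →L[ℝ] E}
    (hemb : ∀ i c, π i (emb c) = c i) {S R : ℝ → E →L[ℝ] E} (hS : ContDiffOn ℝ 1 S (Icc a b))
    (hRS : ∀ ξ ∈ Icc a b, ∀ v, R ξ (S ξ v) = v) (hSR : ∀ ξ ∈ Icc a b, ∀ v, S ξ (R ξ v) = v)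
    {d : ι → ℝ → ℝ} (hd : ∀ i, ContinuousOn (d i) (Icc a b))
    (hd0 : ∀ i, ∀ ξ ∈ Icc a b, 0 < d i ξ) {σ : ι → ℝ} (hσ : ∀ i, σ i = 1 ∨ σ i = -1)
    {H : ℝ → E →L[ℝ] E} (hH : ∀ᵐ ξ ∂volume.restrict (Icc a b), ∀ x i,
      π i (S ξ (P (H ξ x))) = (σ i * d i ξ) • π i (S ξ x)) :
    ∃ D : DiagForm 𝕜 E ι a b, D.P = P ∧ D.Q = Q ∧
      ∀ᵐ ξ ∂volume.restrict (Icc a b), D.H ξ = H ξ := by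
  have hext : ∀ {v w : E}, (∀ i, π i v = π i w) → v = w := by
    intro v w h
    have h1 := hπ' (v - w)
    simp only [map_sub, h, sub_self, norm_zero, Finset.sum_const_zero] at h1
    exact sub_eq_zero.1 (norm_le_zero_iff.1 h1)
  have hR : ContDiffOn ℝ 1 R (Icc a b) := by
    have hu : ∀ ξ ∈ Icc a b, ∃ u : (E →L[ℝ] E)ˣ, (u : E →L[ℝ] E) = S ξ ∧ Ring.inverse (S ξ) = R ξ :=
      fun ξ hξ => by
        let u : (E →L[ℝ] E)ˣ := ⟨S ξ, R ξ, ContinuousLinearMap.ext (hSR ξ hξ),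
          ContinuousLinearMap.ext (hRS ξ hξ)⟩
        exact ⟨u, rfl, Ring.inverse_unit u⟩
    have h1 : ContDiffOn ℝ 1 (fun ξ => Ring.inverse (S ξ)) (Icc a b) := fun ξ hξ => by
      obtain ⟨u, hu, -⟩ := hu ξ hξ
      have h2 := contDiffAt_ringInverse ℝ (n := 1) u
      rw [hu] at h2
      exact h2.comp_contDiffWithinAt ξ (hS ξ hξ)
    exact h1.congr fun ξ hξ => by
      obtain ⟨u, -, h⟩ := hu ξ hξ
      exact h.symm
  obtain ⟨S₁, S₁', hS1, hS1', hSe⟩ := hS.exists_hasDerivAt_extension hab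
  obtain ⟨R₁, R₁', hR1, hR1', hRe⟩ := hR.exists_hasDerivAt_extension hab
  have hS1c : Continuous S₁ := continuous_iff_continuousAt.2 fun ξ => (hS1 ξ).continuousAt
  have hR1c : Continuous R₁ := continuous_iff_continuousAt.2 fun ξ => (hR1 ξ).continuousAt
  let d₁ : ι → ℝ → ℝ := fun i => IccExtend hab.le ((Icc a b).domRestrict (d i))
  have hd1 : ∀ i, ∀ ξ ∈ Icc a b, d₁ i ξ = d i ξ := fun i ξ hξ => IccExtend_of_mem _ _ hξ
  have hd1c : ∀ i, Continuous (d₁ i) := fun i => (hd i).domRestrict.Icc_extend'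
  let Δ : ℝ → E →L[ℝ] E := fun ξ =>
    emb.comp (ContinuousLinearMap.pi fun i => (σ i * d₁ i ξ) • π i)
  have hΔ : ∀ ξ v i, π i (Δ ξ v) = (σ i * d₁ i ξ) • π i v := fun ξ v i => hemb i _
  have hΔc : Continuous Δ := by
    refine continuous_clm_apply.2 fun v => emb.continuous.comp (continuous_pi fun i => ?_)
    exact (continuous_const.mul (hd1c i)).smul continuous_const
  let H₁ : ℝ → E →L[ℝ] E := fun ξ => Pinv.comp ((R₁ ξ).comp ((Δ ξ).comp (S₁ ξ)))
  have hH1c : Continuous H₁ := by fun_prop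
  have hSPH : ∀ ξ ∈ Icc a b, ∀ x i, π i (S₁ ξ (P (H₁ ξ x))) = (σ i * d₁ i ξ) • π i (S₁ ξ x) :=
    fun ξ hξ x i => by
      change π i (S₁ ξ (P (Pinv (R₁ ξ (Δ ξ (S₁ ξ x)))))) = _
      rw [hP, hSe hξ, hRe hξ, hSR ξ hξ, hΔ]
  let D : DiagForm 𝕜 E ι a b :=
    { a_lt_b := hab, P := P, Pinv := Pinv, P_Pinv := hP, Pinv_P := hP', Q := Q, memLp_Q := hQ,
      H := H₁, memLp_H := hH1c.memLp_top_restrict_Icc, π := π, norm_π_le := hπ, norm_le := hπ',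
      emb := emb, π_emb := hemb, S := S₁, S' := S₁', R := R₁, R' := R₁', hasDerivAt_S := hS1,
      continuous_S' := hS1', hasDerivAt_R := hR1, continuous_R' := hR1',
      R_S := fun ξ hξ v => by rw [hSe hξ, hRe hξ, hRS ξ hξ],
      S_R := fun ξ hξ v => by rw [hSe hξ, hRe hξ, hSR ξ hξ],
      d := d₁, continuous_d := hd1c, d_pos := fun i ξ => hd0 i _ (Subtype.coe_prop _),
      σ := σ, σ_eq := hσ, S_P_H := hSPH }
  refine ⟨D, rfl, rfl, ?_⟩
  filter_upwards [hH, ae_restrict_mem measurableSet_Icc] with ξ h1 hξ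
  ext x
  have h2 : S ξ (P (H₁ ξ x)) = S ξ (P (H ξ x)) := by
    refine hext fun i => ?_
    have h3 := hSPH ξ hξ x i
    rw [hSe hξ] at h3
    rw [h3, h1, hd1 i ξ hξ]
  have h3 := congrArg (fun v => Pinv (R ξ v)) h2
  simp only [hRS ξ hξ, hP'] at h3
  exact h3

/-! ### Matrices as real-linear operators on euclidean space. -/

section Matrix

variable {𝕜 ι : Type*} [RCLike 𝕜] [Fintype ι] [DecidableEq ι]

/-- The real-linear operator on euclidean space given by a matrix. -/
noncomputable def euclideanCLM (A : Matrix ι ι 𝕜) :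
    EuclideanSpace 𝕜 ι →L[ℝ] EuclideanSpace 𝕜 ι :=
  LinearMap.toContinuousLinearMap (A.toEuclideanLin.restrictScalars ℝ)

theorem euclideanCLM_apply (A : Matrix ι ι 𝕜) (v : EuclideanSpace 𝕜 ι) :
    euclideanCLM A v = A.toEuclideanLin v := rfl

/-- Passing from entries to operators is a bounded linear map, so smoothness and integrability of
the entries carry over to the operator-valued functions. -/
theorem exists_euclideanCLM_eq (𝕜 ι : Type*) [RCLike 𝕜] [Fintype ι] [DecidableEq ι] :
    ∃ T : (ι → ι → 𝕜) →L[ℝ] EuclideanSpace 𝕜 ι →L[ℝ] EuclideanSpace 𝕜 ι,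
      ∀ A : Matrix ι ι 𝕜, T (fun i j => A i j) = euclideanCLM A := by
  let ℓ : (ι → ι → 𝕜) →ₗ[ℝ] EuclideanSpace 𝕜 ι →L[ℝ] EuclideanSpace 𝕜 ι :=
    { toFun := fun A => euclideanCLM (Matrix.of A)
      map_add' := fun A B => by
        ext v : 1
        rw [add_apply, euclideanCLM_apply, euclideanCLM_apply, euclideanCLM_apply,
          Matrix.toLpLin_apply, Matrix.toLpLin_apply, Matrix.toLpLin_apply, ← WithLp.toLp_add,
          ← Matrix.add_mulVec]
        rfl
      map_smul' := fun c A => by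
        ext v : 1
        rw [RingHom.id_apply, smul_apply, euclideanCLM_apply, euclideanCLM_apply,
          Matrix.toLpLin_apply, Matrix.toLpLin_apply, ← WithLp.toLp_smul, ← Matrix.smul_mulVec]
        rfl }
  exact ⟨LinearMap.toContinuousLinearMap ℓ, fun A => rfl⟩

theorem contDiffOn_euclideanCLM {A : ℝ → Matrix ι ι 𝕜} {s : Set ℝ} {k : WithTop ℕ∞}
    (hA : ∀ i j, ContDiffOn ℝ k (fun ξ => A ξ i j) s) :
    ContDiffOn ℝ k (fun ξ => euclideanCLM (A ξ)) s := by
  obtain ⟨T, hT⟩ := exists_euclideanCLM_eq 𝕜 ι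
  simp only [← hT]
  exact (ContinuousLinearMap.contDiff (E := ι → ι → 𝕜)
    (F := EuclideanSpace 𝕜 ι →L[ℝ] EuclideanSpace 𝕜 ι) T).comp_contDiffOn
    (contDiffOn_pi.2 fun i => contDiffOn_pi.2 fun j => hA i j)

theorem memLp_euclideanCLM {α : Type*} [MeasurableSpace α] {μ : Measure α} {p : ℝ≥0∞}
    {A : α → Matrix ι ι 𝕜} (hA : ∀ i j, MemLp (fun ξ => A ξ i j) p μ) :
    MemLp (fun ξ => euclideanCLM (A ξ)) p μ := by
  obtain ⟨T, hT⟩ := exists_euclideanCLM_eq 𝕜 ι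
  simp only [← hT]
  exact ContinuousLinearMap.comp_memLp' (E := ι → ι → 𝕜)
    (F := EuclideanSpace 𝕜 ι →L[ℝ] EuclideanSpace 𝕜 ι) T
    (MemLp.of_eval fun i => MemLp.of_eval fun j => hA i j)

theorem euclideanCLM_mul_apply (A B : Matrix ι ι 𝕜) (v : EuclideanSpace 𝕜 ι) :
    euclideanCLM (A * B) v = euclideanCLM A (euclideanCLM B v) := by
  simp [euclideanCLM_apply, Matrix.toLpLin_apply, Matrix.mulVec_mulVec]

theorem euclideanCLM_one_apply (v : EuclideanSpace 𝕜 ι) :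
    euclideanCLM (1 : Matrix ι ι 𝕜) v = v := by
  simp [euclideanCLM_apply]

theorem euclideanCLM_apply_inv_apply {A : Matrix ι ι 𝕜} (hA : IsUnit A) (v : EuclideanSpace 𝕜 ι) :
    euclideanCLM A (euclideanCLM A⁻¹ v) = v := by
  rw [← euclideanCLM_mul_apply, A.mul_nonsing_inv ((A.isUnit_iff_isUnit_det).1 hA),
    euclideanCLM_one_apply]

theorem euclideanCLM_inv_apply_apply {A : Matrix ι ι 𝕜} (hA : IsUnit A) (v : EuclideanSpace 𝕜 ι) :
    euclideanCLM A⁻¹ (euclideanCLM A v) = v := by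
  rw [← euclideanCLM_mul_apply, A.nonsing_inv_mul ((A.isUnit_iff_isUnit_det).1 hA),
    euclideanCLM_one_apply]

theorem EuclideanSpace.norm_le_sum {𝕜 ι : Type*} [RCLike 𝕜] [Fintype ι] (v : EuclideanSpace 𝕜 ι) :
    ‖v‖ ≤ ∑ i, ‖v i‖ := by
  have h := Finset.sum_nonneg (s := Finset.univ) fun i _ => norm_nonneg (v i)
  rw [EuclideanSpace.norm_eq]
  refine Real.sqrt_le_iff.2 ⟨h, ?_⟩
  exact Finset.sum_sq_le_sq_sum_of_nonneg fun i _ => norm_nonneg (v i)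

/-- A matrix acting on pairs of boundary values `(v a, v b)`, stacked as `[v b; v a]`. -/
noncomputable def boundaryCLM (W : Matrix ι (ι ⊕ ι) 𝕜) :
    EuclideanSpace 𝕜 ι × EuclideanSpace 𝕜 ι →L[ℝ] EuclideanSpace 𝕜 ι :=
  LinearMap.toContinuousLinearMap ((W.toEuclideanLin.restrictScalars ℝ).comp
    ({ toFun := fun p => WithLp.toLp 2 (Sum.elim p.2.ofLp p.1.ofLp)
       map_add' := fun p q => by
        ext i
        cases i <;> rfl
       map_smul' := fun c p => by
        ext i
        cases i <;> rfl } :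
      EuclideanSpace 𝕜 ι × EuclideanSpace 𝕜 ι →ₗ[ℝ] EuclideanSpace 𝕜 (ι ⊕ ι)))

theorem boundaryCLM_apply (W : Matrix ι (ι ⊕ ι) 𝕜) (va vb : EuclideanSpace 𝕜 ι) :
    boundaryCLM W (va, vb) = W.toEuclideanLin (WithLp.toLp 2 (Sum.elim vb.ofLp va.ofLp)) := rfl

theorem surjective_boundaryCLM {W : Matrix ι (ι ⊕ ι) 𝕜} (hW : W.rank = Fintype.card ι) :
    Function.Surjective (boundaryCLM W) := by
  intro u
  have h1 : LinearMap.range W.mulVecLin = ⊤ := by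
    refine Submodule.eq_top_of_finrank_eq ?_
    rw [Module.finrank_fintype_fun_eq_card, ← hW]
    rfl
  obtain ⟨w, hw⟩ := LinearMap.range_eq_top.1 h1 u.ofLp
  refine ⟨(WithLp.toLp 2 fun i => w (Sum.inr i), WithLp.toLp 2 fun i => w (Sum.inl i)), ?_⟩
  rw [boundaryCLM_apply, Matrix.toLpLin_apply]
  have h2 : (Sum.elim (fun i => w (Sum.inl i)) fun i => w (Sum.inr i)) = w := by
    ext i
    cases i <;> rfl
  change WithLp.toLp 2 (W.mulVec (Sum.elim (fun i => w (Sum.inl i)) fun i => w (Sum.inr i))) = u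
  rw [h2, ← Matrix.mulVecLin_apply, hw]

end Matrix

/-! ### The system in characteristic form. -/

namespace HBCS

variable {𝕜 : Type*} [RCLike 𝕜] {n : ℕ} (sys : HBCS 𝕜 n)

/-- An equivalence, not just one implication: the graph of the generator has to be identified
exactly. -/
theorem exists_diagForm (h_standing : sys.StandingAssumptions) (h_diag : sys.IsC1Diagonalisable) :
    ∃ D : DiagForm 𝕜 (EuclideanSpace 𝕜 (Fin n)) (Fin n) sys.a sys.b,
      ∀ (x z : sys.StateSpace 1) (v : ℝ → EuclideanSpace 𝕜 (Fin n)),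
        sys.IsDiffExpr 1 x z v ↔ ∃ g, D.IsDiff x z v g := by
  obtain ⟨S, HD, m, -, hS, hHD, hSHD, hdiag⟩ := h_diag
  let T := fun A : Matrix (Fin n) (Fin n) 𝕜 => euclideanCLM A
  have hSC : ContDiffOn ℝ 1 (fun ξ => T (S ξ)) (Icc sys.a sys.b) :=
    contDiffOn_euclideanCLM hS
  have hQ : MemLp (fun ξ => T (sys.P₀ ξ)) ∞ sys.μ := memLp_euclideanCLM h_standing.P₀_bounded
  have hpos : ∀ ξ ∈ Icc sys.a sys.b, ∀ i, 0 < RCLike.re (HD ξ i i) ∧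
      HD ξ i i = (RCLike.re (HD ξ i i) : 𝕜) := fun ξ hξ i => by
    have h1 := RCLike.pos_iff.1 ((hSHD ξ hξ).2.2.diag_pos (i := i))
    refine ⟨h1.1, RCLike.ext (by simp) (by simp [h1.2])⟩
  have hP := h_standing.P₁_isUnit
  obtain ⟨D, hDP, hDQ, hDH⟩ := _root_.exists_diagForm (𝕜 := 𝕜) (ι := Fin n) sys.a_lt_b
    (P := T sys.P₁) (Pinv := T sys.P₁⁻¹)
    (euclideanCLM_apply_inv_apply hP) (euclideanCLM_inv_apply_apply hP) hQ
    (π := fun i => (EuclideanSpace.proj i : EuclideanSpace 𝕜 (Fin n) →L[𝕜] 𝕜).restrictScalars ℝ)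
    (fun i v => PiLp.norm_apply_le v i) EuclideanSpace.norm_le_sum
    (emb := ((EuclideanSpace.equiv (Fin n) 𝕜).symm :
      (Fin n → 𝕜) →L[𝕜] EuclideanSpace 𝕜 (Fin n)).restrictScalars ℝ)
    (fun i c => rfl) hSC (R := fun ξ => T (S ξ)⁻¹)
    (fun ξ hξ => euclideanCLM_inv_apply_apply (hSHD ξ hξ).1)
    (fun ξ hξ => euclideanCLM_apply_inv_apply (hSHD ξ hξ).1)
    (d := fun i ξ => RCLike.re (HD ξ i i))
    (fun i => RCLike.continuous_re.comp_continuousOn (hHD i i).continuousOn)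
    (fun i ξ hξ => (hpos ξ hξ i).1) (σ := fun i => if (i : ℕ) < m then 1 else -1)
    (fun i => by
      split_ifs <;> simp)
    (H := fun ξ => T (sys.H ξ)) (by
      filter_upwards [hdiag, ae_restrict_mem measurableSet_Icc] with ξ h1 hξ x i
      change (T (S ξ) (T sys.P₁ (T (sys.H ξ) x))) i = _ • (T (S ξ) x) i
      have h2 : T sys.P₁ (T (sys.H ξ) x) = T (sys.P₁ * sys.H ξ) x :=
        (euclideanCLM_mul_apply _ _ _).symm
      rw [h2, h1, Matrix.mul_assoc, Matrix.mul_assoc]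
      have h3 : ∀ A : Matrix (Fin n) (Fin n) 𝕜, T (S ξ) (T ((S ξ)⁻¹ * A) x) = T A x := fun A => by
        change euclideanCLM _ (euclideanCLM _ _) = _
        rw [euclideanCLM_mul_apply, euclideanCLM_apply_inv_apply (hSHD ξ hξ).1]
      rw [h3]
      have h4 : T (Matrix.diagonal (fun i : Fin n => if (i : ℕ) < m then (1 : 𝕜) else -1) *
          (HD ξ * S ξ)) x = euclideanCLM
            (Matrix.diagonal (fun i : Fin n => if (i : ℕ) < m then (1 : 𝕜) else -1))
            (euclideanCLM (HD ξ) (T (S ξ) x)) := by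
        change euclideanCLM _ _ = _
        rw [euclideanCLM_mul_apply, euclideanCLM_mul_apply]
      rw [h4]
      generalize T (S ξ) x = w
      have h5 := (hSHD ξ hξ).2.1.diagonal_diag
      rw [← h5, euclideanCLM_apply, euclideanCLM_apply, Matrix.toLpLin_apply,
        Matrix.toLpLin_apply]
      change Matrix.mulVec (Matrix.diagonal fun i : Fin n => if (i : ℕ) < m then (1 : 𝕜) else -1)
        (Matrix.mulVec (Matrix.diagonal (HD ξ).diag) w.ofLp) i = _
      rw [Matrix.mulVec_diagonal, Matrix.mulVec_diagonal, Matrix.diagonal_apply_eq,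
        Matrix.diag_apply,
        (hpos ξ hξ i).2, RCLike.real_smul_eq_coe_mul]
      simp only [RCLike.ofReal_mul, RCLike.ofReal_re]
      split_ifs <;> simp)
  refine ⟨D, fun x z v => ?_⟩
  have hz : ∀ g : ℝ → EuclideanSpace 𝕜 (Fin n), (∀ᵐ ξ ∂sys.μ, z ξ = D.P (g ξ) + D.Q ξ (v ξ)) ↔
      ∀ᵐ ξ ∂sys.μ, z ξ = sys.P₁.toEuclideanLin (g ξ) + (sys.P₀ ξ).toEuclideanLin (v ξ) :=
      fun g => by
    rw [hDP, hDQ]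
    rfl
  have hv : (∀ᵐ ξ ∂sys.μ, v ξ = D.H ξ (x ξ)) ↔
      ∀ᵐ ξ ∂sys.μ, v ξ = (sys.H ξ).toEuclideanLin (x ξ) := by
    refine eventually_congr ?_
    filter_upwards [hDH] with ξ h
    rw [h]
    rfl
  constructor
  · rintro ⟨h1, g, ⟨h2, h3⟩, h4⟩
    exact ⟨g, hv.2 h1, memLp_one_iff_integrable.1 h2, h3, (hz g).2 h4⟩
  · rintro ⟨g, h1, h2, h3, h4⟩
    exact ⟨hv.1 h1, g, ⟨memLp_one_iff_integrable.2 h2, h3⟩, (hz g).1 h4⟩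

end HBCS

/-! ### Restriction of scalars to the reals. -/

namespace C0Semigroup

variable {𝕜 X : Type*} [RCLike 𝕜] [NormedAddCommGroup X] [NormedSpace 𝕜 X] [NormedSpace ℝ X]
  [IsScalarTower ℝ 𝕜 X]

/-- A semigroup of `𝕜`-linear operators as a semigroup of real-linear operators. -/
noncomputable def restrictReal (S : C0Semigroup 𝕜 X) : C0Semigroup ℝ X where
  T t := (S.T t).restrictScalars ℝ
  map_zero := by
    rw [S.map_zero]
    rfl
  map_add s t := by
    rw [S.map_add]
    rfl
  strongly_continuous := S.strongly_continuous

theorem IsGenerator.restrictReal {S : C0Semigroup 𝕜 X} {A : Set (X × X)} (h : S.IsGenerator A) :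
    S.restrictReal.IsGenerator A := fun x z => by
  rw [h x z]
  have h1 : ∀ (r : ℝ) (w : X), ((r : 𝕜))⁻¹ • w = (r : ℝ)⁻¹ • w := fun r w => by
    rw [← RCLike.ofReal_inv, ← algebraMap_smul 𝕜 r⁻¹ w]
  simp only [h1]
  rfl

theorem IsExponentiallyStable.restrictReal {S : C0Semigroup 𝕜 X} (h : S.IsExponentiallyStable) :
    S.restrictReal.IsExponentiallyStable := by
  obtain ⟨M, ω, hω, h⟩ := h
  exact ⟨M, ω, hω, fun t => (ContinuousLinearMap.norm_restrictScalars (S.T t)).trans_le (h t)⟩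

end C0Semigroup

theorem exists_inclusion_L2_L1 {α E : Type*} [MeasurableSpace α] (μ : Measure α) [IsFiniteMeasure μ]
    [NormedAddCommGroup E] [NormedSpace ℝ E] :
    ∃ ι : Lp E 2 μ →L[ℝ] Lp E 1 μ, ∀ x, ι x =ᵐ[μ] x := by
  have hN : MemLp (fun _ : α => ContinuousLinearMap.id ℝ E) 2 μ := memLp_const _
  refine ⟨(ContinuousLinearMap.id ℝ (E →L[ℝ] E)).holderL μ 2 2 1 (hN.toLp _), fun x => ?_⟩
  have h1 := (ContinuousLinearMap.id ℝ (E →L[ℝ] E)).coeFn_holder (r := 1) (hN.toLp _) x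
  filter_upwards [h1, hN.coeFn_toLp] with ξ h2 h3
  rw [h3] at h2
  exact h2

/-- On an interval of positive length, an inequality between continuous functions that holds almost
everywhere holds everywhere. -/
theorem ContinuousOn.norm_le_eLpNorm_top {E : Type*} [NormedAddCommGroup E] {u : ℝ → E} {a b : ℝ}
    (hab : a < b) (hu : ContinuousOn u (Icc a b)) :
    eLpNorm u ∞ (volume.restrict (Icc a b)) ≠ ∞ ∧
      ∀ s ∈ Icc a b, ‖u s‖ ≤ (eLpNorm u ∞ (volume.restrict (Icc a b))).toReal := by
  obtain ⟨K, hK⟩ := isCompact_Icc.exists_bound_of_continuousOn hu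
  have hfin : eLpNorm u ∞ (volume.restrict (Icc a b)) ≠ ∞ := by
    rw [eLpNorm_exponent_top]
    exact ((eLpNormEssSup_le_of_ae_bound
      ((ae_restrict_mem measurableSet_Icc).mono fun s hs => hK s hs)).trans_lt
        ENNReal.ofReal_lt_top).ne
  refine ⟨hfin, ?_⟩
  set β := (eLpNorm u ∞ (volume.restrict (Icc a b))).toReal with hβ
  have h1 : (fun s => max ‖u s‖ β) =ᵐ[volume.restrict (Icc a b)] fun _ => β := by
    filter_upwards [ae_le_eLpNormEssSup (f := u) (μ := volume.restrict (Icc a b))] with s hs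
    refine max_eq_right ?_
    rw [← eLpNorm_exponent_top] at hs
    rw [hβ, ← toReal_enorm]
    exact ENNReal.toReal_mono hfin hs
  have h2 := Measure.eqOn_Icc_of_ae_eq volume hab.ne h1 (hu.norm.sup continuousOn_const)
    continuousOn_const
  exact fun s hs => (le_max_left _ _).trans_eq (h2 hs)

/-! ### From `L²` solutions to `L¹` solutions, and the conclusion. -/

namespace HBCS

variable {𝕜 : Type*} [RCLike 𝕜] {n : ℕ} (sys : HBCS 𝕜 n)

theorem isDiffExpr_one_of_two {ι : sys.StateSpace 2 →L[ℝ] sys.StateSpace 1}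
    (hι : ∀ x, ι x =ᵐ[sys.μ] x) {x z : sys.StateSpace 2} {v : ℝ → EuclideanSpace 𝕜 (Fin n)}
    (h : sys.IsDiffExpr 2 x z v) : sys.IsDiffExpr 1 (ι x) (ι z) v := by
  obtain ⟨h1, g, ⟨h2, h3⟩, h4⟩ := h
  refine ⟨?_, g, ⟨h2.mono_exponent (by norm_num), h3⟩, ?_⟩
  · filter_upwards [h1, hι x] with ξ h5 h6
    rw [h5, h6]
  · filter_upwards [h4, hι z] with ξ h5 h6
    rw [h6, h5]

end HBCS

theorem mainTheorem2 {𝕜 : Type*} [RCLike 𝕜] {n : ℕ} (sys : HBCS 𝕜 n)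
    (h_standing : sys.StandingAssumptions) (h_diag : sys.IsC1Diagonalisable)
    (h_stable : sys.IsExponentiallyStableOn 1) : sys.IsBIBOStable := by
  obtain ⟨D, hD⟩ := sys.exists_diagForm h_standing h_diag
  obtain ⟨T, hT, hstab⟩ := h_stable
  have hgraph : sys.operatorGraph 1 = D.graph (boundaryCLM sys.W_B) := by
    ext ⟨x, z⟩
    constructor
    · rintro ⟨v, h1, h2⟩
      obtain ⟨g, h3⟩ := (hD x z v).1 h1
      exact ⟨v, g, h3, h2⟩
    · rintro ⟨v, g, h1, h2⟩
      exact ⟨v, (hD x z v).2 ⟨g, h1⟩, h2⟩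
  rw [hgraph] at hT
  obtain ⟨C, hC0, hC⟩ := D.exists_output_bound
    (surjective_boundaryCLM (by rw [h_standing.W_B_fullRank, Fintype.card_fin]))
    (boundaryCLM sys.W_C) hT.restrictReal hstab.restrictReal
  obtain ⟨ι, hι⟩ := exists_inclusion_L2_L1 (E := EuclideanSpace 𝕜 (Fin n)) sys.μ
  -- `C` may be zero, whereas the gain has to be positive.
  refine ⟨(C + 1).toNNReal, Real.toNNReal_pos.2 (by positivity), ?_⟩
  rintro u x y ⟨hu, -, x', hx', hsol⟩ hx0 - - t ht
  choose hx v hv hu_eq hy_eq using hsol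
  have hdiff : ∀ s ∈ Ici (0 : ℝ), ∃ v g, D.IsDiff (ι (x s)) (ι (x' s)) v g ∧
      boundaryCLM sys.W_B (v sys.a, v sys.b) = u s ∧
      boundaryCLM sys.W_C (v sys.a, v sys.b) = y s := fun s hs => by
    obtain ⟨g, hg⟩ := (hD _ _ _).1 (sys.isDiffExpr_one_of_two hι (hv s hs))
    exact ⟨v s hs, g, hg, (hu_eq s hs).symm, (hy_eq s hs).symm⟩
  choose! w g hw hwu hwy using hdiff
  obtain ⟨hfin, hβ⟩ := (hu.mono fun s (hs : s ∈ Icc 0 t) => hs.1).norm_le_eLpNorm_top ht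
  set β := (eLpNorm u ∞ (volume.restrict (Icc 0 t))).toReal with hβ'
  have hy : ∀ s ∈ Icc 0 t, ‖y s‖ ≤ C * β := fun s hs => by
    rw [← hwy s hs.1]
    refine hC (fun s => ι (x s)) (fun s => ι (x' s)) w g
      (fun r hr => ι.hasFDerivAt.comp_hasDerivWithinAt r (hx r hr))
      (ι.continuous.comp_continuousOn hx') (by rw [hx0, map_zero]) hw s β hs.1 fun r hr => ?_
    rw [hwu r hr.1]
    exact hβ r ⟨hr.1, hr.2.trans hs.2⟩
  rw [eLpNorm_exponent_top]
  refine (eLpNormEssSup_le_of_ae_bound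
    ((ae_restrict_mem measurableSet_Icc).mono fun s hs => hy s hs)).trans ?_
  rw [ENNReal.ofReal_mul hC0, ENNReal.ofReal_toReal hfin]
  gcongr
  exact ENNReal.ofReal_le_ofReal (by linarith)
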